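/- **Sixth-order Birkhoff normal form.** Let $-\tfrac12\le m\le 1$, $m\ne0$, $\mathbb N=\{1,2,\dots\}$, $\omega_j=\sqrt{j^4+mj^2}$ for $j\in\mathbb N$, $\mu=\min\{2\sqrt{1+m},\tfrac32\sqrt{4+m}\}$, and $\mathfrak c=1$ if $m\ge0$, $\mathfrak c=(1+m)^{-1/2}$ if $m<0$. *Spaces and norms.* Let $\mathtt w=(\mathtt w_j)_{j\in\mathbb N}$ be a real sequence with $\inf_j\mathtt w_j>0$, let $\mathtt h_{\mathtt w}$ be the space of complex sequences with $|z|_{\mathtt w}^2=\sum_j\mathtt w_j^2|z_j|^2<\infty$, and $B_r$ its closed ball of radius $r$ centred at $0$. For a power series $F=\sum_{\alpha,\beta}F_{\alpha,\beta}z^\alpha\bar z^\beta$ put $\underline F=\sum|F_{\alpha,\beta}|z^\alpha\bar z^\beta$ and $|F|_{r,\mathtt w}=r^{-1}\sup_{|z|_{\mathtt w}\le r}\big|(\partial_{\bar z_j}\underline F(z))_j\big|_{\mathtt w}$. Let $\mathcal H_r$ be the set of such $F$ with $F_{\alpha,\beta}=\overline{F_{\beta,\alpha}}$, $F(0)=0$,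 absolutely convergent at every point of $B_r$, and $|F|_{r,\mathtt w}<\infty$. Poisson brackets are $\{F,K\}=\mathrm i\sum_j(\partial_{z_j}F\,\partial_{\bar z_j}K-\partial_{\bar z_j}F\,\partial_{z_j}K)$, and $\Phi_F^t$ is the Hamiltonian flow $\dot z_j=-\mathrm i\,\partial_{\bar z_j}F$, so that $\frac{d}{dt}K\circ\Phi_F^t=\{F,K\}\circ\Phi_F^t$. We say that $F$ has *even index structure* if $F_{\alpha,\beta}\neq0$ implies that $\alpha_j+\beta_j$ is even for all $j$, i.e. if every monomial of $F$ has the form $z_{\ell_1}^{\sigma_1}z_{\ell_1}^{\sigma_1'}\cdots z_{\ell_n}^{\sigma_n}z_{\ell_n}^{\sigma_n'}$ with $\ell_k\in\mathbb N$, signs $\sigma_k,\sigma_k'\in\{+,-\}$, $z^+_j=z_j$, $z^-_j=\bar z_j$. *Hamiltonian.* Let $H=\Lambda+G$ with $\Lambda=\sum_j\omega_j|z_j|^2$ and $$G=\frac1{32\pi}\Big(\sum_j\frac{j^2}{\omega_j}(z_j+\bar z_j)^2\Big)^2=\sum_{i,j,\sigma,\sigma'}G_{ij}\,z_i^{\sigma_1}z_i^{\sigma_1'}z_j^{\sigma_2}z_j^{\sigma_2'},\qquad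 G_{ij}=\frac1{32\pi}\frac{i^2j^2}{\omega_i\omega_j}.$$ Let $\bar G=\sum_{i,j}A_{ij}|z_i|^2|z_j|^2$, where $A_{ij}=\frac1{8\pi}\frac{i^2j^2}{\omega_i\omega_j}$ for $i\ne j$ and $A_{ii}=\frac3{16\pi}\frac{i^4}{\omega_i^2}$. Let $$S=\sum\frac{\mathrm iG_{ij}}{(\sigma_1+\sigma_1')\omega_i+(\sigma_2+\sigma_2')\omega_j}\,z_i^{\sigma_1}z_i^{\sigma_1'}z_j^{\sigma_2}z_j^{\sigma_2'},$$ where the sum runs over all $(i,j,\sigma,\sigma')$ except those with $i\neq j$, $\sigma_1\ne\sigma_1'$, $\sigma_2\neq\sigma_2'$ and those with $i=j$, $\sigma_1+\sigma_1'+\sigma_2+\sigma_2'=0$. *Smallness.* For $r>0$ let $$\gamma_r=\sup_{|z|_{\mathtt w}\le r}\Big(\sum_j\frac{j^2}{\omega_j}|z_j|^2\Big)^{1/2},\qquad \eta_r=\frac{44e\,\mathfrak c}{\pi\mu}\Big(\frac{11\gamma_r}{10}\Big)^2,\qquad C_r=\frac{3\mathfrak c}{2\pi e}\,\frac{\eta_r}{1-\eta_r}\Big(\frac{11\gamma_r}{10}\Big)^2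 .$$ Let $r>0$, $\mathtt r=10r/11$ (so that $11\mathtt r/10=r$), and assume $$\gamma_r\le\frac5{11}\sqrt{\frac{\pi\mu}{22e\,\mathfrak c}},\qquad \tilde\eta_{\mathtt r}:=\frac{352\,e\,C_{11\mathtt r/10}}{7|m|}\le\frac12 .$$ *Conclusion.* (1) Fourth-order normal form. $S\in\mathcal H_{11r/10}$, its flow $\Phi_S^t:B_r\to B_{11r/10}$ exists for $|t|\le1$, and with $\Psi=\Phi_S^1$ one has $H\circ\Psi=\Lambda+\bar G+R$ on $\{z\in B_r:\Lambda(z)<\infty\}$, a set on which $\Lambda\circ\Psi<\infty$; here $R\in\mathcal H_r$ has $|R|_{r,\mathtt w}\le C_r$, even index structure and only monomials of degree $\geq6$. (2) For a multi-index pair put $\Delta_{\alpha,\beta}=\sum_j\omega_j(\alpha_j-\beta_j)$. Let $\bar R$ be the sum of the terms $R_{\alpha,\beta}z^\alpha\bar z^\beta$ with $|\alpha|+|\beta|=6$ and $\Delta_{\alpha,\beta}=0$, and let $\mathcal S=\sum\frac{\mathrm iR_{\alpha,\beta}}{\Delta_{\alpha,\beta}}z^\alpha\bar z^\beta$ over $|\alpha|+|\beta|=6$,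 $\Delta_{\alpha,\beta}\ne0$. Then $\mathcal S,\bar R\in\mathcal H_r$, and $\bar R$ is integrable: $\bar R=\sum_{i,j,k}A_{ijk}|z_i|^2|z_j|^2|z_k|^2$ on $B_r$ for suitable $A_{ijk}\in\mathbb R$. (3) The flow $\Phi_{\mathcal S}^t:B_{\mathtt r}\to B_{11\mathtt r/10}$ exists for $|t|\le1$, and $$\sup_{|z|_{\mathtt w}\le\mathtt r}|\Phi_{\mathcal S}^{\pm1}(z)-z|_{\mathtt w}\le\frac{\mathtt r}{80e},\qquad \Phi_{\mathcal S}^1(\Phi_{\mathcal S}^{-1}(z))=\Phi_{\mathcal S}^{-1}(\Phi_{\mathcal S}^1(z))=z\quad\text{for all } z\in B_{(1-\frac1{80e})\mathtt r}.$$ (4) For every $z\in B_{\mathtt r}$ with $\Lambda(z)<\infty$, $\Lambda$ is finite at $\Phi^1_{\mathcal S}(z)$ and at $\Psi(\Phi^1_{\mathcal S}(z))$, and $$H\circ\Psi\circ\Phi_{\mathcal S}^1=\Lambda+\bar G+\bar R+\mathtt R ,$$ where $\mathtt R\in\mathcal H_{\mathtt r}$ has even index structure, only monomials of degree $\ge8$,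 and $$|\mathtt R|_{\mathtt r,\mathtt w}\le\tilde C_{\mathtt r}:=\frac{\tilde\eta_{\mathtt r}^2}{44e^2}+\frac2e\,\tilde\eta_{\mathtt r}\Big(\frac{\mathfrak c}\pi\gamma_{11\mathtt r/10}^2+C_{11\mathtt r/10}\Big)+\frac{16\mathfrak c}{3e^2\pi^3}\,\frac{\gamma_{11\mathtt r/10}^6}{\mu^2}\Big(1+\frac{2\tilde\eta_{\mathtt r}}e\Big).$$ -/

import Mathlib

noncomputable section

namespace Beam

open ComplexConjugate

/-! ### Frequencies and constants. Modes are indexed by the positive integers. -/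

/-- The linear frequency `ω_j = √(j⁴ + m j²)`. -/
def omega (m : ℝ) (j : ℕ+) : ℝ := √((j : ℝ) ^ 4 + m * (j : ℝ) ^ 2)

/-- `μ = min {2√(1+m), (3/2)√(4+m)}`. -/
def mu (m : ℝ) : ℝ := min (2 * √(1 + m)) (3 / 2 * √(4 + m))

/-- `𝔠 = 1` if `m ≥ 0`, and `𝔠 = (1+m)^{-1/2}` if `m < 0`. -/
def cfrak (m : ℝ) : ℝ := if 0 ≤ m then 1 else 1 / √(1 + m)

/-! ### The weighted space `h_w` -/

/-- A weight: a real sequence with positive infimum. -/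
structure Weight where
  val : ℕ+ → ℝ
  bddBelow' : ∃ c > 0, ∀ j, c ≤ val j

theorem Weight.pos (w : Weight) (j : ℕ+) : 0 < w.val j := by
  obtain ⟨c, hc, h⟩ := w.bddBelow'
  exact hc.trans_le (h j)

/-- The subspace of all sequences `z` with `∑ w_j² |z_j|² < ∞` (see `mem_hSub_iff`). -/
def hSub (w : Weight) : Submodule ℂ (ℕ+ → ℂ) where
  carrier := {z | Memℓp (fun j => (w.val j : ℂ) * z j) 2}
  add_mem' := by
    intro a b ha hb
    have h := Memℓp.add ha hb
    have e : (fun j => (w.val j : ℂ) * (a + b) j)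
        = (fun j => (w.val j : ℂ) * a j) + fun j => (w.val j : ℂ) * b j := by
      funext j
      simp [mul_add]
    simp only [Set.mem_ofPred_eq]
    rw [e]
    exact h
  zero_mem' := by
    have e : (fun j => (w.val j : ℂ) * (0 : ℕ+ → ℂ) j) = 0 := by
      funext j
      simp
    simp only [Set.mem_ofPred_eq]
    rw [e]
    exact zero_memℓp
  smul_mem' := by
    intro c a ha
    have h := Memℓp.const_smul ha c
    have e : (fun j => (w.val j : ℂ) * (c • a) j) = c • fun j => (w.val j : ℂ) * a j := by
      funext j
      simp only [Pi.smul_apply, smul_eq_mul]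
      ring
    simp only [Set.mem_ofPred_eq]
    rw [e]
    exact h

theorem mem_hSub_iff (w : Weight) (z : ℕ+ → ℂ) :
    z ∈ hSub w ↔ Summable fun j => w.val j ^ 2 * ‖z j‖ ^ 2 := by
  change Memℓp (fun j => (w.val j : ℂ) * z j) 2 ↔ _
  rw [memℓp_gen_iff (by norm_num)]
  have e : (fun j => ‖(w.val j : ℂ) * z j‖ ^ (2 : ENNReal).toReal)
      = fun j => w.val j ^ 2 * ‖z j‖ ^ 2 := by
    funext j
    simp [mul_pow]
  rw [e]

/-- The complex space `h_w`, with the norm `|z|_w = (∑ w_j² |z_j|²)^{1/2}` (see `norm_sq_eq`). -/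
def HSpace (w : Weight) : Type := hSub w

instance (w : Weight) : AddCommGroup (HSpace w) := inferInstanceAs (AddCommGroup (hSub w))

instance (w : Weight) : Module ℂ (HSpace w) := inferInstanceAs (Module ℂ (hSub w))

instance (w : Weight) : CoeFun (HSpace w) (fun _ => ℕ+ → ℂ) := ⟨fun z => z.1⟩

/-- The linear embedding `z ↦ (w_j z_j)_j` of `h_w` into `ℓ²`, which defines the norm of `h_w`. -/
def toEll2 (w : Weight) : HSpace w →ₗ[ℂ] lp (fun _ : ℕ+ => ℂ) 2 where
  toFun z := ⟨fun j => (w.val j : ℂ) * z j, z.2⟩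
  map_add' := by
    intro a b
    apply Subtype.ext
    funext j
    exact mul_add _ _ _
  map_smul' := by
    intro c a
    apply Subtype.ext
    funext j
    exact mul_left_comm _ _ _

theorem toEll2_injective (w : Weight) : Function.Injective (toEll2 w) := by
  intro a b h
  apply Subtype.ext
  funext j
  have h1 : (w.val j : ℂ) * a j = (w.val j : ℂ) * b j := congrFun (congrArg Subtype.val h) j
  exact mul_left_cancel₀ (by exact_mod_cast (w.pos j).ne') h1

instance (w : Weight) : NormedAddCommGroup (HSpace w) :=
  NormedAddCommGroup.induced _ _ (toEll2 w) (toEll2_injective w)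

instance (w : Weight) : NormedSpace ℂ (HSpace w) :=
  NormedSpace.induced ℂ _ _ (toEll2 w)

theorem norm_sq_eq (w : Weight) (z : HSpace w) :
    ‖z‖ ^ 2 = ∑' j, w.val j ^ 2 * ‖z j‖ ^ 2 := by
  have h : ‖z‖ = ‖toEll2 w z‖ := rfl
  have h2 := lp.norm_rpow_eq_tsum (p := 2) (by norm_num) (toEll2 w z)
  simp only [ENNReal.toReal_ofNat, Real.rpow_two] at h2
  rw [h, h2]
  refine tsum_congr fun j => ?_
  have : (toEll2 w z : ∀ _ : ℕ+, ℂ) j = (w.val j : ℂ) * z j := rfl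
  rw [this]
  simp [mul_pow]

/-- The closed ball `B_r(h_w)`. -/
abbrev ball (w : Weight) (r : ℝ) : Set (HSpace w) := Metric.closedBall 0 r

/-! ### Hamiltonians given by power series in `z` and `z̄` -/

/-- A pair `(α, β)` of finitely supported multi-indices, standing for the monomial `z^α z̄^β`. -/
abbrev MIdx : Type := (ℕ+ →₀ ℕ) × (ℕ+ →₀ ℕ)

/-- A power series `∑ H_{α,β} z^α z̄^β`, given by its coefficients. -/
abbrev Ham : Type := MIdx → ℂ

/-- The monomial `z^α z̄^β`. -/
def mon (p : MIdx) (z : ℕ+ → ℂ) : ℂ :=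
  (p.1.prod fun j n => z j ^ n) * (p.2.prod fun j n => (conj (z j)) ^ n)

/-- The degree `|α| + |β|`. -/
def deg (p : MIdx) : ℕ := (p.1.sum fun _ n => n) + (p.2.sum fun _ n => n)

/-- The value of the power series at `z`. -/
def Ham.eval (f : Ham) (z : ℕ+ → ℂ) : ℂ := ∑' p : MIdx, f p * mon p z

/-- The partial derivative `∂/∂z̄_j` of the power series, evaluated at `z`. -/
def dzbar (f : Ham) (z : ℕ+ → ℂ) (j : ℕ+) : ℂ :=
  ∑' p : MIdx, f p * (p.2 j : ℂ) * mon (p.1, p.2 - Finsupp.single j 1) z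

/-- The modulus `∑ |H_{α,β}| β_j |z^α z̄^{β - e_j}|` of the `j`-th component of the Hamiltonian
vector field of the majorant `∑ |H_{α,β}| z^α z̄^β` at `(|z_k|)_k`, with value `∞` if it diverges. -/
def majorantField (f : Ham) (z : ℕ+ → ℂ) (j : ℕ+) : ENNReal :=
  ∑' p : MIdx, ‖f p‖ₑ * (p.2 j : ENNReal) * ‖mon (p.1, p.2 - Finsupp.single j 1) z‖ₑ

/-- The majorant norm `|H|_{r,w} = r⁻¹ sup_{|z|_w ≤ r} |X_{H̲}(z)|_w`, with value `∞` if the series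
or the supremum is infinite. As the coefficients of the majorant are nonnegative, and
`(z_j) ↦ (|z_j|)` preserves the ball, the supremum may be taken over the values at `(|z_j|)`. -/
def hamNorm (w : Weight) (r : ℝ) (f : Ham) : ENNReal :=
  (ENNReal.ofReal r)⁻¹ *
    ⨆ z ∈ ball w r, (∑' j, ENNReal.ofReal (w.val j) ^ 2 * majorantField f z j ^ 2) ^ (1 / 2 : ℝ)

/-- The class `𝓗_r(h_w)` of regular Hamiltonians. -/
structure MemHam (w : Weight) (r : ℝ) (f : Ham) : Prop where
  real : ∀ α β, f (α, β) = conj (f (β, α))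
  zero : f (0, 0) = 0
  summable : ∀ z ∈ ball w r, Summable fun p => ‖f p * mon p z‖
  norm_lt : hamNorm w r f < ⊤

/-- All monomials contain each index `j` an even number of times: `α_j + β_j` is even. In other
words every monomial has the form
`z_{ℓ₁}^{σ₁} z_{ℓ₁}^{σ₁'} ⋯ z_{ℓₙ}^{σₙ} z_{ℓₙ}^{σₙ'}`, with `z^+ = z`, `z^- = z̄`. -/
def EvenIndex (f : Ham) : Prop := ∀ p, f p ≠ 0 → ∀ j, Even (p.1 j + p.2 j)

/-- `Φ` is the Hamiltonian flow of `f` for times in `[-1, 1]` and initial data in `B_r(h_w)`, with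
orbits in `B_{r+ρ}(h_w)`. Hamilton's equations `q̇ = ∂_p f`, `ṗ = -∂_q f` read
`ż_j = -i ∂f/∂z̄_j` in the variables `z_j = (q_j + i p_j)/√2`. The derivative is that of curves
in the normed space `h_w`. -/
def IsHamFlow (w : Weight) (f : Ham) (r ρ : ℝ) (Φ : ℝ → HSpace w → HSpace w) : Prop :=
  ∀ z ∈ ball w r, Φ 0 z = z ∧ ∀ t ∈ Set.Icc (-1 : ℝ) 1, Φ t z ∈ ball w (r + ρ) ∧
    ∃ v : HSpace w, (∀ j, v j = -Complex.I * dzbar f (Φ t z) j) ∧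
      HasDerivWithinAt (fun s => Φ s z) v (Set.Icc (-1 : ℝ) 1) t

/-! ### The beam Hamiltonian -/

/-- `z` lies in the domain of `Λ`. -/
def FiniteEnergy (m : ℝ) (z : ℕ+ → ℂ) : Prop := Summable fun j => omega m j * ‖z j‖ ^ 2

/-- `Λ = ∑ ω_j z_j z̄_j`. -/
def Lam (m : ℝ) (z : ℕ+ → ℂ) : ℝ := ∑' j, omega m j * ‖z j‖ ^ 2

/-- `G = (1/32π) (∑ (j²/ω_j) (z_j + z̄_j)²)²`; here `z_j + z̄_j = 2 Re z_j`. -/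
def Gfun (m : ℝ) (z : ℕ+ → ℂ) : ℝ :=
  1 / (32 * Real.pi) * (∑' j : ℕ+, (j : ℝ) ^ 2 / omega m j * (2 * (z j).re) ^ 2) ^ 2

/-- The Hamiltonian `H = Λ + G` of the beam equation. -/
def Hbeam (m : ℝ) (z : ℕ+ → ℂ) : ℝ := Lam m z + Gfun m z

/-- `A_{ij}`. -/
def Acoef (m : ℝ) (i j : ℕ+) : ℝ :=
  if i = j then 3 / (16 * Real.pi) * ((i : ℝ) ^ 4 / omega m i ^ 2)
  else 1 / (8 * Real.pi) * ((i : ℝ) ^ 2 * (j : ℝ) ^ 2 / (omega m i * omega m j))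

/-- `Ḡ = ∑_{i,j} A_{ij} |z_i|² |z_j|²`, the integrable part of `G`. -/
def Gbar (m : ℝ) (z : ℕ+ → ℂ) : ℝ :=
  ∑' q : ℕ+ × ℕ+, Acoef m q.1 q.2 * ‖z q.1‖ ^ 2 * ‖z q.2‖ ^ 2

/-! ### The generating function of the fourth order step -/

/-- Indices `(i, j, σ, σ')` of the monomials `z_i^{σ₁} z_i^{σ₁'} z_j^{σ₂} z_j^{σ₂'}`;
`true` is the sign `+` (the factor `z`), and `false` is the sign `-` (the factor `z̄`). -/
structure QIdx where
  i : ℕ+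
  j : ℕ+
  s₁ : Bool
  s₂ : Bool
  s₁' : Bool
  s₂' : Bool

/-- The value `±1` of a sign. -/
def sgn (s : Bool) : ℤ := if s then 1 else -1

/-- The multi-index of `z_i^σ`. -/
def single (i : ℕ+) (s : Bool) : MIdx :=
  if s then (Finsupp.single i 1, 0) else (0, Finsupp.single i 1)

/-- The multi-index of `z_i^{σ₁} z_i^{σ₁'} z_j^{σ₂} z_j^{σ₂'}`. -/
def QIdx.midx (q : QIdx) : MIdx :=
  single q.i q.s₁ + single q.i q.s₁' + single q.j q.s₂ + single q.j q.s₂'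

/-- The index set `𝓘` of the integrable monomials of `G`. -/
def QIdx.Integrable (q : QIdx) : Prop :=
  (q.i ≠ q.j → q.s₁ ≠ q.s₁' ∧ q.s₂ ≠ q.s₂') ∧
    (q.i = q.j → sgn q.s₁ + sgn q.s₁' + sgn q.s₂ + sgn q.s₂' = 0)

/-- `Δ_{ij}^{σ,σ'} = (σ₁ + σ₁') ω_i + (σ₂ + σ₂') ω_j`. -/
def QIdx.Delta (m : ℝ) (q : QIdx) : ℝ :=
  ((sgn q.s₁ + sgn q.s₁' : ℤ) : ℝ) * omega m q.i + ((sgn q.s₂ + sgn q.s₂' : ℤ) : ℝ) * omega m q.j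

/-- `G_{ij} = (1/32π) i² j² / (ω_i ω_j)`. -/
def Gcoef (m : ℝ) (i j : ℕ+) : ℝ :=
  1 / (32 * Real.pi) * ((i : ℝ) ^ 2 * (j : ℝ) ^ 2 / (omega m i * omega m j))

/-- `S = ∑_{𝓘ᶜ} (i G_{ij} / Δ_{ij}^{σ,σ'}) z_i^{σ₁} z_i^{σ₁'} z_j^{σ₂} z_j^{σ₂'}`, the generating
function of the fourth order step. Each coefficient is a sum of finitely many nonzero terms. -/
def S4 (m : ℝ) : Ham := fun p =>
  ∑ᶠ (q : QIdx) (_ : q.midx = p ∧ ¬ q.Integrable),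
    Complex.I * (Gcoef m q.i q.j : ℂ) / (q.Delta m : ℂ)

/-! ### The sixth order step -/

/-- The divisor `∑_j ω_j (α_j - β_j)` of the monomial `z^α z̄^β`, so that
`{z^α z̄^β, Λ} = i (∑_j ω_j (α_j - β_j)) z^α z̄^β`. -/
def divisor (m : ℝ) (p : MIdx) : ℝ :=
  (p.1.sum fun j n => (n : ℝ) * omega m j) - p.2.sum fun j n => (n : ℝ) * omega m j

open Classical in
/-- `R̄`: the resonant (zero divisor) part of the homogeneous part of degree `6` of `R`. -/
def Rbar (m : ℝ) (R : Ham) : Ham := fun p =>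
  if deg p = 6 ∧ divisor m p = 0 then R p else 0

open Classical in
/-- `𝓢`: the generating function of the sixth order step, with coefficients `i R_{α,β} / Δ` on the
non-resonant monomials of degree `6` of `R`, solving `R⁽⁶⁾ + {𝓢, Λ} = R̄`. -/
def S6 (m : ℝ) (R : Ham) : Ham := fun p =>
  if deg p = 6 ∧ divisor m p ≠ 0 then Complex.I * R p / (divisor m p : ℂ) else 0

/-! ### Smallness constants -/

/-- `γ_r = sup_{|z|_w ≤ r} (∑ (j²/ω_j) |z_j|²)^{1/2}`. -/
def gam (m : ℝ) (w : Weight) (r : ℝ) : ℝ :=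
  ⨆ z : ball w r, √(∑' j : ℕ+, (j : ℝ) ^ 2 / omega m j * ‖(z : HSpace w) j‖ ^ 2)

/-- `η_r = (44 e 𝔠 / (π μ)) (11 γ_r / 10)²`. -/
def eta (m : ℝ) (w : Weight) (r : ℝ) : ℝ :=
  44 * Real.exp 1 * cfrak m / (Real.pi * mu m) * (11 * gam m w r / 10) ^ 2

/-- `C_r = (3𝔠 / (2πe)) (η_r / (1 - η_r)) (11 γ_r / 10)²`. -/
def Cr (m : ℝ) (w : Weight) (r : ℝ) : ℝ :=
  3 * cfrak m / (2 * Real.pi * Real.exp 1) * (eta m w r / (1 - eta m w r)) *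
    (11 * gam m w r / 10) ^ 2

/-- `η̃_𝚛 = 352 e C_{11𝚛/10} / (7|m|)`. -/
def etaTilde (m : ℝ) (w : Weight) (r : ℝ) : ℝ :=
  352 * Real.exp 1 * Cr m w (11 * r / 10) / (7 * |m|)

/-- `C̃_𝚛`, the bound for the remainder of order eight. -/
def CrTilde (m : ℝ) (w : Weight) (r : ℝ) : ℝ :=
  1 / (44 * Real.exp 1 ^ 2) * etaTilde m w r ^ 2 +
    2 / Real.exp 1 * etaTilde m w r *
      (cfrak m / Real.pi * gam m w (11 * r / 10) ^ 2 + Cr m w (11 * r / 10)) +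
    16 * cfrak m / (3 * Real.exp 1 ^ 2 * Real.pi ^ 3) *
      (gam m w (11 * r / 10) ^ 6 / mu m ^ 2) * (1 + 2 * etaTilde m w r / Real.exp 1)

/-- `Λ + Ḡ + R` is the fourth order normal form of `H` on `B_r(h_w)`, obtained through the time-one
map of the Hamiltonian flow `Ψ` of `S`; the identity `H ∘ Ψ¹ = Λ + Ḡ + R` is stated on the domain
of `Λ`, which `Ψ¹` preserves. -/
structure IsFourthOrderNF (m : ℝ) (w : Weight) (r : ℝ) (Ψ : ℝ → HSpace w → HSpace w) (R : Ham) :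
    Prop where
  regular : MemHam w (r + r / 10) (S4 m)
  flow : IsHamFlow w (S4 m) r (r / 10) Ψ
  mem : MemHam w r R
  bound : hamNorm w r R ≤ ENNReal.ofReal (Cr m w r)
  six_le_deg : ∀ p, R p ≠ 0 → 6 ≤ deg p
  even : EvenIndex R
  conj_eq : ∀ z ∈ ball w r, FiniteEnergy m z → FiniteEnergy m (Ψ 1 z) ∧
    (Hbeam m (Ψ 1 z) : ℂ) = Lam m z + Gbar m z + R.eval z

end Beam

end

noncomputable section

namespace Beam

open ComplexConjugate
open scoped ENNReal

/-! ### Monomials and their derivatives with values in `[0, ∞]` -/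

/-! Both normal form steps are Lie transforms. If `{F, Λ} = N`, Taylor expansion along the flow of
`F` gives `(Λ + K) ∘ Φ_F^1 = Λ + K + N + ∑_k (ad_F^{k+1} K / (k+1)! + ad_F^{k+1} N / (k+2)!)`
(`lie_step`, `lieRem`). In the fourth order step `K = G` and `N = Ḡ - G`. In the sixth order step `K
= Ḡ + R`, and `N` is minus the nonresonant sextic part of `R`. Three ingredients make this rigorous
and quantitative.

Estimates. A Hamiltonian is measured by the supremum of its majorant vector field over a ball
(`fldSup`), computed in `[0, ∞]`, where sums may be reordered freely. Nonnegativity of the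
coefficients gives a Cauchy estimate without complex analysis (`wn_dfld_le`), hence a bracket bound
with constant `2/ρ` on shrinking the radius by `ρ` (`fldSup_bracket_le`). Spreading the loss over
`k` brackets costs `k^k ≤ k! e^{k-1}`, so the Lie series is dominated by a geometric series of ratio
`e (2/ρ) |X_F|` (`fldSup_adPow_le`). This ratio is at most `η/2` in the fourth order step and `η̃/2`
in the sixth.

The unbounded part. `Λ` does not have a bounded field, but `{F, Λ} = N` does, so only the first step
of its Taylor expansion is special. Even index structure makes the `j`-th component of the field at
most a multiple of `|z_j|` (`Good.mul_fld_le`). Gronwall's inequality then bounds each `|z_j|` along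
an orbit by a constant times its initial value, so `Λ` stays finite.

Small divisors. A sextic monomial with even index structure has as divisor a combination of three
frequencies with coefficients `0, ±2`. Since `ω_j = j² + m/2 + O(m²/j²)`, the combination `ω_i + ω_j
- ω_k` is close to the integer `i² + j² - k²` plus `m/2`, and stays away from `0` even when the
integer vanishes (`abs_le_abs_three_wave`). A divisor is therefore at least `7|m|/8` unless `α = β`.
This bounds the sextic generating function and makes every resonant sextic term integrable.

For the final constant, the part of `R` of degree at least eight omits the leading term of the
quartic Lie series. It is thus quadratic in `η`, and `etaTilde_ge` absorbs it into a multiple of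
`η̃`. -/

/-- The monomial `x^n` in variables with values in `[0, ∞]`. -/
def emon (n : ℕ+ →₀ ℕ) (x : ℕ+ → ℝ≥0∞) : ℝ≥0∞ := n.prod fun j k => x j ^ k

/-- The partial derivative `∂_j x^n`. -/
def ed (n : ℕ+ →₀ ℕ) (j : ℕ+) (x : ℕ+ → ℝ≥0∞) : ℝ≥0∞ :=
  (n j : ℝ≥0∞) * emon (n - Finsupp.single j 1) x

/-- The second partial derivative `∂_j ∂_i x^n`. -/
def edd (n : ℕ+ →₀ ℕ) (i j : ℕ+) (x : ℕ+ → ℝ≥0∞) : ℝ≥0∞ :=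
  (n i : ℝ≥0∞) * ed (n - Finsupp.single i 1) j x

theorem finsupp_single_induction {P : (ℕ+ →₀ ℕ) → Prop} (h0 : P 0)
    (h1 : ∀ n a, P n → P (n + Finsupp.single a 1)) (n : ℕ+ →₀ ℕ) : P n := by
  induction n using Finsupp.induction with
  | zero => exact h0
  | single_add a b f _ _ ih =>
    clear * - ih h1
    induction b with
    | zero => simpa using ih
    | succ b ihb =>
      have := h1 _ a ihb
      rwa [add_right_comm, ← Finsupp.single_add] at this

@[simp] theorem emon_zero (x : ℕ+ → ℝ≥0∞) : emon 0 x = 1 := by simp [emon]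

theorem emon_add (n m : ℕ+ →₀ ℕ) (x : ℕ+ → ℝ≥0∞) : emon (n + m) x = emon n x * emon m x :=
  Finsupp.prod_add_index' (by simp) (by intros; exact pow_add _ _ _)

@[simp] theorem emon_single (a : ℕ+) (x : ℕ+ → ℝ≥0∞) : emon (Finsupp.single a 1) x = x a := by
  simp [emon]

theorem emon_mono (n : ℕ+ →₀ ℕ) {x y : ℕ+ → ℝ≥0∞} (h : ∀ j, x j ≤ y j) : emon n x ≤ emon n y :=
  Finset.prod_le_prod' fun j _ => pow_le_pow_left' (h j) _

theorem ed_mono (n : ℕ+ →₀ ℕ) (j : ℕ+) {x y : ℕ+ → ℝ≥0∞} (h : ∀ j, x j ≤ y j) :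
    ed n j x ≤ ed n j y :=
  mul_le_mul_right (emon_mono _ h) _

@[simp] theorem ed_zero (j : ℕ+) (x : ℕ+ → ℝ≥0∞) : ed 0 j x = 0 := by simp [ed]

theorem sub_single_add {n : ℕ+ →₀ ℕ} {j : ℕ+} (h : n j ≠ 0) (m : ℕ+ →₀ ℕ) :
    n - Finsupp.single j 1 + m = n + m - Finsupp.single j 1 := by
  ext i
  simp only [Finsupp.coe_add, Finsupp.coe_tsub, Pi.add_apply, Pi.sub_apply, Finsupp.single_apply]
  split_ifs with hij
  · subst hij; omega
  · omega

theorem ed_add (n m : ℕ+ →₀ ℕ) (j : ℕ+) (x : ℕ+ → ℝ≥0∞) :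
    ed (n + m) j x = ed n j x * emon m x + emon n x * ed m j x := by
  have key : ∀ n m : ℕ+ →₀ ℕ, (n j : ℝ≥0∞) * emon (n + m - Finsupp.single j 1) x
      = ed n j x * emon m x := by
    intro n m
    by_cases h : n j = 0
    · simp [ed, h]
    · rw [← sub_single_add h, emon_add, ed, mul_assoc]
  have h2 := key m n
  rw [add_comm m n, mul_comm (ed m j x)] at h2
  rw [← key, ← h2, ed, Finsupp.add_apply, Nat.cast_add, add_mul]

theorem ed_single (a j : ℕ+) (x : ℕ+ → ℝ≥0∞) :
    ed (Finsupp.single a 1) j x = if a = j then 1 else 0 := by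
  by_cases h : a = j
  · subst h; simp [ed]
  · simp [ed, h]

theorem edd_comm (n : ℕ+ →₀ ℕ) (i j : ℕ+) (x : ℕ+ → ℝ≥0∞) : edd n i j x = edd n j i x := by
  by_cases h : i = j
  · rw [h]
  · simp only [edd, ed, Finsupp.coe_tsub, Pi.sub_apply, Finsupp.single_apply, h, Ne.symm h,
      if_false, tsub_zero]
    rw [← mul_assoc, ← mul_assoc, mul_comm (n i : ℝ≥0∞), tsub_tsub, tsub_tsub, add_comm]

/-- The left side consists of the terms of order at most one in `v` in the expansion of `(x + v)^n`,
and all other terms are nonnegative. This takes the place of Cauchy's integral formula. -/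
theorem emon_add_tsum_le (n : ℕ+ →₀ ℕ) (x v : ℕ+ → ℝ≥0∞) :
    emon n x + ∑' j, v j * ed n j x ≤ emon n (fun j => x j + v j) := by
  induction n using finsupp_single_induction with
  | h0 => simp
  | h1 n a ih =>
    have e : ∑' j, v j * ed (n + Finsupp.single a 1) j x
        = x a * ∑' j, v j * ed n j x + v a * emon n x := by
      rw [← ENNReal.tsum_mul_left]
      rw [show v a * emon n x = ∑' j, if j = a then v a * emon n x else 0 by
        rw [tsum_ite_eq], ← ENNReal.tsum_add]
      refine tsum_congr fun j => ?_
      rw [ed_add, ed_single, emon_single]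
      by_cases h : a = j
      · subst h; simp; ring
      · simp [h, Ne.symm h]; ring
    rw [e, emon_add, emon_single, emon_add, emon_single]
    calc emon n x * x a + (x a * ∑' j, v j * ed n j x + v a * emon n x)
        ≤ emon n x * x a + (x a * ∑' j, v j * ed n j x + v a * emon n x)
          + v a * ∑' j, v j * ed n j x := le_self_add
      _ = (emon n x + ∑' j, v j * ed n j x) * (x a + v a) := by ring
      _ ≤ _ := mul_le_mul_left ih _

theorem ed_add_tsum_le (n : ℕ+ →₀ ℕ) (i : ℕ+) (x v : ℕ+ → ℝ≥0∞) :
    ed n i x + ∑' j, v j * edd n i j x ≤ ed n i (fun j => x j + v j) := by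
  calc ed n i x + ∑' j, v j * edd n i j x
      = n i * (emon (n - Finsupp.single i 1) x
        + ∑' j, v j * ed (n - Finsupp.single i 1) j x) := by
        rw [mul_add, ← ENNReal.tsum_mul_left, ed]
        simp only [edd]
        congr 1
        exact tsum_congr fun j => by ring
    _ ≤ _ := mul_le_mul_right (emon_add_tsum_le _ _ _) _

/-! ### The majorant vector field and its derivative -/

/-- The `i`-th component of the majorant vector field of `f` at `x`. -/
def fld (f : Ham) (x : ℕ+ → ℝ≥0∞) (i : ℕ+) : ℝ≥0∞ :=
  ∑' p : MIdx, ‖f p‖ₑ * (emon p.1 x * ed p.2 i x)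

/-- The derivative of the `i`-th component of the majorant vector field in the direction `v`, where
all `z_j` and `z̄_j` are replaced by `x_j`. -/
def dfld (f : Ham) (x : ℕ+ → ℝ≥0∞) (v : ℕ+ → ℝ≥0∞) (i : ℕ+) : ℝ≥0∞ :=
  ∑' p : MIdx, ‖f p‖ₑ * ∑' j, v j * (ed p.1 j x * ed p.2 i x + emon p.1 x * edd p.2 i j x)

theorem fld_mono (f : Ham) {x y : ℕ+ → ℝ≥0∞} (h : ∀ j, x j ≤ y j) (i : ℕ+) :
    fld f x i ≤ fld f y i :=
  ENNReal.tsum_le_tsum fun _ => mul_le_mul_right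
    (mul_le_mul' (emon_mono _ h) (ed_mono _ _ h)) _

/-- The linear part of the increment of a power series with nonnegative coefficients is at most the
value at the shifted point. Applied to a rescaled `v`, this is the Cauchy estimate. -/
theorem dfld_le_fld (f : Ham) (x v : ℕ+ → ℝ≥0∞) (i : ℕ+) :
    dfld f x v i ≤ fld f (fun j => x j + v j) i := by
  refine ENNReal.tsum_le_tsum fun p => mul_le_mul_right ?_ _
  calc ∑' j, v j * (ed p.1 j x * ed p.2 i x + emon p.1 x * edd p.2 i j x)
      = (∑' j, v j * ed p.1 j x) * ed p.2 i x + emon p.1 x * ∑' j, v j * edd p.2 i j x := by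
        rw [← ENNReal.tsum_mul_left, ← ENNReal.tsum_mul_right, ← ENNReal.tsum_add]
        exact tsum_congr fun j => by ring
    _ ≤ (emon p.1 x + ∑' j, v j * ed p.1 j x) * (ed p.2 i x + ∑' j, v j * edd p.2 i j x) := by
        rw [add_mul, mul_add, mul_add, add_comm]
        gcongr
        · exact le_add_self
        · exact le_self_add
    _ ≤ _ := mul_le_mul' (emon_add_tsum_le _ _ _) (ed_add_tsum_le _ _ _ _)

theorem dfld_smul (f : Ham) (x v : ℕ+ → ℝ≥0∞) (s : ℝ≥0∞) (i : ℕ+) :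
    dfld f x (fun j => s * v j) i = s * dfld f x v i := by
  simp only [dfld]
  rw [← ENNReal.tsum_mul_left]
  refine tsum_congr fun p => ?_
  simp only [mul_assoc, ENNReal.tsum_mul_left]
  exact mul_left_comm _ _ _

/-! ### The weighted `ℓ²` norm with values in `[0, ∞]` -/

/-- The weighted norm of a sequence with values in `[0, ∞]`. -/
def wn (w : Weight) (x : ℕ+ → ℝ≥0∞) : ℝ≥0∞ :=
  (∑' j, ENNReal.ofReal (w.val j) ^ 2 * x j ^ 2) ^ (1 / 2 : ℝ)

theorem wn_sq (w : Weight) (x : ℕ+ → ℝ≥0∞) :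
    wn w x ^ 2 = ∑' j, ENNReal.ofReal (w.val j) ^ 2 * x j ^ 2 := by
  rw [wn, ← ENNReal.rpow_natCast, ← ENNReal.rpow_mul]
  norm_num

theorem tsum_minkowski {ι : Type} [Countable ι] (x y : ι → ℝ≥0∞) :
    (∑' j, (x j + y j) ^ 2) ^ (1 / 2 : ℝ)
      ≤ (∑' j, x j ^ 2) ^ (1 / 2 : ℝ) + (∑' j, y j ^ 2) ^ (1 / 2 : ℝ) := by
  let _ : MeasurableSpace ι := ⊤
  have := ENNReal.lintegral_Lp_add_le (μ := (MeasureTheory.Measure.count : MeasureTheory.Measure ι))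
    (f := x) (g := y) (p := 2) (measurable_of_countable _).aemeasurable
    (measurable_of_countable _).aemeasurable (by norm_num)
  simpa only [Pi.add_apply, MeasureTheory.lintegral_count, ENNReal.rpow_two] using this

theorem tsum_mul_le_sqrt {ι : Type} [Countable ι] (x y : ι → ℝ≥0∞) :
    ∑' j, x j * y j ≤ (∑' j, x j ^ 2) ^ (1 / 2 : ℝ) * (∑' j, y j ^ 2) ^ (1 / 2 : ℝ) := by
  let _ : MeasurableSpace ι := ⊤
  have := ENNReal.lintegral_mul_le_Lp_mul_Lq
    (MeasureTheory.Measure.count : MeasureTheory.Measure ι) (p := 2) (q := 2)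
    (f := x) (g := y) (by constructor <;> norm_num)
    (measurable_of_countable _).aemeasurable (measurable_of_countable _).aemeasurable
  simpa only [Pi.mul_apply, MeasureTheory.lintegral_count, ENNReal.rpow_two] using this

theorem wn_eq (w : Weight) (x : ℕ+ → ℝ≥0∞) :
    wn w x = (∑' j, (ENNReal.ofReal (w.val j) * x j) ^ 2) ^ (1 / 2 : ℝ) := by
  simp only [wn, mul_pow]

theorem wn_mono (w : Weight) {x y : ℕ+ → ℝ≥0∞} (h : ∀ j, x j ≤ y j) : wn w x ≤ wn w y :=
  ENNReal.rpow_le_rpow (ENNReal.tsum_le_tsum fun j =>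
    mul_le_mul_right (pow_le_pow_left' (h j) 2) _) (by norm_num)

theorem wn_smul (w : Weight) (s : ℝ≥0∞) (x : ℕ+ → ℝ≥0∞) :
    wn w (fun j => s * x j) = s * wn w x := by
  have : ∑' j, ENNReal.ofReal (w.val j) ^ 2 * (s * x j) ^ 2
      = s ^ 2 * ∑' j, ENNReal.ofReal (w.val j) ^ 2 * x j ^ 2 := by
    rw [← ENNReal.tsum_mul_left]
    exact tsum_congr fun j => by ring
  rw [wn, this, ENNReal.mul_rpow_of_nonneg _ _ (by norm_num), wn, ← ENNReal.rpow_natCast,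
    ← ENNReal.rpow_mul]
  norm_num

theorem wn_add_le (w : Weight) (x y : ℕ+ → ℝ≥0∞) :
    wn w (fun j => x j + y j) ≤ wn w x + wn w y := by
  simp only [wn_eq, mul_add]
  exact tsum_minkowski _ _

theorem le_wn (w : Weight) (x : ℕ+ → ℝ≥0∞) (j : ℕ+) : ENNReal.ofReal (w.val j) * x j ≤ wn w x := by
  have h : (ENNReal.ofReal (w.val j) * x j) ^ 2 ≤ wn w x ^ 2 := by
    rw [wn_sq, mul_pow]
    exact ENNReal.le_tsum (f := fun j => ENNReal.ofReal (w.val j) ^ 2 * x j ^ 2) j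
  exact (ENNReal.pow_le_pow_left_iff two_ne_zero).1 h

theorem ofReal_weight_ne_zero (w : Weight) (j : ℕ+) : ENNReal.ofReal (w.val j) ≠ 0 := by
  simpa using w.pos j

theorem lt_top_of_wn_lt_top (w : Weight) {x : ℕ+ → ℝ≥0∞} (h : wn w x < ⊤) (j : ℕ+) : x j < ⊤ := by
  by_contra hx
  rw [not_lt, top_le_iff] at hx
  have := (le_wn w x j).trans_lt h
  rw [hx, ENNReal.mul_top (ofReal_weight_ne_zero w j)] at this
  exact lt_irrefl _ this

/-- Cauchy–Schwarz, after a factor `w_j / c ≥ 1` is inserted next to each term. This is the only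
role of the positive lower bound of the weights in pairings. -/
theorem exists_tsum_mul_le_wn (w : Weight) : ∃ c : ℝ≥0∞, c < ⊤ ∧ ∀ x y : ℕ+ → ℝ≥0∞,
    ∑' j, x j * y j ≤ c * (wn w x * wn w y) := by
  obtain ⟨c, hc, h⟩ := w.bddBelow'
  have hc' : ENNReal.ofReal c ≠ 0 := by simpa using hc
  refine ⟨((ENNReal.ofReal c) ^ 2)⁻¹, by
    rw [ENNReal.inv_lt_top]; exact pos_iff_ne_zero.2 (pow_ne_zero 2 hc'), fun x y => ?_⟩
  rw [← ENNReal.div_eq_inv_mul, ENNReal.le_div_iff_mul_le (Or.inl (by simpa using hc))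
    (Or.inl (by simp)), wn_eq, wn_eq]
  refine le_trans ?_ (tsum_mul_le_sqrt _ _)
  rw [mul_comm, ← ENNReal.tsum_mul_left]
  refine ENNReal.tsum_le_tsum fun j => ?_
  have hj := ENNReal.ofReal_le_ofReal (h j)
  calc _ = ENNReal.ofReal c * x j * (ENNReal.ofReal c * y j) := by ring
    _ ≤ _ := mul_le_mul' (mul_le_mul_left hj _) (mul_le_mul_left hj _)

/-- Minkowski's inequality for countably many summands: finite partial sums are handled by
induction, and the limit is taken over each finite block of indices. -/
theorem wn_tsum_le (w : Weight) (x : ℕ → ℕ+ → ℝ≥0∞) :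
    wn w (fun j => ∑' k, x k j) ≤ ∑' k, wn w (x k) := by
  have hfin : ∀ n, wn w (fun j => ∑ k ∈ Finset.range n, x k j)
      ≤ ∑ k ∈ Finset.range n, wn w (x k) := by
    intro n
    induction n with
    | zero => simp [wn]
    | succ n ih =>
      simp only [Finset.sum_range_succ]
      exact (wn_add_le w _ _).trans (by gcongr)
  have h : wn w (fun j => ∑' k, x k j) ^ 2 ≤ (∑' k, wn w (x k)) ^ 2 := by
    rw [wn_sq, ENNReal.tsum_eq_iSup_sum]
    refine iSup_le fun s => ?_
    have ht : Filter.Tendsto (fun n : ℕ => ∑ j ∈ s, ENNReal.ofReal (w.val j) ^ 2 *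
        (∑ k ∈ Finset.range n, x k j) ^ 2) Filter.atTop
        (nhds (∑ j ∈ s, ENNReal.ofReal (w.val j) ^ 2 * (∑' k, x k j) ^ 2)) := by
      refine tendsto_finsetSum _ fun j _ => ?_
      refine ENNReal.Tendsto.const_mul ?_ (Or.inr (by finiteness))
      exact ((ENNReal.continuous_pow 2).tendsto _).comp (ENNReal.tendsto_nat_tsum _)
    refine le_of_tendsto' ht fun n => ?_
    calc _ ≤ wn w (fun j => ∑ k ∈ Finset.range n, x k j) ^ 2 := by
          rw [wn_sq]
          exact ENNReal.sum_le_tsum s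
      _ ≤ _ := by
          gcongr
          exact (hfin n).trans (ENNReal.sum_le_tsum _)
  exact (ENNReal.pow_le_pow_left_iff two_ne_zero).1 h

/-! ### The supremum of the majorant vector field over a ball -/

/-- The supremum of the weighted norm of the majorant vector field over the ball of radius `R`. -/
def fldSup (w : Weight) (R : ℝ≥0∞) (f : Ham) : ℝ≥0∞ := ⨆ x, ⨆ _ : wn w x ≤ R, wn w (fld f x)

theorem wn_fld_le (w : Weight) {R : ℝ≥0∞} (f : Ham) {x : ℕ+ → ℝ≥0∞} (h : wn w x ≤ R) :
    wn w (fld f x) ≤ fldSup w R f :=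
  le_iSup₂_of_le x h le_rfl

theorem fldSup_mono (w : Weight) {R R' : ℝ≥0∞} (h : R ≤ R') (f : Ham) :
    fldSup w R f ≤ fldSup w R' f :=
  iSup₂_le fun _ hx => wn_fld_le w f (hx.trans h)

theorem fldSup_le_mul (w : Weight) {R : ℝ≥0∞} {f g : Ham} (c : ℝ≥0∞)
    (h : ∀ p, ‖f p‖ₑ ≤ c * ‖g p‖ₑ) : fldSup w R f ≤ c * fldSup w R g := by
  refine iSup₂_le fun x hx => ?_
  refine le_trans (wn_mono w fun j => ?_)
    ((wn_smul w c (fld g x)).le.trans (mul_le_mul_right (wn_fld_le w g hx) c))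
  simp only [fld]
  rw [← ENNReal.tsum_mul_left]
  exact ENNReal.tsum_le_tsum fun p => by
    rw [← mul_assoc c]; exact mul_le_mul_left (h p) _

theorem fldSup_tsum_le (w : Weight) {R : ℝ≥0∞} {f : Ham} {g : ℕ → Ham} (c : ℕ → ℝ≥0∞)
    (h : ∀ p, ‖f p‖ₑ ≤ ∑' k, c k * ‖g k p‖ₑ) : fldSup w R f ≤ ∑' k, c k * fldSup w R (g k) := by
  refine iSup₂_le fun x hx => ?_
  calc wn w (fld f x) ≤ wn w (fun j => ∑' k, c k * fld (g k) x j) := by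
        refine wn_mono w fun j => ?_
        simp only [fld]
        simp_rw [← ENNReal.tsum_mul_left]
        rw [ENNReal.tsum_comm]
        refine ENNReal.tsum_le_tsum fun p => ?_
        simp_rw [← mul_assoc (c _), ENNReal.tsum_mul_right]
        exact mul_le_mul_left (h p) _
    _ ≤ ∑' k, wn w (fun j => c k * fld (g k) x j) := wn_tsum_le w _
    _ ≤ _ := ENNReal.tsum_le_tsum fun k => by
        rw [wn_smul]
        exact mul_le_mul_right (wn_fld_le w _ hx) _

/-- Cauchy estimate for the derivative of the majorant vector field. -/
theorem wn_dfld_le (w : Weight) {R ρ b : ℝ≥0∞} (f : Ham) {x v : ℕ+ → ℝ≥0∞} (hx : wn w x ≤ R)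
    (hv : wn w v ≤ b) (hb0 : b ≠ 0) (hb : b ≠ ⊤) (hρ : ρ ≠ 0) (hρ' : ρ ≠ ⊤) :
    wn w (dfld f x v) ≤ b / ρ * fldSup w (R + ρ) f := by
  -- The direction `v` is scaled by `ρ / b`, so that its norm is at most `ρ` and `x` plus the scaled
  -- direction stays in the ball of radius `R + ρ`.
  have h1 : ρ / b * wn w (dfld f x v) ≤ fldSup w (R + ρ) f := by
    rw [← wn_smul]
    simp_rw [← dfld_smul]
    refine (wn_mono w fun j => dfld_le_fld f x _ j).trans (wn_fld_le w f ?_)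
    refine (wn_add_le w _ _).trans (add_le_add hx ?_)
    rw [wn_smul]
    calc ρ / b * wn w v ≤ ρ / b * b := mul_le_mul_right hv _
      _ = ρ := ENNReal.div_mul_cancel hb0 hb
  calc wn w (dfld f x v) = b / ρ * (ρ / b * wn w (dfld f x v)) := by
        rw [← mul_assoc]
        have : b / ρ * (ρ / b) = 1 := by
          rw [← ENNReal.inv_div (Or.inl hb) (Or.inl hb0)]
          exact ENNReal.inv_mul_cancel (ENNReal.div_ne_zero.2 ⟨hρ, hb⟩) (ENNReal.div_ne_top hρ' hb0)
        rw [this, one_mul]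
    _ ≤ _ := mul_le_mul_right h1 _

/-! ### Real even Hamiltonians -/

/-- Real-valued Hamiltonians with even index structure and without constant term. -/
structure Good (f : Ham) : Prop where
  real : ∀ α β, f (α, β) = conj (f (β, α))
  even : EvenIndex f
  zero : f (0, 0) = 0

theorem Good.enorm_swap {f : Ham} (hf : Good f) (p : MIdx) : ‖f p.swap‖ₑ = ‖f p‖ₑ := by
  obtain ⟨α, β⟩ := p
  rw [Prod.swap_prod_mk, hf.real β α, ← ofReal_norm, RCLike.norm_conj, ofReal_norm]

theorem deg_eq (p : MIdx) : deg p = p.1.degree + p.2.degree := rfl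

theorem deg_add (p q : MIdx) : deg (p + q) = deg p + deg q := by
  simp only [deg_eq, Prod.fst_add, Prod.snd_add, map_add]
  ring

/-- An index that occurs at all occurs at least twice. This keeps brackets free of constant terms.
-/
theorem Good.two_le_deg {f : Ham} (hf : Good f) {p : MIdx} (hp : f p ≠ 0) : 2 ≤ deg p := by
  have h0 : ∃ j, p.1 j + p.2 j ≠ 0 := by
    by_contra! h
    have : p = (0, 0) := by
      refine Prod.ext (Finsupp.ext fun j => ?_) (Finsupp.ext fun j => ?_)
      · have := h j; simp; omega
      · have := h j; simp; omega
    exact hp (this ▸ hf.zero)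
  obtain ⟨j, hj⟩ := h0
  obtain ⟨k, hk⟩ := hf.even p hp j
  have h1 := Finsupp.le_degree j p.1
  have h2 := Finsupp.le_degree j p.2
  rw [deg_eq]
  omega

/-- `∑_p |f_p| ∂_{z_j} (z^α z̄^β)` agrees with the majorant field, by reality. -/
theorem Good.tsum_ed_fst {f : Ham} (hf : Good f) (x : ℕ+ → ℝ≥0∞) (j : ℕ+) :
    ∑' p : MIdx, ‖f p‖ₑ * (ed p.1 j x * emon p.2 x) = fld f x j := by
  rw [fld, ← (Equiv.prodComm (ℕ+ →₀ ℕ) (ℕ+ →₀ ℕ)).tsum_eq]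
  refine tsum_congr fun p => ?_
  rw [Equiv.prodComm_apply, hf.enorm_swap, mul_comm (ed _ _ _)]
  rfl

/-! ### Push-forward of families of monomials -/

open Classical in
/-- The power series `∑_t c_t z^{π(t)}`. -/
def push {T : Type} (c : T → ℂ) (π : T → MIdx) : Ham := fun P => ∑' t, if π t = P then c t else 0

theorem exists_of_push_ne_zero {T : Type} {c : T → ℂ} {π : T → MIdx} {P : MIdx}
    (h : push c π P ≠ 0) : ∃ t, π t = P ∧ c t ≠ 0 := by
  by_contra! hc
  refine h ?_
  refine (tsum_congr fun t => ?_).trans tsum_zero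
  split_ifs with ht
  · exact hc t ht
  · rfl

/-- No summability is needed: a divergent fibre sum has the default value `0`, for which the
inequality is still true. -/
theorem tsum_push_le {T : Type} (c : T → ℂ) (π : T → MIdx) (W : MIdx → ℝ≥0∞) :
    ∑' P, ‖push c π P‖ₑ * W P ≤ ∑' t, ‖c t‖ₑ * W (π t) := by
  classical
  calc ∑' P, ‖push c π P‖ₑ * W P
      ≤ ∑' P, ∑' t, if P = π t then ‖c t‖ₑ * W P else 0 := by
        refine ENNReal.tsum_le_tsum fun P => ?_
        refine (mul_le_mul_left enorm_tsum_le_tsum_enorm _).trans ?_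
        rw [← ENNReal.tsum_mul_right]
        refine ENNReal.tsum_le_tsum fun t => ?_
        by_cases h : π t = P
        · simp [h]
        · simp [h]
    _ = _ := by
        rw [ENNReal.tsum_comm]
        refine tsum_congr fun t => ?_
        rw [tsum_eq_single (π t) (fun P hP => if_neg hP), if_pos rfl]

/-- The sum over `T` is regrouped along the fibres of `π`; `m` is constant on each fibre and factors
out. -/
theorem hasSum_push {T : Type} {c : T → ℂ} {π : T → MIdx} (m : MIdx → ℂ)
    (h : Summable fun t => c t * m (π t)) :
    HasSum (fun P => push c π P * m P) (∑' t, c t * m (π t)) := by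
  classical
  have h1 := (Equiv.sigmaFiberEquiv π).hasSum_iff.2 h.hasSum
  refine h1.sigma fun P => ?_
  have h2 : Summable fun t : {t // π t = P} => c t * m (π t) := h.subtype {t | π t = P}
  have h3 : push c π P * m P = ∑' t : {t // π t = P}, c t * m (π t) := by
    rw [push, ← tsum_mul_right]
    refine Eq.trans ?_ (tsum_subtype {t | π t = P} fun t => c t * m (π t)).symm
    refine tsum_congr fun t => ?_
    by_cases ht : π t = P
    · simp [ht]
    · simp [ht]
  rw [h3]
  exact h2.hasSum

theorem fld_push_le {T : Type} (c : T → ℂ) (π : T → MIdx) (x : ℕ+ → ℝ≥0∞) (i : ℕ+) :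
    fld (push c π) x i ≤ ∑' t, ‖c t‖ₑ * (emon (π t).1 x * ed (π t).2 i x) :=
  tsum_push_le c π fun P => emon P.1 x * ed P.2 i x

/-! ### The Poisson bracket -/

/-- The coefficient `i (α_j β'_j - β_j α'_j) F_{α,β} K_{α',β'}`. -/
def brCoef (F K : Ham) (t : MIdx × MIdx × ℕ+) : ℂ :=
  Complex.I * ((t.1.1 t.2.2 : ℂ) * t.2.1.2 t.2.2 - (t.1.2 t.2.2 : ℂ) * t.2.1.1 t.2.2) *
    (F t.1 * K t.2.1)

/-- The multi-index `(α + α' - e_j, β + β' - e_j)`. -/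
def brIdx (t : MIdx × MIdx × ℕ+) : MIdx :=
  (t.1.1 + t.2.1.1 - Finsupp.single t.2.2 1, t.1.2 + t.2.1.2 - Finsupp.single t.2.2 1)

/-- The Poisson bracket `{F, K} = i ∑_j (∂_{z_j} F ∂_{z̄_j} K - ∂_{z̄_j} F ∂_{z_j} K)`. -/
def bracket (F K : Ham) : Ham := push (brCoef F K) brIdx

/-- The multi-index of `z_j z̄_j`. -/
def diagIdx (j : ℕ+) : MIdx := (Finsupp.single j 1, Finsupp.single j 1)

/-- A nonzero coefficient forces `j` to occur as a `z` in one factor and as a `z̄` in the other, so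
the truncated subtractions in `brIdx` are genuine. All degree and parity counts for brackets rest on
this. -/
theorem brIdx_add_diagIdx {F K : Ham} {t : MIdx × MIdx × ℕ+} (h : brCoef F K t ≠ 0) :
    brIdx t + diagIdx t.2.2 = t.1 + t.2.1 := by
  obtain ⟨p, q, j⟩ := t
  have h1 : (p.1 j ≠ 0 ∧ q.2 j ≠ 0) ∨ (p.2 j ≠ 0 ∧ q.1 j ≠ 0) := by
    by_contra! hc
    refine h ?_
    have e1 : (p.1 j : ℂ) * q.2 j = 0 := by
      by_cases h0 : p.1 j = 0
      · simp [h0]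
      · simp [hc.1 h0]
    have e2 : (p.2 j : ℂ) * q.1 j = 0 := by
      by_cases h0 : p.2 j = 0
      · simp [h0]
      · simp [hc.2 h0]
    simp [brCoef, e1, e2]
  have key : ∀ n : ℕ+ →₀ ℕ, n j ≠ 0 → n - Finsupp.single j 1 + Finsupp.single j 1 = n := by
    intro n hn
    refine tsub_add_cancel_of_le ?_
    rw [Finsupp.single_le_iff]
    omega
  refine Prod.ext ?_ ?_
  · refine key _ ?_
    simp only [Finsupp.add_apply]
    omega
  · refine key _ ?_
    simp only [Finsupp.add_apply]
    omega

theorem brCoef_ne_zero {F K : Ham} {t : MIdx × MIdx × ℕ+} (h : brCoef F K t ≠ 0) :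
    F t.1 ≠ 0 ∧ K t.2.1 ≠ 0 :=
  mul_ne_zero_iff.1 (mul_ne_zero_iff.1 h).2

theorem exists_of_bracket_ne_zero {F K : Ham} {P : MIdx} (h : bracket F K P ≠ 0) :
    ∃ p q j, F p ≠ 0 ∧ K q ≠ 0 ∧ P + diagIdx j = p + q := by
  obtain ⟨t, rfl, ht⟩ := exists_of_push_ne_zero h
  exact ⟨t.1, t.2.1, t.2.2, (brCoef_ne_zero ht).1, (brCoef_ne_zero ht).2, brIdx_add_diagIdx ht⟩

theorem deg_diagIdx (j : ℕ+) : deg (diagIdx j) = 2 := by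
  simp [deg_eq, diagIdx]

theorem exists_deg_of_bracket_ne_zero {F K : Ham} {P : MIdx} (h : bracket F K P ≠ 0) :
    ∃ p q, F p ≠ 0 ∧ K q ≠ 0 ∧ deg P + 2 = deg p + deg q := by
  obtain ⟨p, q, j, hp, hq, e⟩ := exists_of_bracket_ne_zero h
  exact ⟨p, q, hp, hq, by rw [← deg_add, ← e, deg_add, deg_diagIdx]⟩

/-- Removing `z_j z̄_j` does not change parities. Exchanging the two exponents in both factors flips
the sign of the antisymmetric coefficient, which cancels the sign from conjugating `i`. -/
theorem Good.bracket {F K : Ham} (hF : Good F) (hK : Good K) : Good (bracket F K) where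
  real α β := by
    classical
    let e : MIdx ≃ MIdx := Equiv.prodComm _ _
    let e' : MIdx × MIdx × ℕ+ ≃ MIdx × MIdx × ℕ+ := e.prodCongr (e.prodCongr (Equiv.refl ℕ+))
    rw [Beam.bracket, push, push, Complex.conj_tsum, ← e'.tsum_eq]
    refine tsum_congr fun t => ?_
    obtain ⟨⟨a, b⟩, ⟨a', b'⟩, j⟩ := t
    have hi : brIdx (e' ((a, b), (a', b'), j)) = (α, β) ↔ brIdx ((a, b), (a', b'), j) = (β, α) := by
      simp only [e', e, brIdx, Equiv.prodCongr_apply, Equiv.prodComm_apply, Prod.map,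
        Prod.swap_prod_mk, Equiv.refl_apply, Prod.mk.injEq]
      exact and_comm
    simp only [hi]
    split_ifs
    · simp only [e', e, brCoef, Equiv.prodCongr_apply, Equiv.prodComm_apply, Prod.map,
        Prod.swap_prod_mk, Equiv.refl_apply, map_mul, map_sub, Complex.conj_I, map_natCast]
      rw [← hF.real b a, ← hK.real b' a']
      ring
    · simp
  even P hP i := by
    obtain ⟨p, q, j, hp, hq, e⟩ := exists_of_bracket_ne_zero hP
    have e1 := DFunLike.congr_fun (congrArg Prod.fst e) i
    have e2 := DFunLike.congr_fun (congrArg Prod.snd e) i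
    simp only [Prod.fst_add, Prod.snd_add, Finsupp.add_apply, diagIdx] at e1 e2
    obtain ⟨k, hk⟩ := hF.even p hp i
    obtain ⟨l, hl⟩ := hK.even q hq i
    exact ⟨k + l - Finsupp.single j 1 i, by omega⟩
  zero := by
    by_contra h
    obtain ⟨p, q, hp, hq, e⟩ := exists_deg_of_bracket_ne_zero h
    have h1 := hF.two_le_deg hp
    have h2 := hK.two_le_deg hq
    have h3 : deg ((0, 0) : MIdx) = 0 := by simp [deg_eq]
    omega

theorem natCast_mul_emon_sub {n m : ℕ+ →₀ ℕ} {j : ℕ+} (x : ℕ+ → ℝ≥0∞) :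
    (n j : ℝ≥0∞) * emon (n + m - Finsupp.single j 1) x = ed n j x * emon m x := by
  by_cases h : n j = 0
  · simp [ed, h]
  · rw [← sub_single_add h, emon_add, ed, mul_assoc]

theorem natCast_mul_ed_sub {n m : ℕ+ →₀ ℕ} {j : ℕ+} (i : ℕ+) (x : ℕ+ → ℝ≥0∞) :
    (n j : ℝ≥0∞) * ed (n + m - Finsupp.single j 1) i x
      = edd n i j x * emon m x + ed n j x * ed m i x := by
  rw [edd_comm]
  by_cases h : n j = 0
  · simp [ed, edd, h]
  · rw [← sub_single_add h, ed_add, edd, mul_add, ed.eq_1 n j]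
    ring

theorem enorm_brCoef_le (F K : Ham) (p q : MIdx) (j : ℕ+) : ‖brCoef F K (p, q, j)‖ₑ ≤
    ((p.1 j : ℝ≥0∞) * q.2 j + (p.2 j : ℝ≥0∞) * q.1 j) * (‖F p‖ₑ * ‖K q‖ₑ) := by
  simp only [brCoef, enorm_mul]
  refine mul_le_mul_left ?_ _
  have hI : ‖Complex.I‖ₑ = 1 := by simp [← ofReal_norm]
  rw [hI, one_mul]
  have hn : ∀ n : ℕ, ‖(n : ℂ)‖ₑ = n := fun n => by
    rw [← ofReal_norm, Complex.norm_natCast, ENNReal.ofReal_natCast]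
  refine enorm_sub_le.trans ?_
  rw [enorm_mul, enorm_mul, hn, hn, hn, hn]

/-- The field of a bracket is the commutator of the two fields; after taking moduli each field is
differentiated along the other and all signs become plus. Reality identifies the `∂_z` sums with
`∂_{z̄}` sums, so that one function `fld` serves for both. -/
theorem fld_bracket_le {F K : Ham} (hF : Good F) (hK : Good K) (x : ℕ+ → ℝ≥0∞) (i : ℕ+) :
    fld (bracket F K) x i ≤ dfld F x (fld K x) i + dfld K x (fld F x) i := by
  have split : ∀ p q : MIdx, ∀ j, ‖brCoef F K (p, q, j)‖ₑ *
      (emon (brIdx (p, q, j)).1 x * ed (brIdx (p, q, j)).2 i x) ≤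
      ‖F p‖ₑ * (ed p.1 j x * ed p.2 i x) * (‖K q‖ₑ * (emon q.1 x * ed q.2 j x)) +
      ‖F p‖ₑ * (emon p.1 x * edd p.2 i j x) * (‖K q‖ₑ * (ed q.1 j x * emon q.2 x)) +
      (‖K q‖ₑ * (emon q.1 x * edd q.2 i j x) * (‖F p‖ₑ * (ed p.1 j x * emon p.2 x)) +
      ‖K q‖ₑ * (ed q.1 j x * ed q.2 i x) * (‖F p‖ₑ * (emon p.1 x * ed p.2 j x))) := by
    intro p q j
    refine (mul_le_mul_left (enorm_brCoef_le F K p q j) _).trans (le_of_eq ?_)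
    simp only [brIdx]
    have e1 := natCast_mul_emon_sub (n := p.1) (m := q.1) (j := j) x
    have e2 := natCast_mul_ed_sub (n := q.2) (m := p.2) (j := j) i x
    have e3 := natCast_mul_emon_sub (n := q.1) (m := p.1) (j := j) x
    have e4 := natCast_mul_ed_sub (n := p.2) (m := q.2) (j := j) i x
    rw [add_comm q.2] at e2
    rw [add_comm q.1] at e3
    calc _ = (((p.1 j : ℝ≥0∞) * emon (p.1 + q.1 - Finsupp.single j 1) x) *
            ((q.2 j : ℝ≥0∞) * ed (p.2 + q.2 - Finsupp.single j 1) i x) +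
          ((q.1 j : ℝ≥0∞) * emon (p.1 + q.1 - Finsupp.single j 1) x) *
            ((p.2 j : ℝ≥0∞) * ed (p.2 + q.2 - Finsupp.single j 1) i x)) *
            (‖F p‖ₑ * ‖K q‖ₑ) := by ring
      _ = _ := by
        rw [e1, e2, e3, e4]
        ring
  have D : ∀ {f g : Ham}, Good g → dfld f x (fld g x) i = ∑' (p : MIdx) (q : MIdx) (j : ℕ+),
      (‖f p‖ₑ * (ed p.1 j x * ed p.2 i x) * (‖g q‖ₑ * (emon q.1 x * ed q.2 j x)) +
      ‖f p‖ₑ * (emon p.1 x * edd p.2 i j x) * (‖g q‖ₑ * (ed q.1 j x * emon q.2 x))) := by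
    intro f g hg
    rw [dfld]
    refine tsum_congr fun p => ?_
    rw [ENNReal.tsum_comm, ← ENNReal.tsum_mul_left]
    refine tsum_congr fun j => ?_
    rw [ENNReal.tsum_add, ENNReal.tsum_mul_left, ENNReal.tsum_mul_left, hg.tsum_ed_fst]
    rw [show ∑' q : MIdx, ‖g q‖ₑ * (emon q.1 x * ed q.2 j x) = fld g x j from rfl]
    ring
  rw [D hK, D hF, bracket]
  refine (fld_push_le _ _ x i).trans ?_
  rw [ENNReal.tsum_prod', ENNReal.tsum_comm (α := MIdx) (β := MIdx) (f := fun q p => ∑' j : ℕ+,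
      (‖K q‖ₑ * (ed q.1 j x * ed q.2 i x) * (‖F p‖ₑ * (emon p.1 x * ed p.2 j x)) +
      ‖K q‖ₑ * (emon q.1 x * edd q.2 i j x) * (‖F p‖ₑ * (ed p.1 j x * emon p.2 x)))),
    ← ENNReal.tsum_add]
  refine ENNReal.tsum_le_tsum fun p => ?_
  rw [ENNReal.tsum_prod', ← ENNReal.tsum_add]
  refine ENNReal.tsum_le_tsum fun q => ?_
  rw [← ENNReal.tsum_add]
  refine ENNReal.tsum_le_tsum fun j => (split p q j).trans (le_of_eq ?_)
  ring

theorem dfld_zero (f : Ham) (x : ℕ+ → ℝ≥0∞) (i : ℕ+) : dfld f x 0 i = 0 := by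
  simp [dfld]

theorem wn_eq_zero {w : Weight} {x : ℕ+ → ℝ≥0∞} (h : wn w x = 0) : x = 0 := by
  funext j
  have := le_wn w x j
  rw [h, nonpos_iff_eq_zero, mul_eq_zero] at this
  exact this.resolve_left (ofReal_weight_ne_zero w j)

@[simp] theorem wn_zero (w : Weight) : wn w 0 = 0 := by simp [wn]

theorem wn_dfld_le' (w : Weight) {R ρ b : ℝ≥0∞} (f : Ham) {x v : ℕ+ → ℝ≥0∞} (hx : wn w x ≤ R)
    (hv : wn w v ≤ b) (hb : b ≠ ⊤) (hρ : ρ ≠ 0) (hρ' : ρ ≠ ⊤) :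
    wn w (dfld f x v) ≤ b / ρ * fldSup w (R + ρ) f := by
  by_cases hb0 : b = 0
  · have hv0 : v = 0 := wn_eq_zero (le_antisymm (hb0 ▸ hv) bot_le)
    have : dfld f x v = 0 := by rw [hv0]; funext i; exact dfld_zero f x i
    rw [this, wn_zero]
    exact bot_le
  · exact wn_dfld_le w f hx hv hb0 hb hρ hρ'

/-- Two Cauchy estimates with factor `1/ρ`, one for each field differentiated along the other. -/
theorem fldSup_bracket_le (w : Weight) {R ρ : ℝ≥0∞} {F K : Ham} (hF : Good F) (hK : Good K)
    (hρ : ρ ≠ 0) (hρ' : ρ ≠ ⊤) (hFfin : fldSup w (R + ρ) F ≠ ⊤) (hKfin : fldSup w (R + ρ) K ≠ ⊤) :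
    fldSup w R (bracket F K) ≤ 2 / ρ * fldSup w (R + ρ) F * fldSup w (R + ρ) K := by
  refine iSup₂_le fun x hx => ?_
  have hx' : wn w x ≤ R + ρ := hx.trans le_self_add
  refine (wn_mono w fun i => fld_bracket_le hF hK x i).trans ((wn_add_le w _ _).trans ?_)
  refine (add_le_add (wn_dfld_le' w F hx (wn_fld_le w K hx') hKfin hρ hρ')
    (wn_dfld_le' w K hx (wn_fld_le w F hx') hFfin hρ hρ')).trans (le_of_eq ?_)
  simp only [div_eq_mul_inv]
  ring

/-! ### Iterated Poisson brackets and their factorial growth. -/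

/-- The iterated brackets `ad_F^k K`. -/
def adPow (F K : Ham) (k : ℕ) : Ham := (bracket F)^[k] K

theorem adPow_zero (F K : Ham) : adPow F K 0 = K := rfl

theorem adPow_succ (F K : Ham) (k : ℕ) : adPow F K (k + 1) = bracket F (adPow F K k) :=
  Function.iterate_succ_apply' _ _ _

theorem Good.adPow {F K : Ham} (hF : Good F) (hK : Good K) (k : ℕ) : Good (adPow F K k) := by
  induction k with
  | zero => exact hK
  | succ k ih => rw [adPow_succ]; exact hF.bracket ih

theorem fldSup_adPow_le_pow_mul (w : Weight) {R ρ : ℝ≥0∞} {F K : Ham} (hF : Good F) (hK : Good K)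
    (hρ : ρ ≠ 0) (hρ' : ρ ≠ ⊤) (k : ℕ) (hFfin : fldSup w (R + k * ρ) F ≠ ⊤)
    (hKfin : fldSup w (R + k * ρ) K ≠ ⊤) :
    fldSup w R (adPow F K k)
      ≤ (2 / ρ * fldSup w (R + k * ρ) F) ^ k * fldSup w (R + k * ρ) K := by
  induction k generalizing R with
  | zero => simp [adPow_zero]
  | succ k ih =>
    have e : R + ρ + k * ρ = R + (k + 1 : ℕ) * ρ := by push_cast; ring
    -- The outermost bracket uses the innermost layer, from `R` to `R + ρ`; the other `k` brackets
    -- use the layers beyond.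
    have h1 := ih (R := R + ρ) (by rwa [e]) (by rwa [e])
    rw [e] at h1
    have hle : R + ρ ≤ R + (k + 1 : ℕ) * ρ := by rw [← e]; exact le_self_add
    have hF1 : fldSup w (R + ρ) F ≠ ⊤ := ne_top_of_le_ne_top hFfin (fldSup_mono w hle F)
    have hK1 : fldSup w (R + ρ) (adPow F K k) ≠ ⊤ := by
      refine ne_top_of_le_ne_top ?_ h1
      exact ENNReal.mul_ne_top (ENNReal.pow_ne_top (ENNReal.mul_ne_top
        (ENNReal.div_ne_top (by simp) hρ) hFfin)) hKfin
    rw [adPow_succ]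
    refine (fldSup_bracket_le w hF (hF.adPow hK k) hρ hρ' hF1 hK1).trans ?_
    refine (mul_le_mul' (mul_le_mul_right (fldSup_mono w hle F) _) h1).trans (le_of_eq ?_)
    rw [pow_succ]
    ring

/-- The induction step is `(1 + 1/(k+1))^{k+1} ≤ e`. Starting from `1 ≤ 1` saves one factor `e` over
the usual `n^n ≤ n! e^n`, which is what produces the `1/e` in the remainder bounds. -/
theorem pow_self_le_factorial_mul_exp (k : ℕ) :
    ((k + 1 : ℕ) : ℝ) ^ (k + 1) ≤ (k + 1).factorial * Real.exp 1 ^ k := by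
  induction k with
  | zero => simp
  | succ k ih =>
    have h1 : ((k + 1 + 1 : ℕ) : ℝ) ^ (k + 1) ≤ ((k + 1 : ℕ) : ℝ) ^ (k + 1) * Real.exp 1 := by
      have h2 : (1 + 1 / ((k + 1 : ℕ) : ℝ)) ≤ Real.exp (1 / ((k + 1 : ℕ) : ℝ)) := by
        rw [add_comm]; exact Real.add_one_le_exp _
      have h3 := pow_le_pow_left₀ (by positivity) h2 (k + 1)
      rw [← Real.exp_nat_mul, mul_one_div_cancel (by positivity)] at h3
      have h4 : ((k + 1 + 1 : ℕ) : ℝ) = ((k + 1 : ℕ) : ℝ) * (1 + 1 / ((k + 1 : ℕ) : ℝ)) := by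
        field_simp
        push_cast
        ring
      rw [h4, mul_pow]
      exact mul_le_mul_of_nonneg_left h3 (by positivity)
    calc ((k + 1 + 1 : ℕ) : ℝ) ^ (k + 1 + 1)
        = ((k + 1 + 1 : ℕ) : ℝ) ^ (k + 1) * ((k + 1 + 1 : ℕ) : ℝ) := pow_succ _ _
      _ ≤ ((k + 1 : ℕ) : ℝ) ^ (k + 1) * Real.exp 1 * ((k + 1 + 1 : ℕ) : ℝ) := by gcongr
      _ ≤ ((k + 1).factorial * Real.exp 1 ^ k) * Real.exp 1 * ((k + 1 + 1 : ℕ) : ℝ) := by gcongr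
      _ = _ := by rw [Nat.factorial_succ (k + 1)]; push_cast; ring

/-- `(k+1)^{k+1} ≤ (k+1)! e^k` in `[0, ∞]`. -/
theorem pow_self_le_factorial_mul_exp_ennreal (k : ℕ) :
    ((k + 1 : ℕ) : ℝ≥0∞) ^ (k + 1) ≤ (k + 1).factorial * ENNReal.ofReal (Real.exp 1) ^ k := by
  have := ENNReal.ofReal_le_ofReal (pow_self_le_factorial_mul_exp k)
  rwa [ENNReal.ofReal_pow (by positivity), ENNReal.ofReal_mul (by positivity),
    ENNReal.ofReal_natCast, ENNReal.ofReal_natCast, ENNReal.ofReal_pow (by positivity)] at this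

/-- The loss `ρ` is divided equally among the `k + 1` brackets. The resulting factor `(k+1)^{k+1}`
is paid for by `(k+1)!`, which the Lie series cancels, and by `e^k`. -/
theorem fldSup_adPow_le (w : Weight) {R ρ : ℝ≥0∞} {F K : Ham} (hF : Good F) (hK : Good K)
    (hρ : ρ ≠ 0) (hρ' : ρ ≠ ⊤) (hFfin : fldSup w (R + ρ) F ≠ ⊤) (hKfin : fldSup w (R + ρ) K ≠ ⊤)
    (k : ℕ) :
    fldSup w R (adPow F K (k + 1)) ≤ (k + 1).factorial * (2 / ρ * fldSup w (R + ρ) F *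
      (ENNReal.ofReal (Real.exp 1) * (2 / ρ * fldSup w (R + ρ) F)) ^ k) * fldSup w (R + ρ) K := by
  have hk0 : ((k + 1 : ℕ) : ℝ≥0∞) ≠ 0 := by exact_mod_cast Nat.succ_ne_zero k
  have hkt : ((k + 1 : ℕ) : ℝ≥0∞) ≠ ⊤ := ENNReal.natCast_ne_top _
  have e : ((k + 1 : ℕ) : ℝ≥0∞) * (ρ / (k + 1 : ℕ)) = ρ := ENNReal.mul_div_cancel hk0 hkt
  have h := fldSup_adPow_le_pow_mul w (R := R) (ρ := ρ / (k + 1 : ℕ)) hF hK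
    (ENNReal.div_ne_zero.2 ⟨hρ, hkt⟩) (ENNReal.div_ne_top hρ' hk0) (k + 1)
    (by rwa [e]) (by rwa [e])
  rw [e] at h
  refine h.trans (mul_le_mul_left ?_ _)
  have e2 : 2 / (ρ / (k + 1 : ℕ)) = ((k + 1 : ℕ) : ℝ≥0∞) * (2 / ρ) := by
    rw [div_eq_mul_inv, ENNReal.inv_div (Or.inl hkt) (Or.inl hk0), div_eq_mul_inv,
      div_eq_mul_inv]
    ring
  rw [e2, mul_assoc, mul_pow]
  refine (mul_le_mul_left (pow_self_le_factorial_mul_exp_ennreal k) _).trans (le_of_eq ?_)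
  rw [pow_succ (2 / ρ * fldSup w (R + ρ) F), mul_pow (ENNReal.ofReal _)]
  ring

/-! ### The moduli of a sequence and the majorant norm -/

/-- The sequence of the moduli. -/
def absSeq (z : ℕ+ → ℂ) : ℕ+ → ℝ≥0∞ := fun j => ‖z j‖ₑ

theorem ofReal_weight_sq_mul (w : Weight) (z : ℕ+ → ℂ) (j : ℕ+) :
    ENNReal.ofReal (w.val j) ^ 2 * absSeq z j ^ 2 = ENNReal.ofReal (w.val j ^ 2 * ‖z j‖ ^ 2) := by
  rw [absSeq, ← ofReal_norm, ENNReal.ofReal_mul (by positivity), ENNReal.ofReal_pow (w.pos j).le,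
    ENNReal.ofReal_pow (norm_nonneg _)]

theorem mem_hSub_of_wn_lt_top (w : Weight) {z : ℕ+ → ℂ} (h : wn w (absSeq z) < ⊤) : z ∈ hSub w := by
  rw [mem_hSub_iff]
  have h2 : ∑' j, ENNReal.ofReal (w.val j ^ 2 * ‖z j‖ ^ 2) ≠ ⊤ := by
    simp_rw [← ofReal_weight_sq_mul]
    rw [← wn_sq]
    exact ENNReal.pow_ne_top h.ne
  have := ENNReal.summable_toReal h2
  refine this.congr fun j => ?_
  rw [ENNReal.toReal_ofReal (by positivity)]

theorem wn_absSeq (w : Weight) (z : HSpace w) : wn w (absSeq z) = ‖z‖ₑ := by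
  refine (ENNReal.pow_right_strictMono two_ne_zero).injective ?_
  rw [wn_sq, ← ofReal_norm, ← ENNReal.ofReal_pow (norm_nonneg _), norm_sq_eq,
    ENNReal.ofReal_tsum_of_nonneg (fun j => by positivity) ((mem_hSub_iff w z.1).1 z.2)]
  exact tsum_congr fun j => ofReal_weight_sq_mul w _ j

theorem mem_ball_iff_enorm {w : Weight} {r : ℝ} (hr : 0 ≤ r) {z : HSpace w} :
    z ∈ ball w r ↔ ‖z‖ₑ ≤ ENNReal.ofReal r := by
  rw [mem_closedBall_zero_iff, ← ofReal_norm, ENNReal.ofReal_le_ofReal_iff hr]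

/-- The monomial `y^n` with complex values. -/
def cmon (n : ℕ+ →₀ ℕ) (y : ℕ+ → ℂ) : ℂ := n.prod fun j k => y j ^ k

theorem cmon_add (n m : ℕ+ →₀ ℕ) (y : ℕ+ → ℂ) : cmon (n + m) y = cmon n y * cmon m y :=
  Finsupp.prod_add_index' (by simp) (by intros; exact pow_add _ _ _)

@[simp] theorem cmon_single (a : ℕ+) (y : ℕ+ → ℂ) : cmon (Finsupp.single a 1) y = y a := by
  simp [cmon]

@[simp] theorem cmon_zero (y : ℕ+ → ℂ) : cmon 0 y = 1 := by simp [cmon]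

theorem enorm_prod' {ι : Type} (s : Finset ι) (f : ι → ℂ) : ‖∏ i ∈ s, f i‖ₑ = ∏ i ∈ s, ‖f i‖ₑ := by
  classical
  induction s using Finset.induction with
  | empty => simp
  | insert a s ha ih => rw [Finset.prod_insert ha, Finset.prod_insert ha, enorm_mul, ih]

theorem enorm_cmon (n : ℕ+ →₀ ℕ) (y : ℕ+ → ℂ) : ‖cmon n y‖ₑ = emon n (absSeq y) := by
  simp only [cmon, emon, Finsupp.prod, enorm_prod', enorm_pow, absSeq]

/-- The complex conjugate sequence. -/
def conjSeq (z : ℕ+ → ℂ) : ℕ+ → ℂ := fun j => conj (z j)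

theorem enorm_conj (z : ℂ) : ‖conj z‖ₑ = ‖z‖ₑ := by
  rw [← ofReal_norm, RCLike.norm_conj, ofReal_norm]

@[simp] theorem absSeq_conjSeq (z : ℕ+ → ℂ) : absSeq (conjSeq z) = absSeq z :=
  funext fun j => enorm_conj (z j)

theorem mon_eq (p : MIdx) (z : ℕ+ → ℂ) : mon p z = cmon p.1 z * cmon p.2 (conjSeq z) := rfl

theorem enorm_mon (p : MIdx) (z : ℕ+ → ℂ) :
    ‖mon p z‖ₑ = emon p.1 (absSeq z) * emon p.2 (absSeq z) := by
  rw [mon_eq, enorm_mul, enorm_cmon, enorm_cmon, absSeq_conjSeq]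

theorem enorm_natCast' (n : ℕ) : ‖(n : ℂ)‖ₑ = n := by
  rw [← ofReal_norm, Complex.norm_natCast, ENNReal.ofReal_natCast]

theorem majorantField_eq (f : Ham) (z : ℕ+ → ℂ) (j : ℕ+) :
    majorantField f z j = fld f (absSeq z) j := by
  refine tsum_congr fun p => ?_
  rw [enorm_mon, ed]
  ring

/-- A sequence in `[0, ∞]` of finite weighted norm has finite entries, the weights being positive,
and is therefore the modulus of a point of `h_w`. The two suprema thus range over the same data. -/
theorem hamNorm_eq (w : Weight) {r : ℝ} (hr : 0 ≤ r) (f : Ham) :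
    hamNorm w r f = (ENNReal.ofReal r)⁻¹ * fldSup w (ENNReal.ofReal r) f := by
  rw [hamNorm]
  congr 1
  have hz : ∀ z : HSpace w, (∑' j, ENNReal.ofReal (w.val j) ^ 2 * majorantField f z j ^ 2) ^
      (1 / 2 : ℝ) = wn w (fld f (absSeq z)) := by
    intro z
    simp only [majorantField_eq]
    rfl
  simp_rw [hz]
  apply le_antisymm
  · refine iSup₂_le fun z h => wn_fld_le w f ?_
    rw [wn_absSeq]
    exact (mem_ball_iff_enorm hr).1 h
  · refine iSup₂_le fun x hx => ?_
    have hfin : wn w x < ⊤ := hx.trans_lt ENNReal.ofReal_lt_top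
    have hx' : absSeq (fun j => ((x j).toReal : ℂ)) = x := by
      funext j
      rw [absSeq, ← ofReal_norm, Complex.norm_real, Real.norm_of_nonneg ENNReal.toReal_nonneg,
        ENNReal.ofReal_toReal (lt_top_of_wn_lt_top w hfin j).ne]
    have hmem := mem_hSub_of_wn_lt_top w (z := fun j => ((x j).toReal : ℂ)) (by rwa [hx'])
    let z : HSpace w := ⟨_, hmem⟩
    have hzx : absSeq z = x := hx'
    refine le_iSup₂_of_le z ?_ (by rw [hzx])
    rw [mem_ball_iff_enorm hr, ← wn_absSeq, hzx]
    exact hx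

theorem fldSup_eq (w : Weight) {r : ℝ} (hr : 0 < r) (f : Ham) :
    fldSup w (ENNReal.ofReal r) f = ENNReal.ofReal r * hamNorm w r f := by
  rw [hamNorm_eq w hr.le, ← mul_assoc, ENNReal.mul_inv_cancel (by simpa using hr) (by simp),
    one_mul]

/-! ### Completeness of `h_w` -/

instance (w : Weight) : CompleteSpace (HSpace w) := by
  have hiso : Isometry (toEll2 w) := AddMonoidHomClass.isometry_of_norm _ fun _ => rfl
  have hsurj : Function.Surjective (toEll2 w) := by
    intro y
    have e : (fun j => (w.val j : ℂ) * ((w.val j : ℂ)⁻¹ * y j)) = (y : ∀ _ : ℕ+, ℂ) := by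
      funext j
      exact mul_inv_cancel_left₀ (by exact_mod_cast (w.pos j).ne') _
    have hmem : (fun j => (w.val j : ℂ)⁻¹ * y j) ∈ hSub w := by
      change Memℓp (fun j => (w.val j : ℂ) * ((w.val j : ℂ)⁻¹ * y j)) 2
      rw [e]
      exact y.2
    exact ⟨⟨_, hmem⟩, Subtype.ext e⟩
  exact (IsometryEquiv.mk (Equiv.ofBijective _ ⟨toEll2_injective w, hsurj⟩) hiso).completeSpace

/-! ### The Hamiltonian vector field -/

/-- The difference of products is telescoped one factor at a time, every other factor being
dominated by the common majorant `x`. -/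
theorem enorm_cmon_sub_le (n : ℕ+ →₀ ℕ) {y y' : ℕ+ → ℂ} {x v : ℕ+ → ℝ≥0∞}
    (hy : ∀ j, ‖y j‖ₑ ≤ x j) (hy' : ∀ j, ‖y' j‖ₑ ≤ x j) (hv : ∀ j, ‖y' j - y j‖ₑ ≤ v j) :
    ‖cmon n y' - cmon n y‖ₑ ≤ ∑' j, v j * ed n j x := by
  induction n using finsupp_single_induction with
  | h0 => simp
  | h1 n a ih =>
    have e : ∑' j, v j * ed (n + Finsupp.single a 1) j x
        = (∑' j, v j * ed n j x) * x a + emon n x * v a := by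
      rw [← ENNReal.tsum_mul_right]
      rw [show emon n x * v a = ∑' j, if j = a then emon n x * v a else 0 by
        rw [tsum_ite_eq], ← ENNReal.tsum_add]
      refine tsum_congr fun j => ?_
      rw [ed_add, ed_single, emon_single]
      by_cases h : a = j
      · subst h; simp; ring
      · simp [h, Ne.symm h]; ring
    rw [e, cmon_add, cmon_add, cmon_single, cmon_single]
    have : cmon n y' * y' a - cmon n y * y a
        = (cmon n y' - cmon n y) * y' a + cmon n y * (y' a - y a) := by ring
    rw [this]
    refine (enorm_add_le _ _).trans ?_
    rw [enorm_mul, enorm_mul, enorm_cmon]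
    exact add_le_add (mul_le_mul' ih (hy' a)) (mul_le_mul' (emon_mono n hy) (hv a))

/-- The `j`-th component of the vector field of the monomial `z^α z̄^β`, up to the factor `-i`. -/
def dzmon (p : MIdx) (j : ℕ+) (z : ℕ+ → ℂ) : ℂ :=
  (p.2 j : ℂ) * mon (p.1, p.2 - Finsupp.single j 1) z

theorem dzbar_eq (f : Ham) (z : ℕ+ → ℂ) (j : ℕ+) : dzbar f z j = ∑' p, f p * dzmon p j z :=
  tsum_congr fun _ => mul_assoc _ _ _

theorem enorm_dzmon (p : MIdx) (j : ℕ+) (z : ℕ+ → ℂ) :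
    ‖dzmon p j z‖ₑ = emon p.1 (absSeq z) * ed p.2 j (absSeq z) := by
  rw [dzmon, enorm_mul, enorm_natCast', enorm_mon, ed]
  ring

theorem enorm_dzmon_sub_le (p : MIdx) (i : ℕ+) {z z' : ℕ+ → ℂ} {x v : ℕ+ → ℝ≥0∞}
    (hz : ∀ j, ‖z j‖ₑ ≤ x j) (hz' : ∀ j, ‖z' j‖ₑ ≤ x j) (hv : ∀ j, ‖z' j - z j‖ₑ ≤ v j) :
    ‖dzmon p i z' - dzmon p i z‖ₑ
      ≤ ∑' j, v j * (ed p.1 j x * ed p.2 i x + emon p.1 x * edd p.2 i j x) := by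
  have h1 := enorm_cmon_sub_le p.1 hz hz' hv
  have h2 := enorm_cmon_sub_le (p.2 - Finsupp.single i 1) (y := conjSeq z) (y' := conjSeq z')
    (x := x) (v := v) (fun j => (enorm_conj (z j)).le.trans (hz j))
    (fun j => (enorm_conj (z' j)).le.trans (hz' j))
    (fun j => by
      rw [conjSeq, conjSeq, ← map_sub, enorm_conj]
      exact hv j)
  have e : dzmon p i z' - dzmon p i z = (cmon p.1 z' - cmon p.1 z) *
      ((p.2 i : ℂ) * cmon (p.2 - Finsupp.single i 1) (conjSeq z')) +
      cmon p.1 z * ((p.2 i : ℂ) * (cmon (p.2 - Finsupp.single i 1) (conjSeq z')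
        - cmon (p.2 - Finsupp.single i 1) (conjSeq z))) := by
    simp only [dzmon, mon_eq]
    ring
  rw [e]
  refine (enorm_add_le _ _).trans ?_
  rw [enorm_mul, enorm_mul, enorm_mul, enorm_mul, enorm_cmon, enorm_cmon, enorm_natCast',
    absSeq_conjSeq]
  simp_rw [mul_add]
  rw [ENNReal.tsum_add]
  refine add_le_add ?_ ?_
  · simp_rw [← mul_assoc]
    rw [ENNReal.tsum_mul_right, mul_assoc]
    exact mul_le_mul' h1 (ed_mono p.2 i hz')
  · have : ∑' j, v j * (emon p.1 x * edd p.2 i j x)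
        = emon p.1 x * ((p.2 i : ℝ≥0∞) * ∑' j, v j * ed (p.2 - Finsupp.single i 1) j x) := by
      rw [← ENNReal.tsum_mul_left, ← ENNReal.tsum_mul_left]
      exact tsum_congr fun j => by rw [edd]; ring
    rw [this]
    exact mul_le_mul' (emon_mono p.1 hz) (mul_le_mul_right h2 _)

theorem tsum_enorm_dzmon (f : Ham) (z : ℕ+ → ℂ) (j : ℕ+) :
    ∑' p, ‖f p * dzmon p j z‖ₑ = fld f (absSeq z) j :=
  tsum_congr fun p => by rw [enorm_mul, enorm_dzmon]

theorem summable_of_tsum_enorm_ne_top {ι : Type} {f : ι → ℂ} (h : ∑' i, ‖f i‖ₑ ≠ ⊤) :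
    Summable fun i => ‖f i‖ := by
  have := ENNReal.summable_toReal h
  simpa using this

theorem summable_dzmon {f : Ham} {z : ℕ+ → ℂ} {j : ℕ+} (h : fld f (absSeq z) j ≠ ⊤) :
    Summable fun p => f p * dzmon p j z := by
  refine Summable.of_norm (summable_of_tsum_enorm_ne_top ?_)
  rwa [tsum_enorm_dzmon]

theorem enorm_dzbar_le (f : Ham) (z : ℕ+ → ℂ) (j : ℕ+) : ‖dzbar f z j‖ₑ ≤ fld f (absSeq z) j := by
  rw [dzbar_eq]
  exact enorm_tsum_le_tsum_enorm.trans (tsum_enorm_dzmon f z j).le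

theorem enorm_dzbar_sub_le {f : Ham} {z z' : ℕ+ → ℂ} (i : ℕ+) {x v : ℕ+ → ℝ≥0∞}
    (hz : ∀ j, ‖z j‖ₑ ≤ x j) (hz' : ∀ j, ‖z' j‖ₑ ≤ x j) (hv : ∀ j, ‖z' j - z j‖ₑ ≤ v j)
    (hx : fld f x i ≠ ⊤) : ‖dzbar f z' i - dzbar f z i‖ₑ ≤ dfld f x v i := by
  rw [dzbar_eq, dzbar_eq, ← (summable_dzmon (ne_top_of_le_ne_top hx (fld_mono f hz' i))).tsum_sub
    (summable_dzmon (ne_top_of_le_ne_top hx (fld_mono f hz i)))]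
  refine enorm_tsum_le_tsum_enorm.trans (ENNReal.tsum_le_tsum fun p => ?_)
  rw [← mul_sub, enorm_mul]
  exact mul_le_mul_right (enorm_dzmon_sub_le p i hz hz' hv) _

open Classical in
/-- The Hamiltonian vector field `(-i ∂_{z̄_j} f)_j`, with value `0` where it is not in `h_w`. -/
def vf (w : Weight) (f : Ham) (z : HSpace w) : HSpace w :=
  if h : (fun j => -Complex.I * dzbar f z j) ∈ hSub w then ⟨_, h⟩ else 0

theorem enorm_neg_I_mul (z : ℂ) : ‖-Complex.I * z‖ₑ = ‖z‖ₑ := by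
  rw [← ofReal_norm, ← ofReal_norm]
  simp

theorem absSeq_field_le (f : Ham) (z : ℕ+ → ℂ) (j : ℕ+) :
    absSeq (fun j => -Complex.I * dzbar f z j) j ≤ fld f (absSeq z) j := by
  rw [absSeq, enorm_neg_I_mul]
  exact enorm_dzbar_le f z j

theorem vf_apply {w : Weight} {f : Ham} {z : HSpace w} (h : wn w (fld f (absSeq z)) < ⊤) (j : ℕ+) :
    vf w f z j = -Complex.I * dzbar f z j := by
  have hm : (fun j => -Complex.I * dzbar f z j) ∈ hSub w :=
    mem_hSub_of_wn_lt_top w ((wn_mono w (absSeq_field_le f z)).trans_lt h)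
  exact congrFun (congrArg Subtype.val (dif_pos hm : vf w f z = (⟨_, hm⟩ : hSub w))) j

theorem enorm_vf_le {w : Weight} {f : Ham} {z : HSpace w} (h : wn w (fld f (absSeq z)) < ⊤) :
    ‖vf w f z‖ₑ ≤ wn w (fld f (absSeq z)) := by
  rw [← wn_absSeq]
  refine wn_mono w fun j => ?_
  rw [absSeq, vf_apply h]
  exact absSeq_field_le f z j

theorem enorm_vf_le_fldSup {w : Weight} {f : Ham} {R : ℝ≥0∞} {z : HSpace w} (hz : ‖z‖ₑ ≤ R)
    (h : fldSup w R f < ⊤) : ‖vf w f z‖ₑ ≤ fldSup w R f := by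
  have h1 := wn_fld_le w f ((wn_absSeq w z).le.trans hz)
  exact (enorm_vf_le (h1.trans_lt h)).trans h1

/-- If the points are within `ρ/2`, both are dominated by `|z| + |z' - z|`, which lies in the ball
of radius `R + ρ/2` and leaves `ρ/2` for the Cauchy estimate. If they are farther apart, boundedness
of the field suffices. -/
theorem enorm_vf_sub_le {w : Weight} {f : Ham} {R ρ : ℝ≥0∞} (hρ : ρ ≠ 0) (hρ' : ρ ≠ ⊤)
    (h : fldSup w (R + ρ) f < ⊤) {z z' : HSpace w} (hz : ‖z‖ₑ ≤ R) (hz' : ‖z'‖ₑ ≤ R) :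
    ‖vf w f z' - vf w f z‖ₑ ≤ 4 / ρ * fldSup w (R + ρ) f * ‖z' - z‖ₑ := by
  have hle : R ≤ R + ρ := le_self_add
  by_cases hd : ‖z' - z‖ₑ ≤ ρ / 2
  · obtain ⟨d, hd'⟩ : ∃ d : HSpace w, d = z' - z := ⟨_, rfl⟩
    obtain ⟨D, hD⟩ : ∃ D : HSpace w, D = vf w f z' - vf w f z := ⟨_, rfl⟩
    have hdj : ∀ j, d j = z' j - z j := fun j => by rw [hd']; rfl
    have hDj : ∀ j, D j = vf w f z' j - vf w f z j := fun j => by rw [hD]; rfl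
    rw [← hd'] at hd ⊢
    rw [← hD]
    let x : ℕ+ → ℝ≥0∞ := fun j => absSeq z j + absSeq d j
    have hxw : wn w x ≤ R + ρ / 2 := by
      refine (wn_add_le w _ _).trans (add_le_add ?_ ?_)
      · rw [wn_absSeq]; exact hz
      · rw [wn_absSeq]; exact hd
    have hxw' : wn w x ≤ R + ρ := hxw.trans (by gcongr; exact ENNReal.half_le_self)
    have hfx : wn w (fld f x) < ⊤ := (wn_fld_le w f hxw').trans_lt h
    have hzx : ∀ j, ‖z j‖ₑ ≤ x j := fun j => le_self_add
    have hzx' : ∀ j, ‖z' j‖ₑ ≤ x j := fun j => by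
      have : z' j = z j + d j := by rw [hdj]; ring
      rw [this]
      exact enorm_add_le _ _
    have hwz : wn w (fld f (absSeq z)) < ⊤ := (wn_mono w (fld_mono f hzx)).trans_lt hfx
    have hwz' : wn w (fld f (absSeq z')) < ⊤ := (wn_mono w (fld_mono f hzx')).trans_lt hfx
    have hb : ‖d‖ₑ ≠ ⊤ := enorm_ne_top
    have h1 : ‖D‖ₑ ≤ wn w (dfld f x (absSeq d)) := by
      rw [← wn_absSeq]
      refine wn_mono w fun j => ?_
      rw [absSeq, hDj, vf_apply hwz, vf_apply hwz', ← mul_sub, enorm_neg_I_mul]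
      refine enorm_dzbar_sub_le j hzx hzx' (fun j => ?_) (lt_top_of_wn_lt_top w hfx j).ne
      rw [← hdj]
      exact le_rfl
    refine h1.trans ((wn_dfld_le' w (ρ := ρ / 2) f hxw (wn_absSeq w _).le hb
      (ENNReal.div_ne_zero.2 ⟨hρ, by simp⟩) (ENNReal.div_ne_top hρ' (by simp))).trans ?_)
    rw [add_assoc, ENNReal.add_halves]
    have : ‖d‖ₑ / (ρ / 2) = 2 / ρ * ‖d‖ₑ := by
      rw [div_eq_mul_inv, ENNReal.inv_div (Or.inl ENNReal.ofNat_ne_top)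
        (Or.inl two_ne_zero), mul_comm]
    rw [this]
    calc _ = 2 / ρ * fldSup w (R + ρ) f * ‖d‖ₑ := by ring
      _ ≤ _ := by
        gcongr
        norm_num
  · rw [not_le] at hd
    have hN := fldSup_mono w hle f
    have h1 := (enorm_vf_le_fldSup hz (hN.trans_lt h)).trans hN
    have h2 := (enorm_vf_le_fldSup hz' (hN.trans_lt h)).trans hN
    refine enorm_sub_le.trans ((add_le_add h2 h1).trans ?_)
    calc fldSup w (R + ρ) f + fldSup w (R + ρ) f
        = 4 / ρ * (ρ / 2) * fldSup w (R + ρ) f := by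
          have : (4 : ℝ≥0∞) / ρ * (ρ / 2) = 2 := by
            rw [div_eq_mul_inv, div_eq_mul_inv, show (4 : ℝ≥0∞) * ρ⁻¹ * (ρ * 2⁻¹)
              = 4 * 2⁻¹ * (ρ⁻¹ * ρ) by ring, ENNReal.inv_mul_cancel hρ hρ', mul_one,
              show (4 : ℝ≥0∞) = 2 * 2 by norm_num, mul_assoc,
              ENNReal.mul_inv_cancel (by simp) (by simp), mul_one]
          rw [this, two_mul]
      _ ≤ 4 / ρ * ‖z' - z‖ₑ * fldSup w (R + ρ) f := by gcongr
      _ = _ := by ring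

/-! ### The Hamiltonian flow -/

open Set in
-- The Picard fixed point is used directly in order to retain that the curve stays in the ball of
-- radius `a`. The curve is frozen outside the time interval, hence the bound for all `t`.
theorem exists_solution_mem_closedBall {E : Type*} [NormedAddCommGroup E] [NormedSpace ℝ E]
    [CompleteSpace E] {f : ℝ → E → E} {tmin tmax : ℝ} {t₀ : Icc tmin tmax} {x₀ x : E}
    {a r L K : NNReal} (hf : IsPicardLindelof f t₀ x₀ a r L K) (hx : x ∈ Metric.closedBall x₀ r) :
    ∃ α : ℝ → E, α t₀ = x ∧
      (∀ t ∈ Icc tmin tmax, HasDerivWithinAt α (f t (α t)) (Icc tmin tmax) t) ∧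
      ∀ t, α t ∈ Metric.closedBall x₀ a := by
  obtain ⟨α, hα⟩ := ODE.FunSpace.exists_isFixedPt_next hf hx
  refine ⟨α.compProj, by rw [ODE.FunSpace.compProj_val, ← hα, ODE.FunSpace.next_apply₀],
    fun t ht => ?_, fun t => α.compProj_mem_closedBall hf.mul_max_le⟩
  apply ODE.hasDerivWithinAt_picard_Icc t₀.2 hf.continuousOn_uncurry
    α.continuous_compProj.continuousOn (fun _ ht' => α.compProj_mem_closedBall hf.mul_max_le)
    x ht |>.congr_of_mem _ ht
  intro t' ht'
  nth_rw 1 [← hα]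
  rw [ODE.FunSpace.compProj_of_mem ht', ODE.FunSpace.next_apply]

theorem lipschitzOnWith_vf {w : Weight} {F : Ham} {r ρ d : ℝ} (hr : 0 ≤ r) (hdρ : d < ρ)
    (hd : 0 ≤ d) (hF : fldSup w (ENNReal.ofReal (r + ρ)) F ≤ ENNReal.ofReal d) :
    ∃ K : NNReal, LipschitzOnWith K (vf w F) (ball w (r + d)) := by
  have hρ : ENNReal.ofReal (ρ - d) ≠ 0 := by simpa using hdρ
  have e : ENNReal.ofReal (r + d) + ENNReal.ofReal (ρ - d) = ENNReal.ofReal (r + ρ) := by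
    rw [← ENNReal.ofReal_add (by linarith) (by linarith)]
    congr 1
    ring
  have hfin : fldSup w (ENNReal.ofReal (r + d) + ENNReal.ofReal (ρ - d)) F < ⊤ := by
    rw [e]
    exact hF.trans_lt ENNReal.ofReal_lt_top
  have hK : 4 / ENNReal.ofReal (ρ - d) *
      fldSup w (ENNReal.ofReal (r + d) + ENNReal.ofReal (ρ - d)) F ≠ ⊤ :=
    ENNReal.mul_ne_top (ENNReal.div_ne_top (by simp) hρ) hfin.ne
  refine ⟨(4 / ENNReal.ofReal (ρ - d) *
    fldSup w (ENNReal.ofReal (r + d) + ENNReal.ofReal (ρ - d)) F).toNNReal, fun x hx y hy => ?_⟩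
  rw [edist_eq_enorm_sub, edist_eq_enorm_sub, ENNReal.coe_toNNReal hK]
  exact enorm_vf_sub_le hρ (by simp) hfin ((mem_ball_iff_enorm (by linarith)).1 hy)
    ((mem_ball_iff_enorm (by linarith)).1 hx)

theorem norm_vf_le {w : Weight} {F : Ham} {r ρ d : ℝ} (hr : 0 ≤ r) (hd : 0 ≤ d) (hdρ : d < ρ)
    (hF : fldSup w (ENNReal.ofReal (r + ρ)) F ≤ ENNReal.ofReal d) {z : HSpace w}
    (hz : z ∈ ball w (r + ρ)) : ‖vf w F z‖ ≤ d := by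
  have h := enorm_vf_le_fldSup ((mem_ball_iff_enorm (by linarith)).1 hz)
    (hF.trans_lt ENNReal.ofReal_lt_top)
  have h2 := h.trans hF
  rwa [← ofReal_norm, ENNReal.ofReal_le_ofReal_iff hd] at h2

/-- Existence of the Hamiltonian flow, with the bound `|Φ^t z - z| ≤ d` and the group property. -/
theorem exists_hamFlow {w : Weight} {F : Ham} {r ρ d : ℝ} (hr : 0 ≤ r) (hd : 0 ≤ d) (hdρ : d < ρ)
    (hF : fldSup w (ENNReal.ofReal (r + ρ)) F ≤ ENNReal.ofReal d) :
    ∃ Φ : ℝ → HSpace w → HSpace w, (∀ z ∈ ball w r, Φ 0 z = z ∧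
        (∀ t ∈ Set.Icc (-1 : ℝ) 1,
          HasDerivWithinAt (fun s => Φ s z) (vf w F (Φ t z)) (Set.Icc (-1 : ℝ) 1) t) ∧
        ∀ t, ‖Φ t z - z‖ ≤ d) ∧
      ∀ z ∈ ball w (r - d), Φ 1 (Φ (-1) z) = z ∧ Φ (-1) (Φ 1 z) = z := by
  obtain ⟨K, hK⟩ := lipschitzOnWith_vf hr hdρ hd hF
  have hsub : ∀ z ∈ ball w r, Metric.closedBall z d ⊆ ball w (r + d) := by
    intro z hz y hy
    rw [mem_closedBall_zero_iff] at hz ⊢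
    rw [mem_closedBall_iff_norm] at hy
    have := norm_add_le z (y - z)
    rw [add_sub_cancel] at this
    linarith
  have hsub2 : ball w (r + d) ⊆ ball w (r + ρ) := Metric.closedBall_subset_closedBall (by linarith)
  have hsol : ∀ z : HSpace w, ∃ α : ℝ → HSpace w, z ∈ ball w r → (α 0 = z ∧
      (∀ t ∈ Set.Icc (-1 : ℝ) 1, HasDerivWithinAt α (vf w F (α t)) (Set.Icc (-1 : ℝ) 1) t) ∧
      ∀ t, α t ∈ Metric.closedBall z d) := by
    intro z
    by_cases hz : z ∈ ball w r
    · have h0 : (0 : ℝ) ∈ Set.Icc (-1 : ℝ) 1 := by constructor <;> norm_num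
      -- The field is bounded by `d` and `|t| ≤ 1`, so an orbit moves by at most `d`. Each initial
      -- point is its own centre, so the ball of initial data has radius `0`.
      have hP : IsPicardLindelof (fun _ => vf w F) (⟨0, h0⟩ : Set.Icc (-1 : ℝ) 1) z ⟨d, hd⟩ 0
          ⟨d, hd⟩ K := by
        refine IsPicardLindelof.of_time_independent (fun x hx => ?_) (hK.mono (hsub z hz)) ?_
        · exact norm_vf_le hr hd hdρ hF (hsub2 (hsub z hz hx))
        · simp
      obtain ⟨α, h1, h2, h3⟩ := exists_solution_mem_closedBall hP (Metric.mem_closedBall_self le_rfl)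
      exact ⟨α, fun _ => ⟨h1, h2, h3⟩⟩
    · exact ⟨fun _ => z, fun h => absurd h hz⟩
  choose α hα using hsol
  refine ⟨fun t z => α z t, fun z hz => ⟨(hα z hz).1, (hα z hz).2.1, fun t => ?_⟩, fun z hz => ?_⟩
  · exact mem_closedBall_iff_norm.1 ((hα z hz).2.2 t)
  · have hz' : z ∈ ball w r := Metric.closedBall_subset_closedBall (by linarith) hz
    obtain ⟨h0, hder, hmem⟩ := hα z hz'
    -- The radius `r - d` keeps the whole orbit in the ball of radius `r`, so that the flow may be
    -- restarted from any of its points.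
    have hmem' : ∀ t, α z t ∈ ball w r := by
      intro t
      have h1 := mem_closedBall_iff_norm.1 (hmem t)
      rw [mem_closedBall_zero_iff] at hz ⊢
      have := norm_add_le z (α z t - z)
      rw [add_sub_cancel] at this
      linarith
    have hHD : ∀ y ∈ ball w r, ∀ t ∈ Set.Ioo (-1 : ℝ) 1, HasDerivAt (α y) (vf w F (α y t)) t :=
      fun y hy t ht => ((hα y hy).2.1 t (Set.Ioo_subset_Icc_self ht)).hasDerivAt
        (Icc_mem_nhds ht.1 ht.2)
    constructor
    -- Both curves solve the same autonomous equation and agree at time `0`, so uniqueness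
    -- identifies them; time `1` gives the inverse relation.
    · have key : Set.EqOn (α (α z (-1))) (fun t => α z (t - 1)) (Set.Icc 0 1) := by
        refine ODE_solution_unique_of_mem_Icc_right (v := fun _ => vf w F)
          (s := fun _ => ball w (r + d)) (K := K) (fun t _ => hK) ?_ ?_ ?_ ?_ ?_ ?_ ?_
        · exact fun t ht => ((hα _ (hmem' _)).2.1 t
            ⟨by linarith [ht.1], ht.2⟩).continuousWithinAt.mono
            (Set.Icc_subset_Icc (by norm_num) le_rfl)
        · exact fun t ht => (hHD _ (hmem' _) t ⟨by linarith [ht.1], ht.2⟩).hasDerivWithinAt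
        · exact fun t _ => hsub _ (hmem' _) ((hα _ (hmem' _)).2.2 t)
        · refine ContinuousOn.comp (t := Set.Icc (-1) 1)
            (fun t ht => (hder t ht).continuousWithinAt) (by fun_prop) ?_
          intro t ht
          constructor <;> linarith [ht.1, ht.2]
        · intro t ht
          have h := (hder (t - 1) ⟨by linarith [ht.1], by linarith [ht.2]⟩)
          have h2 : HasDerivWithinAt (fun s : ℝ => s - 1) 1 (Set.Icc t 1) t :=
            ((hasDerivAt_id t).sub_const 1).hasDerivWithinAt
          have h3 := h.scomp (h := fun s : ℝ => s - 1) t h2 (by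
            intro s hs
            constructor <;> linarith [hs.1, hs.2, ht.1])
          rw [one_smul] at h3
          exact h3.mono_of_mem_nhdsWithin (Icc_mem_nhdsGE_of_mem ⟨le_rfl, ht.2⟩)
        · exact fun t _ => hsub z hz' (hmem _)
        · simp [(hα _ (hmem' (-1))).1]
      have := key (Set.right_mem_Icc.2 zero_le_one)
      simpa [h0] using this
    · have key : Set.EqOn (α (α z 1)) (fun t => α z (t + 1)) (Set.Icc (-1) 0) := by
        refine ODE_solution_unique_of_mem_Icc_left (v := fun _ => vf w F)
          (s := fun _ => ball w (r + d)) (K := K) (fun t _ => hK) ?_ ?_ ?_ ?_ ?_ ?_ ?_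
        · exact fun t ht => ((hα _ (hmem' _)).2.1 t
            ⟨ht.1, by linarith [ht.2]⟩).continuousWithinAt.mono
            (Set.Icc_subset_Icc le_rfl (by norm_num))
        · exact fun t ht => (hHD _ (hmem' _) t ⟨ht.1, by linarith [ht.2]⟩).hasDerivWithinAt
        · exact fun t _ => hsub _ (hmem' _) ((hα _ (hmem' _)).2.2 t)
        · refine ContinuousOn.comp (t := Set.Icc (-1) 1)
            (fun t ht => (hder t ht).continuousWithinAt) (by fun_prop) ?_
          intro t ht
          constructor <;> linarith [ht.1, ht.2]
        · intro t ht
          have h := (hder (t + 1) ⟨by linarith [ht.1], by linarith [ht.2]⟩)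
          have h2 : HasDerivWithinAt (fun s : ℝ => s + 1) 1 (Set.Icc (-1) t) t :=
            ((hasDerivAt_id t).add_const 1).hasDerivWithinAt
          have h3 := h.scomp (h := fun s : ℝ => s + 1) t h2 (by
            intro s hs
            constructor <;> linarith [hs.1, hs.2, ht.2])
          rw [one_smul] at h3
          exact h3.mono_of_mem_nhdsWithin (Icc_mem_nhdsLE_of_mem ⟨ht.1, le_rfl⟩)
        · exact fun t _ => hsub z hz' (hmem _)
        · simp [(hα _ (hmem' 1)).1]
      have := key (Set.left_mem_Icc.2 (by norm_num))
      simpa [h0] using this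

/-! ### Evaluation of power series -/

theorem le_mul_ed {n : ℕ+ →₀ ℕ} {j : ℕ+} (h : n j ≠ 0) (x : ℕ+ → ℝ≥0∞) :
    emon n x ≤ x j * ed n j x := by
  have e : n - Finsupp.single j 1 + Finsupp.single j 1 = n :=
    tsub_add_cancel_of_le (Finsupp.single_le_iff.2 (Nat.one_le_iff_ne_zero.2 h))
  have h1 : (1 : ℝ≥0∞) ≤ n j := by exact_mod_cast Nat.one_le_iff_ne_zero.2 h
  calc emon n x = 1 * (emon (n - Finsupp.single j 1) x * x j) := by
        conv_lhs => rw [← e]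
        rw [emon_add, emon_single, one_mul]
    _ ≤ (n j : ℝ≥0∞) * (emon (n - Finsupp.single j 1) x * x j) := mul_le_mul_left h1 _
    _ = _ := by rw [ed]; ring

/-- As in Euler's identity, a nonconstant monomial is at most the sum of its terms `x_j ∂_j`. The
`z` and `z̄` halves have equal sums by reality, which gives the factor `2`. -/
theorem Good.tsum_enorm_mul_emon_le {f : Ham} (hf : Good f) (x : ℕ+ → ℝ≥0∞) :
    ∑' p : MIdx, ‖f p‖ₑ * (emon p.1 x * emon p.2 x) ≤ 2 * ∑' j, x j * fld f x j := by
  have e : 2 * ∑' j, x j * fld f x j = ∑' p : MIdx, ‖f p‖ₑ *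
      ∑' j, x j * (ed p.1 j x * emon p.2 x + emon p.1 x * ed p.2 j x) := by
    simp_rw [← ENNReal.tsum_mul_left]
    rw [ENNReal.tsum_comm]
    refine tsum_congr fun j => ?_
    have : 2 * (x j * fld f x j) = x j * fld f x j + x j * fld f x j := two_mul _
    rw [this]
    conv_lhs => enter [1]; rw [← hf.tsum_ed_fst]
    rw [fld, ← ENNReal.tsum_mul_left, ← ENNReal.tsum_mul_left, ← ENNReal.tsum_add]
    exact tsum_congr fun p => by ring
  rw [e]
  refine ENNReal.tsum_le_tsum fun p => ?_
  by_cases hp : f p = 0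
  · simp [hp]
  refine mul_le_mul_right ?_ _
  obtain ⟨j, hj⟩ : ∃ j, p.1 j ≠ 0 ∨ p.2 j ≠ 0 := by
    by_contra! h
    have : p = (0, 0) := Prod.ext (Finsupp.ext fun j => (h j).1) (Finsupp.ext fun j => (h j).2)
    exact hp (this ▸ hf.zero)
  refine le_trans ?_ (ENNReal.le_tsum j)
  rw [mul_add]
  rcases hj with hj | hj
  · refine le_trans ?_ le_self_add
    rw [← mul_assoc]
    exact mul_le_mul_left (le_mul_ed hj x) _
  · refine le_trans ?_ le_add_self
    rw [mul_left_comm]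
    exact mul_le_mul_right (le_mul_ed hj x) _

theorem tsum_enorm_mul_mon (f : Ham) (z : ℕ+ → ℂ) :
    ∑' p, ‖f p * mon p z‖ₑ = ∑' p : MIdx, ‖f p‖ₑ * (emon p.1 (absSeq z) * emon p.2 (absSeq z)) :=
  tsum_congr fun p => by rw [enorm_mul, enorm_mon]

theorem Good.exists_tsum_enorm_le (w : Weight) : ∃ c : ℝ≥0∞, c < ⊤ ∧ ∀ {f : Ham}, Good f →
    ∀ {R : ℝ≥0∞} {z : HSpace w}, ‖z‖ₑ ≤ R →
      ∑' p, ‖f p * mon p z‖ₑ ≤ c * (R * fldSup w R f) := by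
  obtain ⟨c, hc, h⟩ := exists_tsum_mul_le_wn w
  refine ⟨2 * c, ENNReal.mul_lt_top (by simp) hc, fun {f} hf {R z} hz => ?_⟩
  rw [tsum_enorm_mul_mon]
  refine (hf.tsum_enorm_mul_emon_le _).trans ?_
  rw [mul_assoc]
  refine mul_le_mul_right ((h _ _).trans (mul_le_mul_right ?_ _)) _
  have hz' := (wn_absSeq w z).le.trans hz
  exact mul_le_mul' hz' (wn_fld_le w f hz')

/-- A real even Hamiltonian whose majorant field is bounded is in the class `𝓗_r`. -/
theorem Good.memHam {w : Weight} {r : ℝ} (hr : 0 < r) {f : Ham} (hf : Good f)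
    (h : fldSup w (ENNReal.ofReal r) f < ⊤) : MemHam w r f where
  real := hf.real
  zero := hf.zero
  summable z hz := by
    obtain ⟨c, hc, hsum⟩ := Good.exists_tsum_enorm_le w
    refine summable_of_tsum_enorm_ne_top
      (ne_top_of_le_ne_top ?_ (hsum hf ((mem_ball_iff_enorm hr.le).1 hz)))
    exact (ENNReal.mul_lt_top hc (ENNReal.mul_lt_top ENNReal.ofReal_lt_top h)).ne
  norm_lt := by
    rw [hamNorm_eq w hr.le]
    exact ENNReal.mul_lt_top (ENNReal.inv_lt_top.2 (by simpa using hr)) h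

/-! ### The derivative of a power series along an orbit -/

/-- The partial derivative `∂_j y^n` with complex values. -/
def cd (n : ℕ+ →₀ ℕ) (j : ℕ+) (y : ℕ+ → ℂ) : ℂ := (n j : ℂ) * cmon (n - Finsupp.single j 1) y

theorem enorm_cd (n : ℕ+ →₀ ℕ) (j : ℕ+) (y : ℕ+ → ℂ) : ‖cd n j y‖ₑ = ed n j (absSeq y) := by
  rw [cd, enorm_mul, enorm_natCast', enorm_cmon, ed]

theorem natCast_mul_cmon_sub {n m : ℕ+ →₀ ℕ} {j : ℕ+} (y : ℕ+ → ℂ) :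
    (n j : ℂ) * cmon (n + m - Finsupp.single j 1) y = cd n j y * cmon m y := by
  by_cases h : n j = 0
  · simp [cd, h]
  · rw [← sub_single_add h, cmon_add, cd, mul_assoc]

theorem cd_eq_zero {n : ℕ+ →₀ ℕ} {j : ℕ+} (h : j ∉ n.support) (y : ℕ+ → ℂ) : cd n j y = 0 := by
  simp [cd, Finsupp.notMem_support_iff.1 h]

theorem hasDerivWithinAt_cmon {φ : ℝ → ℕ+ → ℂ} {φ' : ℕ+ → ℂ} {s : Set ℝ} {t : ℝ}
    (h : ∀ j, HasDerivWithinAt (fun u => φ u j) (φ' j) s t) (n : ℕ+ →₀ ℕ) :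
    HasDerivWithinAt (fun u => cmon n (φ u)) (∑ j ∈ n.support, cd n j (φ t) * φ' j) s t := by
  have h1 := HasDerivWithinAt.fun_finsetProd (u := n.support) (f := fun j u => φ u j ^ n j)
    (f' := fun j => (n j : ℂ) * φ t j ^ (n j - 1) * φ' j) (x := t) (s := s)
    fun j _ => (h j).pow (n j)
  refine h1.congr_deriv (Finset.sum_congr rfl fun j hj => ?_)
  have e : cmon (n - Finsupp.single j 1) (φ t)
      = (∏ i ∈ n.support.erase j, φ t i ^ n i) * φ t j ^ (n j - 1) := by
    rw [cmon, Finsupp.prod_of_support_subset (s := n.support) _ Finsupp.support_tsub _ (by simp),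
      ← Finset.prod_erase_mul _ _ hj]
    congr 1
    · refine Finset.prod_congr rfl fun i hi => ?_
      simp [(Finset.ne_of_mem_erase hi).symm]
    · simp
  rw [cd, e, smul_eq_mul]
  ring

theorem continuousOn_cmon {φ : ℝ → ℕ+ → ℂ} {s : Set ℝ} (h : ∀ j, ContinuousOn (fun u => φ u j) s)
    (n : ℕ+ →₀ ℕ) : ContinuousOn (fun u => cmon n (φ u)) s :=
  continuousOn_finsetProd _ fun j _ => (h j).pow _

/-- The derivative of the monomial `q` at `y` in the direction of the Hamiltonian field of `F`. -/
def monDeriv (F : Ham) (q : MIdx) (y : ℕ+ → ℂ) : ℂ :=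
  (∑ j ∈ q.1.support, cd q.1 j y * (-Complex.I * dzbar F y j)) * cmon q.2 (conjSeq y) +
    cmon q.1 y * ∑ j ∈ q.2.support, cd q.2 j (conjSeq y) * (Complex.I * conj (dzbar F y j))

theorem monDeriv_eq_tsum (F : Ham) (q : MIdx) (y : ℕ+ → ℂ) :
    monDeriv F q y = ∑' j, (cmon q.1 y * cd q.2 j (conjSeq y) * (Complex.I * conj (dzbar F y j)) -
      cd q.1 j y * cmon q.2 (conjSeq y) * (Complex.I * dzbar F y j)) := by
  rw [tsum_eq_sum (s := q.1.support ∪ q.2.support), monDeriv,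
    Finset.sum_subset Finset.subset_union_left, Finset.sum_subset
      (s₁ := q.2.support) Finset.subset_union_right, Finset.sum_mul, Finset.mul_sum,
    ← Finset.sum_add_distrib]
  · exact Finset.sum_congr rfl fun j _ => by ring
  · intro j _ hj
    rw [cd_eq_zero hj, zero_mul]
  · intro j _ hj
    rw [cd_eq_zero hj, zero_mul]
  · intro j hj
    rw [Finset.notMem_union] at hj
    rw [cd_eq_zero hj.1, cd_eq_zero hj.2]
    ring

/-- For real-valued `F` the conjugate of `∂_{z̄_j} F` is `∂_{z_j} F`. -/
theorem conj_dzbar {F : Ham} (hF : Good F) (y : ℕ+ → ℂ) (j : ℕ+) :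
    conj (dzbar F y j) = ∑' p : MIdx, F p * (cd p.1 j y * cmon p.2 (conjSeq y)) := by
  rw [dzbar_eq, Complex.conj_tsum, ← (Equiv.prodComm (ℕ+ →₀ ℕ) (ℕ+ →₀ ℕ)).tsum_eq]
  refine tsum_congr fun p => ?_
  obtain ⟨a, b⟩ := p
  have hc : ∀ (n : ℕ+ →₀ ℕ) (y : ℕ+ → ℂ), conj (cmon n y) = cmon n (conjSeq y) := fun n y => by
    simp [cmon, Finsupp.prod, conjSeq]
  have hcc : conjSeq (conjSeq y) = y := by funext i; simp [conjSeq]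
  rw [Equiv.prodComm_apply, Prod.swap_prod_mk, map_mul, ← hF.real a b, dzmon, mon_eq, map_mul,
    map_mul, hc, hc, hcc, map_natCast, cd]
  ring

theorem brCoef_mul_mon (F K : Ham) (p q : MIdx) (j : ℕ+) (y : ℕ+ → ℂ) :
    brCoef F K (p, q, j) * mon (brIdx (p, q, j)) y = K q *
      (cmon q.1 y * cd q.2 j (conjSeq y) *
        (Complex.I * (F p * (cd p.1 j y * cmon p.2 (conjSeq y)))) -
      cd q.1 j y * cmon q.2 (conjSeq y) * (Complex.I * (F p * dzmon p j y))) := by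
  have e1 := natCast_mul_cmon_sub (n := p.1) (m := q.1) (j := j) y
  have e2 := natCast_mul_cmon_sub (n := q.2) (m := p.2) (j := j) (conjSeq y)
  have e3 := natCast_mul_cmon_sub (n := q.1) (m := p.1) (j := j) y
  have e4 := natCast_mul_cmon_sub (n := p.2) (m := q.2) (j := j) (conjSeq y)
  rw [add_comm q.2] at e2
  rw [add_comm q.1] at e3
  have e5 : dzmon p j y = cmon p.1 y * cd p.2 j (conjSeq y) := by
    rw [dzmon, mon_eq, cd]
    ring
  calc _ = Complex.I * (F p * K q) * (((p.1 j : ℂ) * cmon (p.1 + q.1 - Finsupp.single j 1) y) *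
          ((q.2 j : ℂ) * cmon (p.2 + q.2 - Finsupp.single j 1) (conjSeq y)) -
        ((q.1 j : ℂ) * cmon (p.1 + q.1 - Finsupp.single j 1) y) *
          ((p.2 j : ℂ) * cmon (p.2 + q.2 - Finsupp.single j 1) (conjSeq y))) := by
        simp only [brCoef, brIdx, mon_eq]
        ring
    _ = _ := by
        rw [e1, e2, e3, e4, e5]
        ring

/-- The absolute convergence of the bracket, with the derivative of `K` along the field of `F`. -/
theorem tsum_enorm_brCoef_le {F K : Ham} (hF : Good F) (hK : Good K) (y : ℕ+ → ℂ) :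
    ∑' t, ‖brCoef F K t * mon (brIdx t) y‖ₑ
      ≤ 2 * ∑' j, fld F (absSeq y) j * fld K (absSeq y) j := by
  let x := absSeq y
  have h1 : ∀ p q j, ‖brCoef F K (p, q, j) * mon (brIdx (p, q, j)) y‖ₑ ≤
      ‖F p‖ₑ * (ed p.1 j x * emon p.2 x) * (‖K q‖ₑ * (emon q.1 x * ed q.2 j x)) +
      ‖F p‖ₑ * (emon p.1 x * ed p.2 j x) * (‖K q‖ₑ * (ed q.1 j x * emon q.2 x)) := by
    intro p q j
    rw [brCoef_mul_mon, enorm_mul]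
    refine (mul_le_mul_right enorm_sub_le _).trans (le_of_eq ?_)
    have hI : ‖Complex.I‖ₑ = 1 := by simp [← ofReal_norm]
    simp only [enorm_mul, hI, one_mul, enorm_cmon, enorm_cd, enorm_dzmon, absSeq_conjSeq, x]
    ring
  calc ∑' t, ‖brCoef F K t * mon (brIdx t) y‖ₑ
      = ∑' (p : MIdx) (q : MIdx) (j : ℕ+), ‖brCoef F K (p, q, j) * mon (brIdx (p, q, j)) y‖ₑ := by
        rw [ENNReal.tsum_prod']
        exact tsum_congr fun p => ENNReal.tsum_prod'
    _ ≤ ∑' (p : MIdx) (q : MIdx) (j : ℕ+),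
        (‖F p‖ₑ * (ed p.1 j x * emon p.2 x) * (‖K q‖ₑ * (emon q.1 x * ed q.2 j x)) +
        ‖F p‖ₑ * (emon p.1 x * ed p.2 j x) * (‖K q‖ₑ * (ed q.1 j x * emon q.2 x))) :=
        ENNReal.tsum_le_tsum fun p => ENNReal.tsum_le_tsum fun q =>
          ENNReal.tsum_le_tsum fun j => h1 p q j
    _ = ∑' j, (fld F x j * fld K x j + fld F x j * fld K x j) := by
        have : ∀ p : MIdx, ∑' (q : MIdx) (j : ℕ+),
            (‖F p‖ₑ * (ed p.1 j x * emon p.2 x) * (‖K q‖ₑ * (emon q.1 x * ed q.2 j x)) +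
            ‖F p‖ₑ * (emon p.1 x * ed p.2 j x) * (‖K q‖ₑ * (ed q.1 j x * emon q.2 x)))
            = ∑' j, (‖F p‖ₑ * (ed p.1 j x * emon p.2 x) * fld K x j +
              ‖F p‖ₑ * (emon p.1 x * ed p.2 j x) * fld K x j) := by
          intro p
          rw [ENNReal.tsum_comm]
          refine tsum_congr fun j => ?_
          rw [ENNReal.tsum_add, ENNReal.tsum_mul_left, ENNReal.tsum_mul_left, hK.tsum_ed_fst]
          rfl
        simp_rw [this]
        rw [ENNReal.tsum_comm]
        refine tsum_congr fun j => ?_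
        rw [ENNReal.tsum_add, ENNReal.tsum_mul_right, ENNReal.tsum_mul_right, hF.tsum_ed_fst]
        rfl
    _ = _ := by
        rw [← ENNReal.tsum_mul_left]
        exact tsum_congr fun j => (two_mul _).symm

/-- The triple sum over `p`, `q`, `j` converges absolutely, so for each monomial `q` of `K` the sum
over `(j, p)` can be taken on its own; it is the derivative of that monomial along the field of `F`.
Only the pairing of the two fields has to be finite, so `K = Λ` is admitted. -/
theorem hasSum_bracket {F K : Ham} (hF : Good F) (hK : Good K) {y : ℕ+ → ℂ}
    (hfin : ∑' j, fld F (absSeq y) j * fld K (absSeq y) j ≠ ⊤)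
    (hFfin : ∀ j, fld F (absSeq y) j ≠ ⊤) :
    HasSum (fun q => K q * monDeriv F q y) ((bracket F K).eval y) ∧
    ∑' q, ‖K q * monDeriv F q y‖ₑ ≤ 2 * ∑' j, fld F (absSeq y) j * fld K (absSeq y) j ∧
    ‖(bracket F K).eval y‖ₑ ≤ 2 * ∑' j, fld F (absSeq y) j * fld K (absSeq y) j := by
  have hle := tsum_enorm_brCoef_le hF hK y
  have hne : ∑' t, ‖brCoef F K t * mon (brIdx t) y‖ₑ ≠ ⊤ :=
    ne_top_of_le_ne_top (ENNReal.mul_ne_top (by simp) hfin) hle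
  have hs : Summable fun t => brCoef F K t * mon (brIdx t) y :=
    Summable.of_norm (summable_of_tsum_enorm_ne_top hne)
  have he : (bracket F K).eval y = ∑' t, brCoef F K t * mon (brIdx t) y :=
    (hasSum_push (fun P => mon P y) hs).tsum_eq
  let e : MIdx × ℕ+ × MIdx ≃ MIdx × MIdx × ℕ+ :=
    { toFun := fun t => (t.2.2, t.1, t.2.1)
      invFun := fun t => (t.2.1, t.2.2, t.1)
      left_inv := fun _ => rfl
      right_inv := fun _ => rfl }
  have hs' : Summable fun c => brCoef F K (e c) * mon (brIdx (e c)) y := e.summable_iff.2 hs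
  have hfib : ∀ q, K q * monDeriv F q y
      = ∑' u : ℕ+ × MIdx, brCoef F K (u.2, q, u.1) * mon (brIdx (u.2, q, u.1)) y := by
    intro q
    have h2 : Summable fun u : ℕ+ × MIdx =>
      brCoef F K (u.2, q, u.1) * mon (brIdx (u.2, q, u.1)) y := hs'.prod_factor q
    rw [h2.tsum_prod, monDeriv_eq_tsum, ← tsum_mul_left]
    refine tsum_congr fun j => ?_
    simp only [brCoef_mul_mon]
    rw [tsum_mul_left]
    congr 1
    have s1 : Summable fun p : MIdx => F p * (cd p.1 j y * cmon p.2 (conjSeq y)) := by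
      refine Summable.of_norm (summable_of_tsum_enorm_ne_top ?_)
      simp only [enorm_mul, enorm_cd, enorm_cmon, absSeq_conjSeq]
      rw [hF.tsum_ed_fst]
      exact hFfin j
    have s2 := summable_dzmon (hFfin j)
    rw [conj_dzbar hF, dzbar_eq, ← tsum_mul_left, ← tsum_mul_left, ← tsum_mul_left,
      ← tsum_mul_left, ← Summable.tsum_sub]
    · exact (s1.mul_left _).mul_left _
    · exact (s2.mul_left _).mul_left _
  refine ⟨?_, ?_, ?_⟩
  · rw [he, ← e.tsum_eq, hs'.tsum_prod]
    have := hs'.prod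
    simp only [hfib]
    exact this.hasSum
  · refine le_trans ?_ hle
    rw [← e.tsum_eq]
    refine le_trans (ENNReal.tsum_le_tsum fun q => ?_) (ENNReal.tsum_prod'
      (f := fun c : MIdx × (ℕ+ × MIdx) => ‖brCoef F K (e c) * mon (brIdx (e c)) y‖ₑ)).symm.le
    rw [hfib]
    exact enorm_tsum_le_tsum_enorm
  · rw [he]
    exact enorm_tsum_le_tsum_enorm.trans hle

/-! ### Integration along orbits -/

/-- `φ` solves Hamilton's equations of `F` on `[0, 1]`, componentwise, and the field is continuous
along `φ`. -/
structure IsOrbit (F : Ham) (φ : ℝ → ℕ+ → ℂ) : Prop where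
  deriv : ∀ j, ∀ t ∈ Set.Icc (0 : ℝ) 1,
    HasDerivWithinAt (fun u => φ u j) (-Complex.I * dzbar F (φ t) j) (Set.Icc 0 1) t
  cont : ∀ j, ContinuousOn (fun t => dzbar F (φ t) j) (Set.Icc 0 1)
  fin : ∀ t ∈ Set.Icc (0 : ℝ) 1, ∀ j, fld F (absSeq (φ t)) j ≠ ⊤

theorem IsOrbit.continuousOn_monDeriv {F : Ham} {φ : ℝ → ℕ+ → ℂ} (h : IsOrbit F φ) (q : MIdx) :
    ContinuousOn (fun t => monDeriv F q (φ t)) (Set.Icc 0 1) := by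
  have h1 : ∀ j, ContinuousOn (fun t => φ t j) (Set.Icc 0 1) :=
    fun j t ht => (h.deriv j t ht).continuousWithinAt
  have h2 : ∀ j, ContinuousOn (fun t => conjSeq (φ t) j) (Set.Icc 0 1) :=
    fun j => Complex.continuous_conj.comp_continuousOn (h1 j)
  have h3 : ∀ j, ContinuousOn (fun t => conj (dzbar F (φ t) j)) (Set.Icc 0 1) :=
    fun j => Complex.continuous_conj.comp_continuousOn (h.cont j)
  refine ContinuousOn.add (ContinuousOn.mul (continuousOn_finsetSum _ fun j _ => ?_)
    (continuousOn_cmon h2 _)) ((continuousOn_cmon h1 _).mul (continuousOn_finsetSum _ fun j _ => ?_))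
  · exact (continuousOn_const.mul (continuousOn_cmon h1 _)).mul (continuousOn_const.mul (h.cont j))
  · exact (continuousOn_const.mul (continuousOn_cmon h2 _)).mul (continuousOn_const.mul (h3 j))

theorem IsOrbit.hasDerivWithinAt_mon {F : Ham} {φ : ℝ → ℕ+ → ℂ} (h : IsOrbit F φ) (q : MIdx)
    {t : ℝ} (ht : t ∈ Set.Icc (0 : ℝ) 1) :
    HasDerivWithinAt (fun u => mon q (φ u)) (monDeriv F q (φ t)) (Set.Icc 0 1) t := by
  have h1 := hasDerivWithinAt_cmon (fun j => h.deriv j t ht) q.1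
  have h2 := hasDerivWithinAt_cmon (φ := fun u => conjSeq (φ u))
    (φ' := fun j => Complex.I * conj (dzbar F (φ t) j)) (s := Set.Icc 0 1) (t := t) (fun j => by
      have := (h.deriv j t ht).star
      simpa [conjSeq] using this) q.2
  exact h1.mul h2

theorem intervalIntegrable_of_continuousOn_Icc {f : ℝ → ℂ} (hf : ContinuousOn f (Set.Icc 0 1))
    {a b : ℝ} (ha : a ∈ Set.Icc (0 : ℝ) 1) (hb : b ∈ Set.Icc (0 : ℝ) 1) :
    IntervalIntegrable f MeasureTheory.volume a b :=
  (hf.mono (Set.uIcc_subset_Icc ha hb)).intervalIntegrable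

theorem IsOrbit.integral_monDeriv {F : Ham} {φ : ℝ → ℕ+ → ℂ} (h : IsOrbit F φ) (q : MIdx)
    {a b : ℝ} (ha : a ∈ Set.Icc (0 : ℝ) 1) (hb : b ∈ Set.Icc (0 : ℝ) 1) :
    ∫ t in a..b, monDeriv F q (φ t) = mon q (φ b) - mon q (φ a) := by
  have hsub := Set.uIcc_subset_Icc ha hb
  refine intervalIntegral.integral_eq_sub_of_hasDeriv_right
    (f := fun t => mon q (φ t)) ?_ (fun t ht => ?_)
    (intervalIntegrable_of_continuousOn_Icc (h.continuousOn_monDeriv q) ha hb)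
  · exact fun t ht => (h.hasDerivWithinAt_mon q (hsub ht)).continuousWithinAt.mono hsub
  · have ht' : t ∈ Set.Ioo (0 : ℝ) 1 :=
      ⟨(le_min ha.1 hb.1).trans_lt ht.1, ht.2.trans_le (max_le ha.2 hb.2)⟩
    exact ((h.hasDerivWithinAt_mon q (Set.Ioo_subset_Icc_self ht')).hasDerivAt
      (Icc_mem_nhds ht'.1 ht'.2)).hasDerivWithinAt

/-- Along an orbit of `F`, the derivative of `K` is `{F, K}`, in integrated form. -/
theorem IsOrbit.integral_bracket {F K : Ham} {φ : ℝ → ℕ+ → ℂ} (h : IsOrbit F φ) (hF : Good F)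
    (hK : Good K) {M : ℝ≥0∞} (hM : M ≠ ⊤)
    (hle : ∀ t ∈ Set.Icc (0 : ℝ) 1,
      ∑' j, fld F (absSeq (φ t)) j * fld K (absSeq (φ t)) j ≤ M)
    (hs : ∀ t ∈ Set.Icc (0 : ℝ) 1, Summable fun p => K p * mon p (φ t))
    {a b : ℝ} (ha : a ∈ Set.Icc (0 : ℝ) 1) (hb : b ∈ Set.Icc (0 : ℝ) 1) :
    K.eval (φ b) - K.eval (φ a) = ∫ t in a..b, (bracket F K).eval (φ t) := by
  have hsub : Set.uIoc a b ⊆ Set.Icc 0 1 :=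
    Set.uIoc_subset_uIcc.trans (Set.uIcc_subset_Icc ha hb)
  have hB : ∀ t ∈ Set.Icc (0 : ℝ) 1, ∑' q, ‖K q * monDeriv F q (φ t)‖ₑ ≤ 2 * M := fun t ht =>
    (hasSum_bracket hF hK (ne_top_of_le_ne_top hM (hle t ht)) (h.fin t ht)).2.1.trans
      (mul_le_mul_right (hle t ht) _)
  have h2M : 2 * M ≠ ⊤ := ENNReal.mul_ne_top (by simp) hM
  have hcont : ∀ q, ContinuousOn (fun t => K q * monDeriv F q (φ t)) (Set.Icc 0 1) :=
    fun q => continuousOn_const.mul (h.continuousOn_monDeriv q)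
  have hmeas : ∀ q, MeasureTheory.AEStronglyMeasurable (fun t => K q * monDeriv F q (φ t))
      (MeasureTheory.volume.restrict (Set.uIoc a b)) := fun q =>
    ((hcont q).mono hsub).aestronglyMeasurable measurableSet_uIoc
  -- The series for `{F, K}` is integrated term by term, each term being the derivative of one
  -- monomial. No differentiation of an infinite series is involved.
  have key := intervalIntegral.hasSum_integral_of_dominated_convergence
    (μ := MeasureTheory.volume) (a := a) (b := b) (F := fun q t => K q * monDeriv F q (φ t))
    (f := fun t => (bracket F K).eval (φ t))
    (fun q t => ‖K q * monDeriv F q (φ t)‖) hmeas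
    (fun q => Filter.Eventually.of_forall fun t _ => le_rfl)
    (Filter.Eventually.of_forall fun t ht =>
      summable_of_tsum_enorm_ne_top (ne_top_of_le_ne_top h2M (hB t (hsub ht)))) ?_
    (Filter.Eventually.of_forall fun t ht =>
      (hasSum_bracket hF hK (ne_top_of_le_ne_top hM (hle t (hsub ht))) (h.fin t (hsub ht))).1)
  · have e : ∀ q, ∫ t in a..b, K q * monDeriv F q (φ t)
        = K q * mon q (φ b) - K q * mon q (φ a) := fun q => by
      rw [intervalIntegral.integral_const_mul, h.integral_monDeriv q ha hb, mul_sub]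
    simp only [e] at key
    exact ((hs b hb).hasSum.sub (hs a ha).hasSum).unique key
  · rw [intervalIntegrable_iff]
    refine MeasureTheory.Integrable.mono' (g := fun _ => (2 * M).toReal)
      (intervalIntegrable_iff.1 intervalIntegrable_const) ?_ ?_
    · have : (fun t => ∑' q, ‖K q * monDeriv F q (φ t)‖)
          = fun t => (∑' q, ‖K q * monDeriv F q (φ t)‖ₑ).toReal := by
        funext t
        rw [ENNReal.tsum_toReal_eq fun q => enorm_ne_top]
        simp
      rw [this]
      exact (AEMeasurable.tsum fun q => (hmeas q).enorm).ennreal_toReal.aestronglyMeasurable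
    · refine (MeasureTheory.ae_restrict_mem measurableSet_uIoc).mono fun t ht => ?_
      have hb1 := hB t (hsub ht)
      rw [Real.norm_of_nonneg (tsum_nonneg fun _ => norm_nonneg _)]
      calc ∑' q, ‖K q * monDeriv F q (φ t)‖
          = (∑' q, ‖K q * monDeriv F q (φ t)‖ₑ).toReal := by
            rw [ENNReal.tsum_toReal_eq fun q => enorm_ne_top]
            simp
        _ ≤ _ := ENNReal.toReal_mono h2M hb1

/-! ### Taylor expansion of a hierarchy of integrals -/

/-- `f (k + 1)` acts as the derivative of `f k`, known only in integrated form. The induction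
applies the estimate to the shifted hierarchy and integrates it once. -/
theorem norm_sub_taylor_le {f : ℕ → ℝ → ℂ} {B : ℕ → ℝ}
    (hint : ∀ k, ∀ a ∈ Set.Icc (0 : ℝ) 1, ∀ b ∈ Set.Icc (0 : ℝ) 1,
      f k b - f k a = ∫ t in a..b, f (k + 1) t)
    (hB : ∀ k, ∀ t ∈ Set.Icc (0 : ℝ) 1, ‖f k t‖ ≤ B k) (n : ℕ) {t : ℝ}
    (ht : t ∈ Set.Icc (0 : ℝ) 1) :
    ‖f 0 t - ∑ k ∈ Finset.range n, ((t ^ k / k.factorial : ℝ) : ℂ) * f k 0‖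
      ≤ B n * (t ^ n / n.factorial) := by
  induction n generalizing f B t with
  | zero => simpa using hB 0 t ht
  | succ n ih =>
    have h0 : (0 : ℝ) ∈ Set.Icc (0 : ℝ) 1 := by simp
    have ih1 := fun s hs => ih (f := fun k => f (k + 1)) (B := fun k => B (k + 1))
      (fun k => hint (k + 1)) (fun k => hB (k + 1)) (t := s) hs
    -- The bound on `f 2` makes `f 1` Lipschitz, hence integrable.
    have hcont : ContinuousOn (f 1) (Set.Icc 0 1) := by
      have hL : LipschitzOnWith (B 2).toNNReal (f 1) (Set.Icc 0 1) := by
        refine LipschitzOnWith.of_dist_le_mul fun x hx y hy => ?_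
        have hB2 : 0 ≤ B 2 := (norm_nonneg _).trans (hB 2 0 h0)
        rw [dist_eq_norm, hint 1 y hy x hx, Real.coe_toNNReal _ hB2, Real.dist_eq]
        exact intervalIntegral.norm_integral_le_of_norm_le_const fun s hs => hB 2 s
          (Set.uIcc_subset_Icc hy hx (Set.uIoc_subset_uIcc hs))
      exact hL.continuousOn
    have hpoly : Continuous fun s : ℝ =>
        ∑ k ∈ Finset.range n, ((s ^ k / k.factorial : ℝ) : ℂ) * f (k + 1) 0 := by
      fun_prop
    have e1 : ∀ k : ℕ, ∫ s in (0 : ℝ)..t, s ^ k / (k.factorial : ℝ)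
        = t ^ (k + 1) / (k + 1).factorial := by
      intro k
      rw [intervalIntegral.integral_div, integral_pow, Nat.factorial_succ]
      push_cast
      field_simp
      ring
    have e2 : f 0 t - ∑ k ∈ Finset.range (n + 1), ((t ^ k / k.factorial : ℝ) : ℂ) * f k 0
        = ∫ s in (0 : ℝ)..t, (f 1 s -
          ∑ k ∈ Finset.range n, ((s ^ k / k.factorial : ℝ) : ℂ) * f (k + 1) 0) := by
      rw [intervalIntegral.integral_sub (intervalIntegrable_of_continuousOn_Icc hcont h0 ht)
        (hpoly.intervalIntegrable _ _), ← hint 0 0 h0 t ht,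
        intervalIntegral.integral_finsetSum]
      · rw [Finset.sum_range_succ']
        simp only [intervalIntegral.integral_mul_const, intervalIntegral.integral_ofReal, e1]
        simp
        ring
      · intro k _
        exact Continuous.intervalIntegrable (by fun_prop) _ _
    rw [e2]
    have hle := intervalIntegral.norm_integral_le_of_norm_le (μ := MeasureTheory.volume) ht.1
      (f := fun s => f 1 s - ∑ k ∈ Finset.range n, ((s ^ k / k.factorial : ℝ) : ℂ) * f (k + 1) 0)
      (g := fun s => B (n + 1) * (s ^ n / n.factorial))
      (Filter.Eventually.of_forall fun s hs => ih1 s ⟨hs.1.le, hs.2.trans ht.2⟩)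
      (Continuous.intervalIntegrable (by fun_prop) _ _)
    refine hle.trans (le_of_eq ?_)
    rw [intervalIntegral.integral_const_mul, e1]

/-- The Taylor series of a hierarchy of integrals converges if the bounds are summable. -/
theorem hasSum_taylor {f : ℕ → ℝ → ℂ} {B : ℕ → ℝ}
    (hint : ∀ k, ∀ a ∈ Set.Icc (0 : ℝ) 1, ∀ b ∈ Set.Icc (0 : ℝ) 1,
      f k b - f k a = ∫ t in a..b, f (k + 1) t)
    (hB : ∀ k, ∀ t ∈ Set.Icc (0 : ℝ) 1, ‖f k t‖ ≤ B k)
    (hsum : Summable fun k => B k / k.factorial) :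
    HasSum (fun k => f k 0 / (k.factorial : ℂ)) (f 0 1) := by
  have h1 : (1 : ℝ) ∈ Set.Icc (0 : ℝ) 1 := by simp
  have h0 : (0 : ℝ) ∈ Set.Icc (0 : ℝ) 1 := by simp
  have hs : Summable fun k => f k 0 / (k.factorial : ℂ) := by
    refine Summable.of_norm_bounded hsum fun k => ?_
    rw [norm_div, Complex.norm_natCast]
    gcongr
    exact hB k 0 h0
  refine hs.hasSum_iff_tendsto_nat.2 ?_
  rw [tendsto_iff_norm_sub_tendsto_zero]
  refine squeeze_zero (fun _ => norm_nonneg _) (fun n => ?_) hsum.tendsto_atTop_zero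
  have := norm_sub_taylor_le hint hB n h1
  rw [norm_sub_rev]
  simp only [one_pow] at this
  rw [mul_one_div] at this
  have e : ∑ k ∈ Finset.range n, f k 0 / (k.factorial : ℂ)
      = ∑ k ∈ Finset.range n, ((1 / k.factorial : ℝ) : ℂ) * f k 0 :=
    Finset.sum_congr rfl fun k _ => by push_cast; ring
  rwa [e]

/-! ### Componentwise bounds for fields with even index structure -/

theorem wn_single (w : Weight) (j : ℕ+) (s : ℝ≥0∞) :
    wn w (fun i => if i = j then s else 0) = ENNReal.ofReal (w.val j) * s := by
  refine (ENNReal.pow_right_strictMono two_ne_zero).injective ?_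
  rw [wn_sq, tsum_eq_single j (fun i hi => by simp [hi]), if_pos rfl, mul_pow]

/-- The `j`-th component of the majorant field is at most a multiple of `x_j`. -/
theorem Good.mul_fld_le (w : Weight) {F : Ham} (hF : Good F) {R ρ : ℝ≥0∞} {x : ℕ+ → ℝ≥0∞}
    (hx : wn w x ≤ R) (j : ℕ+) : ρ * fld F x j ≤ fldSup w (R + ρ) F * x j := by
  have hw0 := ofReal_weight_ne_zero w j
  have hwt : ENNReal.ofReal (w.val j) ≠ ⊤ := ENNReal.ofReal_ne_top
  -- Raising the `j`-th coordinate by `s` increases the weighted norm by at most `ρ`.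
  set s := ρ / ENNReal.ofReal (w.val j) with hs
  have hws : ENNReal.ofReal (w.val j) * s = ρ := ENNReal.mul_div_cancel hw0 hwt
  let x' : ℕ+ → ℝ≥0∞ := fun i => x i + if i = j then s else 0
  have hxx' : ∀ i, x i ≤ x' i := fun i => le_self_add
  have hsx' : s ≤ x' j := by simp [x']
  have hx' : wn w x' ≤ R + ρ := by
    refine (wn_add_le w _ _).trans (add_le_add hx ?_)
    rw [wn_single, hws]
  -- If `β_j ≥ 1` and `α_j + β_j` is even, a factor `x_j` survives the derivative `∂_{z̄_j}`. It is
  -- taken out on the left, and `s ≤ x'_j` takes its place in the remaining monomial.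
  have key : s * fld F x j ≤ x j * fld F x' j := by
    rw [fld, fld, ← ENNReal.tsum_mul_left, ← ENNReal.tsum_mul_left]
    refine ENNReal.tsum_le_tsum fun p => ?_
    by_cases hp : F p = 0
    · simp [hp]
    by_cases hb : p.2 j = 0
    · simp [ed, hb]
    obtain ⟨k, hk⟩ := hF.even p hp j
    have hle : Finsupp.single j 1 ≤ p.1 + (p.2 - Finsupp.single j 1) := by
      rw [Finsupp.single_le_iff]
      simp only [Finsupp.add_apply, Finsupp.tsub_apply, Finsupp.single_eq_same]
      omega
    have hm : ∀ y : ℕ+ → ℝ≥0∞, emon p.1 y * ed p.2 j y = y j *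
        ((p.2 j : ℝ≥0∞) * emon (p.1 + (p.2 - Finsupp.single j 1) - Finsupp.single j 1) y) := by
      intro y
      have : emon p.1 y * emon (p.2 - Finsupp.single j 1) y =
          emon (p.1 + (p.2 - Finsupp.single j 1) - Finsupp.single j 1) y * y j := by
        rw [← emon_add]
        conv_lhs => rw [← tsub_add_cancel_of_le hle]
        rw [emon_add, emon_single]
      rw [ed, mul_left_comm, this]
      ring
    rw [hm, hm]
    calc _ = ‖F p‖ₑ * x j * (s * ((p.2 j : ℝ≥0∞) *
          emon (p.1 + (p.2 - Finsupp.single j 1) - Finsupp.single j 1) x)) := by ring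
      _ ≤ ‖F p‖ₑ * x j * (x' j * ((p.2 j : ℝ≥0∞) *
          emon (p.1 + (p.2 - Finsupp.single j 1) - Finsupp.single j 1) x')) := by
        refine mul_le_mul_right (mul_le_mul' hsx' (mul_le_mul_right (emon_mono _ hxx') _)) _
      _ = _ := by ring
  calc ρ * fld F x j = ENNReal.ofReal (w.val j) * (s * fld F x j) := by rw [← mul_assoc, hws]
    _ ≤ ENNReal.ofReal (w.val j) * (x j * fld F x' j) := mul_le_mul_right key _
    _ = (ENNReal.ofReal (w.val j) * fld F x' j) * x j := by ring
    _ ≤ _ := mul_le_mul_left ((le_wn w _ j).trans (wn_fld_le w F hx')) _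

/-- Gronwall's inequality in each coordinate separately. This controls the energy although the
weights `w` are unrelated to the frequencies. -/
theorem IsOrbit.norm_le {F : Ham} {φ : ℝ → ℕ+ → ℂ} (h : IsOrbit F φ) {C : ℝ} (hC0 : 0 ≤ C)
    (hC : ∀ t ∈ Set.Icc (0 : ℝ) 1, ∀ j, ‖dzbar F (φ t) j‖ ≤ C * ‖φ t j‖) (j : ℕ+) {t : ℝ}
    (ht : t ∈ Set.Icc (0 : ℝ) 1) : ‖φ t j‖ ≤ Real.exp C * ‖φ 0 j‖ := by
  have := norm_le_gronwallBound_of_norm_deriv_right_le (f := fun s => φ s j)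
    (f' := fun s => -Complex.I * dzbar F (φ s) j) (δ := ‖φ 0 j‖) (K := C) (ε := 0) (a := 0) (b := 1)
    (fun s hs => (h.deriv j s hs).continuousWithinAt)
    (fun s hs => (h.deriv j s ⟨hs.1, hs.2.le⟩).mono_of_mem_nhdsWithin
      (Icc_mem_nhdsGE_of_mem hs)) le_rfl
    (fun s hs => by simpa using hC s ⟨hs.1, hs.2.le⟩ j) t ht
  rw [gronwallBound_ε0] at this
  refine this.trans ?_
  rw [mul_comm]
  gcongr
  nlinarith [ht.2]

/-! ### The quadratic Hamiltonian as a power series -/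

/-- `Λ` as a power series. -/
def lamHam (m : ℝ) : Ham := push (fun j : ℕ+ => (omega m j : ℂ)) diagIdx

theorem diagIdx_injective : Function.Injective diagIdx := by
  intro i j h
  exact (Finsupp.single_left_inj one_ne_zero).1 (congrArg Prod.fst h)

theorem lamHam_diagIdx (m : ℝ) (j : ℕ+) : lamHam m (diagIdx j) = omega m j := by
  rw [lamHam, push, tsum_eq_single j, if_pos rfl]
  intro i hi
  rw [if_neg fun h => hi (diagIdx_injective h)]

theorem good_lamHam (m : ℝ) : Good (lamHam m) where
  real α β := by
    rw [lamHam, push, push, Complex.conj_tsum]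
    refine tsum_congr fun j => ?_
    have : diagIdx j = (α, β) ↔ diagIdx j = (β, α) := by
      simp only [diagIdx, Prod.mk.injEq]
      exact and_comm
    simp only [this]
    split_ifs <;> simp
  even p hp i := by
    obtain ⟨j, rfl, -⟩ := exists_of_push_ne_zero hp
    exact ⟨Finsupp.single j 1 i, rfl⟩
  zero := by
    by_contra h
    obtain ⟨j, hj, -⟩ := exists_of_push_ne_zero h
    have := deg_diagIdx j
    rw [hj] at this
    simp [deg_eq] at this

theorem omega_nonneg (m : ℝ) (j : ℕ+) : 0 ≤ omega m j := Real.sqrt_nonneg _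

theorem enorm_ofReal' {a : ℝ} (ha : 0 ≤ a) : ‖(a : ℂ)‖ₑ = ENNReal.ofReal a := by
  rw [← ofReal_norm, Complex.norm_real, Real.norm_of_nonneg ha]

theorem fld_lamHam_le (m : ℝ) (x : ℕ+ → ℝ≥0∞) (i : ℕ+) :
    fld (lamHam m) x i ≤ ENNReal.ofReal (omega m i) * x i := by
  refine (fld_push_le _ _ x i).trans (le_of_eq ?_)
  rw [tsum_eq_single i]
  · rw [enorm_ofReal' (omega_nonneg m i)]
    simp [diagIdx, ed_single]
  · intro j hj
    simp [diagIdx, ed_single, hj]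

theorem mon_diagIdx (j : ℕ+) (z : ℕ+ → ℂ) : mon (diagIdx j) z = ((‖z j‖ ^ 2 : ℝ) : ℂ) := by
  rw [mon_eq, diagIdx, cmon_single, cmon_single, conjSeq, Complex.mul_conj,
    Complex.normSq_eq_norm_sq]

theorem hasSum_lamHam {m : ℝ} {z : ℕ+ → ℂ} (hz : FiniteEnergy m z) :
    HasSum (fun p => lamHam m p * mon p z) (Lam m z : ℂ) := by
  have e : ∀ j, (omega m j : ℂ) * mon (diagIdx j) z = ((omega m j * ‖z j‖ ^ 2 : ℝ) : ℂ) := by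
    intro j
    rw [mon_diagIdx]
    push_cast
    ring
  have hs : Summable fun j => (omega m j : ℂ) * mon (diagIdx j) z := by
    simp_rw [e]
    exact_mod_cast hz
  have := hasSum_push (c := fun j : ℕ+ => (omega m j : ℂ)) (fun P => mon P z) hs
  have e2 : ∑' j, (omega m j : ℂ) * mon (diagIdx j) z = (Lam m z : ℂ) := by
    rw [Lam, Complex.ofReal_tsum]
    exact tsum_congr e
  rwa [e2] at this

/-- `{F, Λ} = i (∑_j ω_j (α_j - β_j)) F_{α,β}` at the level of coefficients. -/
theorem bracket_lamHam (m : ℝ) (F : Ham) (P : MIdx) :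
    bracket F (lamHam m) P = Complex.I * divisor m P * F P := by
  classical
  have hinj : Function.Injective fun j : ℕ+ => (P, diagIdx j, j) := by
    intro i j h
    simpa using congrArg (fun t => t.2.2) h
  -- Only the triples `(P, z_j z̄_j, j)` contribute to the coefficient of `P`.
  have hsupp : Function.support (fun t => if brIdx t = P then brCoef F (lamHam m) t else 0)
      ⊆ Set.range fun j : ℕ+ => (P, diagIdx j, j) := by
    intro t ht
    rw [Function.mem_support] at ht
    have h1 : brIdx t = P := by
      by_contra h
      exact ht (if_neg h)
    rw [if_pos h1] at ht
    obtain ⟨k, hk, -⟩ := exists_of_push_ne_zero (brCoef_ne_zero ht).2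
    have h2 := brIdx_add_diagIdx ht
    obtain ⟨p, q, j⟩ := t
    simp only at hk h2
    subst hk
    have hkj : k = j := by
      by_contra hne
      refine ht ?_
      simp [brCoef, diagIdx, hne]
    subst hkj
    refine ⟨k, ?_⟩
    have := add_right_cancel h2
    rw [h1] at this
    rw [this]
  rw [bracket, push]
  refine (hinj.tsum_eq hsupp).symm.trans ?_
  have e : ∀ j, (if brIdx (P, diagIdx j, j) = P then brCoef F (lamHam m) (P, diagIdx j, j) else 0)
      = Complex.I * F P * (((P.1 j : ℝ) * omega m j - (P.2 j : ℝ) * omega m j : ℝ) : ℂ) := by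
    intro j
    have h1 : brIdx (P, diagIdx j, j) = P := by
      simp [brIdx, diagIdx]
    rw [if_pos h1, brCoef]
    simp only [lamHam_diagIdx]
    simp [diagIdx]
    ring
  have hd : ∀ n : ℕ+ →₀ ℕ, HasSum (fun j => (n j : ℝ) * omega m j)
      (n.sum fun j k => (k : ℝ) * omega m j) := by
    intro n
    refine hasSum_sum_of_ne_finset_zero fun j hj => ?_
    simp [Finsupp.notMem_support_iff.1 hj]
  simp only [e]
  rw [tsum_mul_left, ← Complex.ofReal_tsum, ((hd P.1).sub (hd P.2)).tsum_eq, divisor]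
  ring

/-! ### Orbits of the flow -/

/-- The coordinate functionals of `h_w`. -/
def coord (w : Weight) (j : ℕ+) : HSpace w →L[ℝ] ℂ :=
  LinearMap.mkContinuous
    { toFun := fun z => z j
      map_add' := fun _ _ => rfl
      map_smul' := fun _ _ => rfl } (w.val j)⁻¹ fun z => by
    have h := le_wn w (absSeq z) j
    rw [wn_absSeq, ← ofReal_norm z, absSeq, ← ofReal_norm, ← ENNReal.ofReal_mul (w.pos j).le,
      ENNReal.ofReal_le_ofReal_iff (norm_nonneg _)] at h
    rw [← div_eq_inv_mul, le_div_iff₀ (w.pos j), mul_comm]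
    exact h

theorem isOrbit_of_hasDerivWithinAt {w : Weight} {F : Ham} {r ρ d : ℝ} (hr : 0 ≤ r) (hd : 0 ≤ d)
    (hdρ : d < ρ) (hF : fldSup w (ENNReal.ofReal (r + ρ)) F ≤ ENNReal.ofReal d)
    {α : ℝ → HSpace w}
    (hα : ∀ t ∈ Set.Icc (-1 : ℝ) 1, HasDerivWithinAt α (vf w F (α t)) (Set.Icc (-1 : ℝ) 1) t)
    (hmem : ∀ t, α t ∈ ball w (r + d)) : IsOrbit F fun t => α t := by
  obtain ⟨K, hK⟩ := lipschitzOnWith_vf hr hdρ hd hF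
  have hsub : Set.Icc (0 : ℝ) 1 ⊆ Set.Icc (-1) 1 := Set.Icc_subset_Icc (by norm_num) le_rfl
  have hw : ∀ t, wn w (fld F (absSeq (α t))) < ⊤ := fun t => by
    refine (wn_fld_le w F ((wn_absSeq w _).le.trans ?_)).trans_lt
      (hF.trans_lt ENNReal.ofReal_lt_top)
    refine (mem_ball_iff_enorm (by linarith)).1 ?_
    exact Metric.closedBall_subset_closedBall (by linarith) (hmem t)
  have hcont : ContinuousOn α (Set.Icc 0 1) :=
    fun t ht => (hα t (hsub ht)).continuousWithinAt.mono hsub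
  refine ⟨fun j t ht => ?_, fun j => ?_, fun t _ j => (lt_top_of_wn_lt_top w (hw t) j).ne⟩
  · rw [← vf_apply (hw t) j]
    exact (coord w j).hasFDerivAt.comp_hasDerivWithinAt t ((hα t (hsub ht)).mono hsub)
  · have h1 : ContinuousOn (fun t => vf w F (α t)) (Set.Icc 0 1) :=
      hK.continuousOn.comp hcont fun t _ => hmem t
    have h2 : ContinuousOn (fun t => Complex.I * coord w j (vf w F (α t))) (Set.Icc 0 1) :=
      continuousOn_const.mul ((coord w j).continuous.comp_continuousOn h1)
    refine h2.congr fun t _ => ?_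
    change dzbar F (α t) j = Complex.I * vf w F (α t) j
    rw [vf_apply (hw t) j, ← mul_assoc, mul_neg, Complex.I_mul_I]
    simp

/-! ### Lie series -/

theorem fldSup_add_le (w : Weight) {R : ℝ≥0∞} {f g h : Ham} (a b : ℝ≥0∞)
    (hle : ∀ p, ‖f p‖ₑ ≤ a * ‖g p‖ₑ + b * ‖h p‖ₑ) :
    fldSup w R f ≤ a * fldSup w R g + b * fldSup w R h := by
  refine iSup₂_le fun x hx => ?_
  have h1 : ∀ j, fld f x j ≤ a * fld g x j + b * fld h x j := fun j => by
    simp only [fld]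
    rw [← ENNReal.tsum_mul_left, ← ENNReal.tsum_mul_left, ← ENNReal.tsum_add]
    refine ENNReal.tsum_le_tsum fun p => (mul_le_mul_left (hle p) _).trans (le_of_eq ?_)
    ring
  refine (wn_mono w h1).trans ((wn_add_le w _ _).trans ?_)
  rw [wn_smul, wn_smul]
  exact add_le_add (mul_le_mul_right (wn_fld_le w g hx) _) (mul_le_mul_right (wn_fld_le w h hx) _)

/-- The ratio `(2/ρ) |X_F|` of the geometric series dominating the Lie series, up to a factor `e`. -/
def lieRatio (w : Weight) (R ρ : ℝ≥0∞) (F : Ham) : ℝ≥0∞ := 2 / ρ * fldSup w (R + ρ) F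

theorem factorial_inv_mul_fldSup_adPow_le (w : Weight) {R ρ : ℝ≥0∞} {F K : Ham} (hF : Good F)
    (hK : Good K) (hρ : ρ ≠ 0) (hρ' : ρ ≠ ⊤) (hFfin : fldSup w (R + ρ) F ≠ ⊤)
    (hKfin : fldSup w (R + ρ) K ≠ ⊤) (k : ℕ) :
    ((k + 1).factorial : ℝ≥0∞)⁻¹ * fldSup w R (adPow F K (k + 1)) ≤
      lieRatio w R ρ F * (ENNReal.ofReal (Real.exp 1) * lieRatio w R ρ F) ^ k *
        fldSup w (R + ρ) K := by
  have h := fldSup_adPow_le w hF hK hρ hρ' hFfin hKfin k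
  have h0 : ((k + 1).factorial : ℝ≥0∞) ≠ 0 := by exact_mod_cast Nat.factorial_ne_zero _
  refine (mul_le_mul_right h _).trans (le_of_eq ?_)
  rw [mul_assoc, ← mul_assoc, ENNReal.inv_mul_cancel h0 (ENNReal.natCast_ne_top _), one_mul]
  rfl

/-- The terms `ad_F^{k+1} K / (k+1)! + ad_F^{k+1} N / (k+2)!` of the remainder. -/
def lieTerm (F K N : Ham) (k : ℕ) : Ham := fun P =>
  adPow F K (k + 1) P / ((k + 1).factorial : ℂ) + adPow F N (k + 1) P / ((k + 2).factorial : ℂ)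

/-- The remainder of the transformed Hamiltonian. -/
def lieRem (F K N : Ham) : Ham := fun P => ∑' k, lieTerm F K N k P

theorem enorm_div_natCast (a : ℂ) {n : ℕ} (hn : n ≠ 0) : ‖a / (n : ℂ)‖ₑ = (n : ℝ≥0∞)⁻¹ * ‖a‖ₑ := by
  rw [div_eq_mul_inv, enorm_mul, enorm_inv (by exact_mod_cast hn), enorm_natCast', mul_comm]

/-- `1/(k+2)! ≤ (1/2) · 1/(k+1)!`. The gained half is the source of the factors `3/2` in the
remainder bounds. -/
theorem enorm_lieTerm_le (F K N : Ham) (k : ℕ) (P : MIdx) : ‖lieTerm F K N k P‖ₑ ≤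
    ((k + 1).factorial : ℝ≥0∞)⁻¹ * ‖adPow F K (k + 1) P‖ₑ +
      (2⁻¹ * ((k + 1).factorial : ℝ≥0∞)⁻¹) * ‖adPow F N (k + 1) P‖ₑ := by
  refine (enorm_add_le _ _).trans ?_
  rw [enorm_div_natCast _ (Nat.factorial_ne_zero _), enorm_div_natCast _ (Nat.factorial_ne_zero _)]
  refine add_le_add le_rfl (mul_le_mul_left ?_ _)
  rw [← ENNReal.mul_inv (by simp) (by simp)]
  refine ENNReal.inv_le_inv.2 ?_
  rw [Nat.factorial_succ (k + 1)]
  push_cast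
  gcongr
  norm_cast
  omega

theorem fldSup_lieTerm_le (w : Weight) {R ρ : ℝ≥0∞} {F K N : Ham} (hF : Good F)
    (hK : Good K) (hN : Good N) (hρ : ρ ≠ 0) (hρ' : ρ ≠ ⊤) (hFfin : fldSup w (R + ρ) F ≠ ⊤)
    (hKfin : fldSup w (R + ρ) K ≠ ⊤) (hNfin : fldSup w (R + ρ) N ≠ ⊤) (k : ℕ) :
    fldSup w R (lieTerm F K N k) ≤
      lieRatio w R ρ F * (ENNReal.ofReal (Real.exp 1) * lieRatio w R ρ F) ^ k *
        (fldSup w (R + ρ) K + 2⁻¹ * fldSup w (R + ρ) N) := by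
  refine (fldSup_add_le w _ _ (enorm_lieTerm_le F K N k)).trans ?_
  rw [mul_assoc 2⁻¹]
  refine (add_le_add (factorial_inv_mul_fldSup_adPow_le w hF hK hρ hρ' hFfin hKfin k)
    (mul_le_mul_right (factorial_inv_mul_fldSup_adPow_le w hF hN hρ hρ' hFfin hNfin k) _)).trans
    (le_of_eq ?_)
  ring

theorem Good.lieTerm {F K N : Ham} (hF : Good F) (hK : Good K) (hN : Good N) (k : ℕ) :
    Good (lieTerm F K N k) where
  real α β := by
    simp only [Beam.lieTerm, map_add, map_div₀, map_natCast]
    rw [← (hF.adPow hK (k + 1)).real, ← (hF.adPow hN (k + 1)).real]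
  even p hp := by
    by_cases h : Beam.adPow F K (k + 1) p = 0
    · refine (hF.adPow hN (k + 1)).even p fun h' => hp ?_
      simp [Beam.lieTerm, h, h']
    · exact (hF.adPow hK (k + 1)).even p h
  zero := by simp [Beam.lieTerm, (hF.adPow hK (k + 1)).zero, (hF.adPow hN (k + 1)).zero]

theorem Good.tsum {g : ℕ → Ham} (hg : ∀ k, Good (g k)) : Good fun P => ∑' k, g k P where
  real α β := by
    rw [Complex.conj_tsum]
    exact tsum_congr fun k => (hg k).real α β
  even p hp := by
    have : ∃ k, g k p ≠ 0 := by
      by_contra! h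
      exact hp (by simp [h])
    obtain ⟨k, hk⟩ := this
    exact (hg k).even p hk
  zero := by simp [(hg _).zero]

theorem Good.lieRem {F K N : Ham} (hF : Good F) (hK : Good K) (hN : Good N) :
    Good (lieRem F K N) :=
  Good.tsum fun k => hF.lieTerm hK hN k

/-- Evaluation of a series of Hamiltonians. -/
theorem hasSum_eval_tsum {w : Weight} {g : ℕ → Ham} (hg : ∀ k, Good (g k)) {R : ℝ≥0∞} (hR : R ≠ ⊤)
    (hfin : ∑' k, fldSup w R (g k) ≠ ⊤) {z : HSpace w} (hz : ‖z‖ₑ ≤ R) :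
    HasSum (fun k => (g k).eval z) (Ham.eval (fun P => ∑' k, g k P) z) := by
  obtain ⟨c, hc, hsum⟩ := Good.exists_tsum_enorm_le w
  have h1 : ∑' t : ℕ × MIdx, ‖g t.1 t.2 * mon t.2 z‖ₑ ≠ ⊤ := by
    rw [ENNReal.tsum_prod' (f := fun t : ℕ × MIdx => ‖g t.1 t.2 * mon t.2 z‖ₑ)]
    refine ne_top_of_le_ne_top ?_ (ENNReal.tsum_le_tsum fun k => hsum (hg k) hz)
    rw [ENNReal.tsum_mul_left, ENNReal.tsum_mul_left]
    exact ENNReal.mul_ne_top hc.ne (ENNReal.mul_ne_top hR hfin)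
  have hs : Summable fun t : ℕ × MIdx => g t.1 t.2 * mon t.2 z :=
    Summable.of_norm (summable_of_tsum_enorm_ne_top h1)
  have e : Ham.eval (fun P => ∑' k, g k P) z = ∑' k, (g k).eval z := by
    simp only [Ham.eval]
    rw [← hs.tsum_comm (f := fun k P => g k P * mon P z)]
    exact tsum_congr fun P => tsum_mul_right.symm
  rw [e]
  exact hs.prod.hasSum

theorem Good.summable_mon {w : Weight} {f : Ham} (hf : Good f) {R : ℝ≥0∞} (hR : R ≠ ⊤)
    (hfin : fldSup w R f ≠ ⊤) {z : HSpace w} (hz : ‖z‖ₑ ≤ R) :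
    Summable fun p => f p * mon p z := by
  obtain ⟨c, hc, hsum⟩ := Good.exists_tsum_enorm_le w
  exact Summable.of_norm (summable_of_tsum_enorm_ne_top (ne_top_of_le_ne_top
    (ENNReal.mul_ne_top hc.ne (ENNReal.mul_ne_top hR hfin)) (hsum hf hz)))

theorem fldSup_adPow_ne_top (w : Weight) {R ρ : ℝ≥0∞} {F K : Ham} (hF : Good F) (hK : Good K)
    (hρ : ρ ≠ 0) (hρ' : ρ ≠ ⊤) (hFfin : fldSup w (R + ρ) F ≠ ⊤) (hKfin : fldSup w (R + ρ) K ≠ ⊤)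
    (k : ℕ) : fldSup w R (adPow F K k) ≠ ⊤ := by
  cases k with
  | zero => exact ne_top_of_le_ne_top hKfin (fldSup_mono w le_self_add K)
  | succ k =>
    refine ne_top_of_le_ne_top ?_ (fldSup_adPow_le w hF hK hρ hρ' hFfin hKfin k)
    have h2 : 2 / ρ * fldSup w (R + ρ) F ≠ ⊤ :=
      ENNReal.mul_ne_top (ENNReal.div_ne_top (by simp) hρ) hFfin
    exact ENNReal.mul_ne_top (ENNReal.mul_ne_top (ENNReal.natCast_ne_top _) (ENNReal.mul_ne_top h2
      (ENNReal.pow_ne_top (ENNReal.mul_ne_top ENNReal.ofReal_ne_top h2)))) hKfin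

theorem tsum_fldSup_adPow_ne_top (w : Weight) {R ρ : ℝ≥0∞} {F K : Ham} (hF : Good F) (hK : Good K)
    (hρ : ρ ≠ 0) (hρ' : ρ ≠ ⊤) (hFfin : fldSup w (R + ρ) F ≠ ⊤) (hKfin : fldSup w (R + ρ) K ≠ ⊤)
    (hq : ENNReal.ofReal (Real.exp 1) * lieRatio w R ρ F < 1) :
    ∑' k : ℕ, (k.factorial : ℝ≥0∞)⁻¹ * fldSup w R (adPow F K k) ≠ ⊤ := by
  rw [tsum_eq_zero_add' ENNReal.summable]
  refine ENNReal.add_ne_top.2 ⟨?_, ne_top_of_le_ne_top ?_ (ENNReal.tsum_le_tsum fun k =>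
    factorial_inv_mul_fldSup_adPow_le w hF hK hρ hρ' hFfin hKfin k)⟩
  · simpa using fldSup_adPow_ne_top w hF hK hρ hρ' hFfin hKfin 0
  · simp_rw [mul_assoc]
    rw [ENNReal.tsum_mul_left, ENNReal.tsum_mul_right, ENNReal.tsum_geometric]
    refine ENNReal.mul_ne_top (ENNReal.mul_ne_top (ENNReal.div_ne_top (by simp) hρ) hFfin)
      (ENNReal.mul_ne_top ?_ hKfin)
    rw [ENNReal.inv_ne_top]
    exact (tsub_pos_of_lt hq).ne'

/-- The Taylor series of `K` along the flow of `F`. -/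
theorem hasSum_adPow_eval {w : Weight} {F K : Ham} (hF : Good F) (hK : Good K) {R ρ : ℝ≥0∞}
    (hR : R ≠ ⊤) (hρ : ρ ≠ 0) (hρ' : ρ ≠ ⊤) (hFfin : fldSup w (R + ρ) F ≠ ⊤)
    (hKfin : fldSup w (R + ρ) K ≠ ⊤) (hq : ENNReal.ofReal (Real.exp 1) * lieRatio w R ρ F < 1)
    {α : ℝ → HSpace w} (hα : IsOrbit F fun t => α t) (hmem : ∀ t, ‖α t‖ₑ ≤ R)
    (g : ℕ → ℝ → ℂ) (C : ℝ) (n : ℕ) (hn : n ≤ 1)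
    (hg : ∀ k t, g (k + n) t = (adPow F K k).eval (α t))
    (hg0 : n = 1 → ∀ a ∈ Set.Icc (0 : ℝ) 1, ∀ b ∈ Set.Icc (0 : ℝ) 1,
      g 0 b - g 0 a = ∫ t in a..b, g 1 t)
    (hgC : n = 1 → ∀ t ∈ Set.Icc (0 : ℝ) 1, ‖g 0 t‖ ≤ C) :
    HasSum (fun k => g k 0 / (k.factorial : ℂ)) (g 0 1) := by
  obtain ⟨c, hc, hsum⟩ := Good.exists_tsum_enorm_le w
  obtain ⟨c', hc', hcs⟩ := exists_tsum_mul_le_wn w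
  have hadfin : ∀ k, fldSup w R (adPow F K k) ≠ ⊤ :=
    fldSup_adPow_ne_top w hF hK hρ hρ' hFfin hKfin
  have hFR : fldSup w R F ≠ ⊤ := ne_top_of_le_ne_top hFfin (fldSup_mono w le_self_add F)
  have hint : ∀ k, ∀ a ∈ Set.Icc (0 : ℝ) 1, ∀ b ∈ Set.Icc (0 : ℝ) 1,
      (adPow F K k).eval (α b) - (adPow F K k).eval (α a)
        = ∫ t in a..b, (adPow F K (k + 1)).eval (α t) := by
    intro k a ha b hb
    rw [adPow_succ]
    refine hα.integral_bracket hF (hF.adPow hK k)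
      (M := c' * (fldSup w R F * fldSup w R (adPow F K k)))
      (ENNReal.mul_ne_top hc'.ne (ENNReal.mul_ne_top hFR (hadfin k))) (fun t _ => ?_)
      (fun t _ => (hF.adPow hK k).summable_mon hR (hadfin k) (hmem t)) ha hb
    have ht := (wn_absSeq w (α t)).le.trans (hmem t)
    exact (hcs _ _).trans (mul_le_mul_right (mul_le_mul' (wn_fld_le w F ht) (wn_fld_le w _ ht)) _)
  let B : ℕ → ℝ := fun k => (c * (R * fldSup w R (adPow F K k))).toReal
  have hBne : ∀ k, c * (R * fldSup w R (adPow F K k)) ≠ ⊤ := fun k =>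
    ENNReal.mul_ne_top hc.ne (ENNReal.mul_ne_top hR (hadfin k))
  have hB : ∀ k t, ‖(adPow F K k).eval (α t)‖ ≤ B k := by
    intro k t
    have h1 : ‖(adPow F K k).eval (α t)‖ₑ ≤ c * (R * fldSup w R (adPow F K k)) :=
      enorm_tsum_le_tsum_enorm.trans (hsum (hF.adPow hK k) (hmem t))
    have h2 := ENNReal.toReal_mono (hBne k) h1
    rwa [toReal_enorm] at h2
  have hBsum : Summable fun k => B k / k.factorial := by
    have h1 : ∑' k : ℕ, (k.factorial : ℝ≥0∞)⁻¹ * (c * (R * fldSup w R (adPow F K k))) ≠ ⊤ := by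
      have : ∀ k : ℕ, (k.factorial : ℝ≥0∞)⁻¹ * (c * (R * fldSup w R (adPow F K k)))
          = c * (R * ((k.factorial : ℝ≥0∞)⁻¹ * fldSup w R (adPow F K k))) := fun k => by ring
      simp_rw [this]
      rw [ENNReal.tsum_mul_left, ENNReal.tsum_mul_left]
      exact ENNReal.mul_ne_top hc.ne (ENNReal.mul_ne_top hR
        (tsum_fldSup_adPow_ne_top w hF hK hρ hρ' hFfin hKfin hq))
    refine (ENNReal.summable_toReal h1).congr fun k => ?_
    rw [ENNReal.toReal_mul, ENNReal.toReal_inv, ENNReal.toReal_natCast, inv_mul_eq_div]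
  -- For `n = 1` an extra function `g 0` heads the hierarchy of brackets. This serves `Λ`, whose
  -- derivative along the orbit has a bounded field while `Λ` itself does not.
  obtain rfl | rfl : n = 0 ∨ n = 1 := by omega
  · refine hasSum_taylor (B := B) (fun k a ha b hb => ?_) (fun k t _ => ?_) hBsum
    · have h1 := hg (k + 1)
      have h2 := hg k
      simp only [add_zero] at h1 h2
      simp only [h1, h2]
      exact hint k a ha b hb
    · have h2 := hg k t
      rw [add_zero] at h2
      rw [h2]
      exact hB k t
  · refine hasSum_taylor (B := fun k => if k = 0 then C else B (k - 1))
      (fun k a ha b hb => ?_) (fun k t ht => ?_) ?_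
    · cases k with
      | zero => exact hg0 rfl a ha b hb
      | succ k =>
        simp only [hg]
        exact hint k a ha b hb
    · cases k with
      | zero => exact hgC rfl t ht
      | succ k =>
        rw [hg]
        simpa using hB k t
    · rw [← summable_nat_add_iff 1]
      refine Summable.of_nonneg_of_le (fun k => ?_) (fun k => ?_) hBsum
      · simp only [Nat.add_eq_zero_iff, one_ne_zero, and_false, if_false, Nat.add_sub_cancel]
        exact div_nonneg ENNReal.toReal_nonneg (by positivity)
      · simp only [Nat.add_eq_zero_iff, one_ne_zero, and_false, if_false, Nat.add_sub_cancel]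
        refine div_le_div_of_nonneg_left ENNReal.toReal_nonneg (by positivity) ?_
        exact_mod_cast Nat.factorial_le (Nat.le_succ k)

/-! ### The transformation of `Λ + K` by the flow of `F` -/

theorem finiteEnergy_of_norm_le {m C : ℝ} {z y : ℕ+ → ℂ} (hz : FiniteEnergy m z)
    (h : ∀ j, ‖y j‖ ≤ C * ‖z j‖) : FiniteEnergy m y := by
  refine Summable.of_nonneg_of_le (fun j => mul_nonneg (omega_nonneg m j) (by positivity))
    (fun j => ?_) (hz.mul_left (C ^ 2))
  calc omega m j * ‖y j‖ ^ 2 ≤ omega m j * (C * ‖z j‖) ^ 2 :=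
        mul_le_mul_of_nonneg_left (pow_le_pow_left₀ (norm_nonneg _) (h j) 2) (omega_nonneg m j)
    _ = _ := by ring

theorem Lam_le_of_norm_le {m C : ℝ} {z y : ℕ+ → ℂ} (hz : FiniteEnergy m z)
    (h : ∀ j, ‖y j‖ ≤ C * ‖z j‖) : Lam m y ≤ C ^ 2 * Lam m z := by
  rw [Lam, Lam, ← tsum_mul_left]
  refine (finiteEnergy_of_norm_le hz h).tsum_le_tsum (fun j => ?_) (hz.mul_left (C ^ 2))
  calc omega m j * ‖y j‖ ^ 2 ≤ omega m j * (C * ‖z j‖) ^ 2 :=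
        mul_le_mul_of_nonneg_left (pow_le_pow_left₀ (norm_nonneg _) (h j) 2) (omega_nonneg m j)
    _ = _ := by ring

theorem Lam_nonneg (m : ℝ) (z : ℕ+ → ℂ) : 0 ≤ Lam m z :=
  tsum_nonneg fun j => mul_nonneg (omega_nonneg m j) (by positivity)

/-- The ratio is at most `2 e d / ρ`, and `2 e < 6`. -/
theorem exp_mul_lieRatio_lt_one {w : Weight} {F : Ham} {r ρ d : ℝ} (hr : 0 ≤ r) (hρ : 0 < ρ)
    (hF : fldSup w (ENNReal.ofReal (r + ρ)) F ≤ ENNReal.ofReal d)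
    (hd : 6 * d < ρ) :
    ENNReal.ofReal (Real.exp 1) * lieRatio w (ENNReal.ofReal r) (ENNReal.ofReal ρ) F < 1 := by
  have h1 : lieRatio w (ENNReal.ofReal r) (ENNReal.ofReal ρ) F
      ≤ ENNReal.ofReal (2 / ρ) * ENNReal.ofReal d := by
    rw [lieRatio, ← ENNReal.ofReal_add hr hρ.le, ENNReal.ofReal_div_of_pos hρ]
    simp only [ENNReal.ofReal_ofNat]
    exact mul_le_mul_right hF _
  refine (mul_le_mul_right h1 _).trans_lt ?_
  rw [← ENNReal.ofReal_mul (by positivity), ← ENNReal.ofReal_mul (by positivity),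
    ENNReal.ofReal_lt_one]
  have he := Real.exp_one_lt_d9
  have : Real.exp 1 * (2 / ρ * d) = Real.exp 1 * (2 * d) / ρ := by ring
  rw [this, div_lt_one hρ]
  rcases le_or_gt d 0 with h | h
  · nlinarith [Real.exp_pos 1]
  · nlinarith

/-- Transformation of `Λ + K` by the time-one flow of `F`, where `N = {F, Λ}`. -/
theorem lie_step {m : ℝ} {w : Weight} {F K N : Ham} {r ρ d : ℝ} (hr : 0 ≤ r) (hd : 0 ≤ d)
    (hρ : 0 < ρ) (hdρ : 8 * d ≤ ρ) (hF : Good F) (hK : Good K) (hN : Good N)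
    (hFd : fldSup w (ENNReal.ofReal (r + ρ)) F ≤ ENNReal.ofReal d)
    (hKfin : fldSup w (ENNReal.ofReal (r + ρ)) K ≠ ⊤)
    (hNfin : fldSup w (ENNReal.ofReal (r + ρ)) N ≠ ⊤)
    (hbr : bracket F (lamHam m) = N) {Φ : ℝ → HSpace w → HSpace w} {z : HSpace w}
    (hz : z ∈ ball w r) (hz0 : Φ 0 z = z)
    (hder : ∀ t ∈ Set.Icc (-1 : ℝ) 1,
      HasDerivWithinAt (fun s => Φ s z) (vf w F (Φ t z)) (Set.Icc (-1 : ℝ) 1) t)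
    (hdist : ∀ t, ‖Φ t z - z‖ ≤ d) (hen : FiniteEnergy m z) :
    FiniteEnergy m (Φ 1 z) ∧ (Lam m (Φ 1 z) : ℂ) + K.eval (Φ 1 z) =
      Lam m z + K.eval z + N.eval z + (lieRem F K N).eval z := by
  have hmem : ∀ t, Φ t z ∈ ball w (r + d) := by
    intro t
    rw [mem_closedBall_zero_iff] at hz ⊢
    have := norm_add_le z (Φ t z - z)
    rw [add_sub_cancel] at this
    linarith [hdist t]
  have hmem' : ∀ t, ‖Φ t z‖ₑ ≤ ENNReal.ofReal (r + d) :=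
    fun t => (mem_ball_iff_enorm (by linarith)).1 (hmem t)
  have horb : IsOrbit F fun t => Φ t z :=
    isOrbit_of_hasDerivWithinAt hr hd (by linarith) hFd hder hmem
  -- a smaller ball containing the orbit
  have hρ1 : ENNReal.ofReal (ρ - d) ≠ 0 := by
    simp only [ne_eq, ENNReal.ofReal_eq_zero, not_le]
    linarith
  have hρ2 : ENNReal.ofReal (ρ - d) ≠ ⊤ := ENNReal.ofReal_ne_top
  have eR : ENNReal.ofReal (r + d) + ENNReal.ofReal (ρ - d) = ENNReal.ofReal (r + ρ) := by
    rw [← ENNReal.ofReal_add (by linarith) (by linarith)]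
    congr 1
    ring
  have hFfin' : fldSup w (ENNReal.ofReal (r + d) + ENNReal.ofReal (ρ - d)) F ≠ ⊤ := by
    rw [eR]; exact (hFd.trans_lt ENNReal.ofReal_lt_top).ne
  have hKfin' : fldSup w (ENNReal.ofReal (r + d) + ENNReal.ofReal (ρ - d)) K ≠ ⊤ := by rwa [eR]
  have hNfin' : fldSup w (ENNReal.ofReal (r + d) + ENNReal.ofReal (ρ - d)) N ≠ ⊤ := by rwa [eR]
  -- The orbit uses up `d` of the margin, and `8 d ≤ ρ` still leaves `6 d < ρ - d`.
  have hq : ENNReal.ofReal (Real.exp 1) *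
      lieRatio w (ENNReal.ofReal (r + d)) (ENNReal.ofReal (ρ - d)) F < 1 := by
    refine exp_mul_lieRatio_lt_one (d := d) (by linarith) (by linarith) ?_ (by linarith)
    have : r + d + (ρ - d) = r + ρ := by ring
    rwa [this]
  -- the energy stays finite
  set C := (fldSup w (ENNReal.ofReal (r + ρ)) F / ENNReal.ofReal (ρ - d)).toReal with hC
  have hCne : fldSup w (ENNReal.ofReal (r + ρ)) F / ENNReal.ofReal (ρ - d) ≠ ⊤ :=
    ENNReal.div_ne_top (hFd.trans_lt ENNReal.ofReal_lt_top).ne hρ1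
  have hfldC : ∀ t j, fld F (absSeq (Φ t z)) j ≤ ENNReal.ofReal C * absSeq (Φ t z) j := by
    intro t j
    rw [hC, ENNReal.ofReal_toReal hCne, div_eq_mul_inv, mul_right_comm, ← div_eq_mul_inv,
      ENNReal.le_div_iff_mul_le (Or.inl hρ1) (Or.inl hρ2), mul_comm]
    have := hF.mul_fld_le w (ρ := ENNReal.ofReal (ρ - d)) ((wn_absSeq w (Φ t z)).le.trans (hmem' t)) j
    rwa [eR] at this
  have hC0 : 0 ≤ C := ENNReal.toReal_nonneg
  have hnorm : ∀ t ∈ Set.Icc (0 : ℝ) 1, ∀ j, ‖Φ t z j‖ ≤ Real.exp C * ‖z j‖ := by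
    intro t ht j
    have := horb.norm_le hC0 (fun s _ i => ?_) j ht
    · simpa only [hz0] using this
    · have h1 := (enorm_dzbar_le F (Φ s z) i).trans (hfldC s i)
      rw [absSeq, ← ofReal_norm, ← ofReal_norm, ← ENNReal.ofReal_mul hC0,
        ENNReal.ofReal_le_ofReal_iff (by positivity)] at h1
      exact h1
  have hfe : ∀ t ∈ Set.Icc (0 : ℝ) 1, FiniteEnergy m (Φ t z) :=
    fun t ht => finiteEnergy_of_norm_le hen (hnorm t ht)
  have h1mem : (1 : ℝ) ∈ Set.Icc (0 : ℝ) 1 := by simp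
  refine ⟨hfe 1 h1mem, ?_⟩
  -- the Taylor series of `K` and of `Λ`
  have hKsum := hasSum_adPow_eval hF hK ENNReal.ofReal_ne_top hρ1 hρ2 hFfin' hKfin' hq horb hmem'
    (fun k t => (adPow F K k).eval (Φ t z)) 0 0 zero_le_one (fun k t => rfl) (by simp) (by simp)
  have hLeval : ∀ t ∈ Set.Icc (0 : ℝ) 1, (lamHam m).eval (Φ t z) = (Lam m (Φ t z) : ℂ) :=
    fun t ht => (hasSum_lamHam (hfe t ht)).tsum_eq
  have hLint : ∀ a ∈ Set.Icc (0 : ℝ) 1, ∀ b ∈ Set.Icc (0 : ℝ) 1,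
      (lamHam m).eval (Φ b z) - (lamHam m).eval (Φ a z) = ∫ t in a..b, N.eval (Φ t z) := by
    intro a ha b hb
    have hEsum : ∑' j, ENNReal.ofReal (omega m j * ‖z j‖ ^ 2) ≠ ⊤ := hen.tsum_ofReal_ne_top
    rw [← hbr]
    refine horb.integral_bracket hF (good_lamHam m)
      (M := ENNReal.ofReal (C * Real.exp C ^ 2) * ∑' j, ENNReal.ofReal (omega m j * ‖z j‖ ^ 2))
      (ENNReal.mul_ne_top ENNReal.ofReal_ne_top hEsum) (fun t ht => ?_)
      (fun t ht => (hasSum_lamHam (hfe t ht)).summable) ha hb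
    rw [← ENNReal.tsum_mul_left]
    refine ENNReal.tsum_le_tsum fun j => ?_
    refine (mul_le_mul' (hfldC t j) (fld_lamHam_le m _ j)).trans ?_
    rw [absSeq, ← ofReal_norm, ← ENNReal.ofReal_mul hC0, ← ENNReal.ofReal_mul (omega_nonneg m j),
      ← ENNReal.ofReal_mul (by positivity), ← ENNReal.ofReal_mul (by positivity)]
    refine ENNReal.ofReal_le_ofReal ?_
    calc C * ‖Φ t z j‖ * (omega m j * ‖Φ t z j‖)
        = C * omega m j * ‖Φ t z j‖ ^ 2 := by ring
      _ ≤ C * omega m j * (Real.exp C * ‖z j‖) ^ 2 :=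
          mul_le_mul_of_nonneg_left (pow_le_pow_left₀ (norm_nonneg _) (hnorm t ht j) 2)
            (mul_nonneg hC0 (omega_nonneg m j))
      _ = _ := by ring
  -- The hierarchy for `Λ` is `Λ`, `N`, `{F, N}`, and so on.
  have hLsum := hasSum_adPow_eval hF hN ENNReal.ofReal_ne_top hρ1 hρ2 hFfin' hNfin' hq horb hmem'
    (fun k t => match k with
      | 0 => (lamHam m).eval (Φ t z)
      | k + 1 => (adPow F N k).eval (Φ t z)) (Real.exp C ^ 2 * Lam m z) 1 le_rfl
    (fun k t => rfl) (fun _ => hLint) (fun _ t ht => by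
      simp only [hLeval t ht]
      rw [Complex.norm_real, Real.norm_of_nonneg (Lam_nonneg m _)]
      exact Lam_le_of_norm_le hen (hnorm t ht))
  simp only [hz0] at hKsum hLsum
  rw [hLeval 1 h1mem] at hLsum
  have hL0 : (lamHam m).eval z = (Lam m z : ℂ) := (hasSum_lamHam hen).tsum_eq
  -- the remainder
  have hrfin : ∑' k, fldSup w (ENNReal.ofReal (r + d)) (lieTerm F K N k) ≠ ⊤ := by
    refine ne_top_of_le_ne_top ?_ (ENNReal.tsum_le_tsum fun k =>
      fldSup_lieTerm_le w hF hK hN hρ1 hρ2 hFfin' hKfin' hNfin' k)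
    rw [ENNReal.tsum_mul_right, ENNReal.tsum_mul_left, ENNReal.tsum_geometric]
    refine ENNReal.mul_ne_top (ENNReal.mul_ne_top
      (ENNReal.mul_ne_top (ENNReal.div_ne_top (by simp) hρ1) hFfin') ?_)
      (ENNReal.add_ne_top.2 ⟨hKfin', ENNReal.mul_ne_top (by simp) hNfin'⟩)
    rw [ENNReal.inv_ne_top]
    exact (tsub_pos_of_lt hq).ne'
  have hzmem : ‖z‖ₑ ≤ ENNReal.ofReal (r + d) := by
    have := hmem' 0
    rwa [hz0] at this
  have hrem := hasSum_eval_tsum (fun k => hF.lieTerm hK hN k) ENNReal.ofReal_ne_top hrfin hzmem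
  have hterm : ∀ k, (lieTerm F K N k).eval z = (adPow F K (k + 1)).eval z / ((k + 1).factorial : ℂ) +
      (adPow F N (k + 1)).eval z / ((k + 2).factorial : ℂ) := by
    intro k
    have hs1 := (hF.adPow hK (k + 1)).summable_mon ENNReal.ofReal_ne_top
      (fldSup_adPow_ne_top w hF hK hρ1 hρ2 hFfin' hKfin' (k + 1)) hzmem
    have hs2 := (hF.adPow hN (k + 1)).summable_mon ENNReal.ofReal_ne_top
      (fldSup_adPow_ne_top w hF hN hρ1 hρ2 hFfin' hNfin' (k + 1)) hzmem
    simp only [Ham.eval]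
    rw [← tsum_div_const, ← tsum_div_const, ← (hs1.div_const _).tsum_add (hs2.div_const _)]
    refine tsum_congr fun p => ?_
    simp only [lieTerm]
    ring
  -- With one term of the series of `K` and two of that of `Λ` removed, the `k`-th terms add up to
  -- `lieTerm F K N k`.
  have hK1 := (hasSum_nat_add_iff' 1).2 hKsum
  have hL1 := (hasSum_nat_add_iff' 2).2 hLsum
  simp only [hterm] at hrem
  have htot : _ = (lieRem F K N).eval z := (hK1.add hL1).unique hrem
  simp only [Finset.sum_range_succ, Nat.factorial, hL0] at htot
  simp only [adPow_zero, Finset.range_zero, Finset.sum_empty] at htot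
  push_cast at htot
  linear_combination htot

/-! ### Frequencies -/

theorem one_le_pnat (j : ℕ+) : (1 : ℝ) ≤ (j : ℝ) := by exact_mod_cast j.2

theorem omega_eq (m : ℝ) (j : ℕ+) : omega m j = j * √((j : ℝ) ^ 2 + m) := by
  rw [omega, show (j : ℝ) ^ 4 + m * (j : ℝ) ^ 2 = (j : ℝ) ^ 2 * ((j : ℝ) ^ 2 + m) by ring,
    Real.sqrt_mul (by positivity), Real.sqrt_sq (by positivity)]

theorem sqrt_one_add_le_omega {m : ℝ} (j : ℕ+) : √(1 + m) ≤ omega m j := by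
  have h1 := one_le_pnat j
  rw [omega_eq]
  calc √(1 + m) = 1 * √(1 + m) := (one_mul _).symm
    _ ≤ j * √((j : ℝ) ^ 2 + m) := by
      gcongr
      nlinarith

theorem omega_pos {m : ℝ} (hm : -1 / 2 ≤ m) (j : ℕ+) : 0 < omega m j :=
  (Real.sqrt_pos.2 (by linarith)).trans_le (sqrt_one_add_le_omega j)

theorem omega_add_le {m : ℝ} {i j : ℕ+} (h : i < j) : omega m i + √((j : ℝ) ^ 2 + m) ≤ omega m j := by
  have h1 : (i : ℝ) + 1 ≤ j := by exact_mod_cast h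
  have h2 := one_le_pnat i
  rw [omega_eq, omega_eq]
  have h3 : √((i : ℝ) ^ 2 + m) ≤ √((j : ℝ) ^ 2 + m) := Real.sqrt_le_sqrt (by nlinarith)
  have h4 := Real.sqrt_nonneg ((j : ℝ) ^ 2 + m)
  nlinarith

theorem sqrt_four_add_le_omega_sub {m : ℝ} {i j : ℕ+} (h : i < j) :
    √(4 + m) ≤ omega m j - omega m i := by
  have h1 : (i : ℝ) + 1 ≤ j := by exact_mod_cast h
  have h2 := one_le_pnat i
  have h3 : √(4 + m) ≤ √((j : ℝ) ^ 2 + m) := Real.sqrt_le_sqrt (by nlinarith)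
  linarith [omega_add_le (m := m) h]

/-- The quotient `j² / ω_j`. -/
def acoef (m : ℝ) (j : ℕ+) : ℝ := (j : ℝ) ^ 2 / omega m j

theorem acoef_nonneg (m : ℝ) (j : ℕ+) : 0 ≤ acoef m j :=
  div_nonneg (by positivity) (omega_nonneg m j)

/-- The quotient equals `j / √(j² + m)`: at most `1` if `m ≥ 0`, and largest at `j = 1` if `m < 0`.
-/
theorem acoef_le_cfrak {m : ℝ} (hm : -1 / 2 ≤ m) (j : ℕ+) : acoef m j ≤ cfrak m := by
  have h1 := one_le_pnat j
  rw [acoef, div_le_iff₀ (omega_pos hm j), omega_eq, cfrak]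
  split_ifs with h
  · have : (j : ℝ) ≤ √((j : ℝ) ^ 2 + m) := Real.le_sqrt_of_sq_le (by linarith)
    nlinarith
  · have h0 : 0 < √(1 + m) := Real.sqrt_pos.2 (by linarith)
    have h3 : 0 ≤ -m * ((j : ℝ) ^ 2 - 1) := mul_nonneg (by linarith) (by nlinarith)
    have h2 : (j : ℝ) * √(1 + m) ≤ √((j : ℝ) ^ 2 + m) := by
      rw [← Real.sqrt_sq (by linarith : (0 : ℝ) ≤ j), ← Real.sqrt_mul (by positivity),
        Real.sqrt_sq (by linarith : (0 : ℝ) ≤ j)]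
      exact Real.sqrt_le_sqrt (by linarith)
    rw [one_div, ← div_eq_inv_mul, le_div_iff₀ h0]
    nlinarith

theorem cfrak_pos {m : ℝ} (hm : -1 / 2 ≤ m) : 0 < cfrak m := by
  rw [cfrak]
  split_ifs
  · exact one_pos
  · exact one_div_pos.2 (Real.sqrt_pos.2 (by linarith))

theorem mu_pos {m : ℝ} (hm : -1 / 2 ≤ m) : 0 < mu m :=
  lt_min (mul_pos two_pos (Real.sqrt_pos.2 (by linarith)))
    (mul_pos (by norm_num) (Real.sqrt_pos.2 (by linarith)))

/-! ### Divisors -/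

theorem sum_mul_omega_add (m : ℝ) (n k : ℕ+ →₀ ℕ) :
    ((n + k).sum fun j c => (c : ℝ) * omega m j)
      = (n.sum fun j c => (c : ℝ) * omega m j) + k.sum fun j c => (c : ℝ) * omega m j :=
  Finsupp.sum_add_index' (by simp) (by intros; push_cast; ring)

theorem divisor_add (m : ℝ) (p q : MIdx) : divisor m (p + q) = divisor m p + divisor m q := by
  simp only [divisor, Prod.fst_add, Prod.snd_add, sum_mul_omega_add]
  ring

theorem divisor_single (m : ℝ) (i : ℕ+) (s : Bool) :
    divisor m (single i s) = (sgn s : ℝ) * omega m i := by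
  cases s <;> simp [divisor, single, sgn]

theorem divisor_eq_zero_of_eq (m : ℝ) {p : MIdx} (h : p.1 = p.2) : divisor m p = 0 := by
  rw [divisor, h, sub_self]

theorem divisor_swap (m : ℝ) (α β : ℕ+ →₀ ℕ) : divisor m (β, α) = -divisor m (α, β) := by
  simp [divisor]

theorem QIdx.divisor_midx (m : ℝ) (q : QIdx) : divisor m q.midx = q.Delta m := by
  simp only [QIdx.midx, divisor_add, divisor_single, QIdx.Delta]
  push_cast
  ring

theorem single_fst_sub_snd (i : ℕ+) (s : Bool) (k : ℕ+) :
    (((single i s).1 k : ℕ) : ℤ) - ((single i s).2 k : ℕ) = if i = k then sgn s else 0 := by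
  cases s <;> by_cases h : i = k <;> simp [single, sgn, h]

theorem single_fst_add_snd (i : ℕ+) (s : Bool) :
    (single i s).1 + (single i s).2 = Finsupp.single i 1 := by
  cases s <;> simp [single]

theorem QIdx.fst_sub_snd (q : QIdx) (k : ℕ+) : ((q.midx.1 k : ℕ) : ℤ) - (q.midx.2 k : ℕ) =
    (if q.i = k then sgn q.s₁ + sgn q.s₁' else 0) +
      if q.j = k then sgn q.s₂ + sgn q.s₂' else 0 := by
  have h1 := single_fst_sub_snd q.i q.s₁ k
  have h2 := single_fst_sub_snd q.i q.s₁' k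
  have h3 := single_fst_sub_snd q.j q.s₂ k
  have h4 := single_fst_sub_snd q.j q.s₂' k
  simp only [QIdx.midx, Prod.fst_add, Prod.snd_add, Finsupp.add_apply]
  push_cast
  split_ifs at * <;> linarith

theorem sgn_add_eq_zero_iff (s t : Bool) : sgn s + sgn t = 0 ↔ s ≠ t := by
  cases s <;> cases t <;> simp [sgn]

/-- Integrability depends on the monomial alone, not on the way it is written with indices and
signs. This permits working with coefficients from here on. -/
theorem QIdx.integrable_iff (q : QIdx) : q.Integrable ↔ q.midx.1 = q.midx.2 := by
  have key : q.midx.1 = q.midx.2 ↔ ∀ k, (if q.i = k then sgn q.s₁ + sgn q.s₁' else 0) +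
      (if q.j = k then sgn q.s₂ + sgn q.s₂' else 0) = 0 := by
    rw [DFunLike.ext_iff]
    refine forall_congr' fun k => ?_
    rw [← q.fst_sub_snd k]
    omega
  rw [key, QIdx.Integrable]
  by_cases h : q.i = q.j
  · simp only [h, ne_eq, not_true_eq_false, false_implies, true_and, true_implies]
    constructor
    · intro h0 k
      split_ifs <;> linarith
    · intro h0
      have := h0 q.j
      simp only [if_true] at this
      linarith
  · simp only [ne_eq, h, not_false_eq_true, true_implies, false_implies, and_true]
    rw [← ne_eq, ← ne_eq, ← sgn_add_eq_zero_iff, ← sgn_add_eq_zero_iff]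
    constructor
    · rintro ⟨h1, h2⟩ k
      simp [h1, h2]
    · intro h0
      have h1 := h0 q.i
      have h2 := h0 q.j
      simp only [if_true, h, Ne.symm h, if_false, add_zero, zero_add] at h1 h2
      exact ⟨h1, h2⟩

theorem sgn_add_cases (s t : Bool) : sgn s + sgn t = 0 ∨ sgn s + sgn t = 2 ∨ sgn s + sgn t = -2 := by
  cases s <;> cases t <;> simp [sgn]

/-- Up to sign, a nonintegrable divisor is `2ω` or `4ω` of one mode, or `2(ω_i ± ω_j)` with `i ≠ j`.
All but the difference are at least `2√(1+m)`, and the difference is at least `2√(4+m)`. -/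
theorem QIdx.mu_le_abs_Delta {m : ℝ} (q : QIdx) (hq : ¬ q.Integrable) : mu m ≤ |q.Delta m| := by
  have hi := sqrt_one_add_le_omega (m := m) q.i
  have hj := sqrt_one_add_le_omega (m := m) q.j
  have h0 := Real.sqrt_nonneg (1 + m)
  have h4 := Real.sqrt_nonneg (4 + m)
  have hne : q.i ≠ q.j → √(4 + m) ≤ |omega m q.i - omega m q.j| := by
    intro hne
    rcases lt_or_gt_of_ne hne with h | h
    · rw [abs_sub_comm]
      exact (sqrt_four_add_le_omega_sub h).trans (le_abs_self _)
    · exact (sqrt_four_add_le_omega_sub h).trans (le_abs_self _)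
  have hmu1 : mu m ≤ 2 * √(1 + m) := min_le_left _ _
  have hmu2 : mu m ≤ 3 / 2 * √(4 + m) := min_le_right _ _
  rw [QIdx.Integrable, ← sgn_add_eq_zero_iff, ← sgn_add_eq_zero_iff] at hq
  rw [QIdx.Delta]
  by_cases h : q.i = q.j
  · simp only [h, ne_eq, not_true_eq_false, false_implies, true_and, true_implies] at hq
    rw [h]
    rcases sgn_add_cases q.s₁ q.s₁' with e1 | e1 | e1 <;>
    rcases sgn_add_cases q.s₂ q.s₂' with e2 | e2 | e2 <;>
    first
    | (exfalso; exact hq (by omega))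
    | (rw [e1, e2]; push_cast; rw [le_abs]; first | (left; linarith) | (right; linarith))
  · have h5 := hne h
    simp only [ne_eq, h, not_false_eq_true, true_implies, false_implies, and_true] at hq
    rcases sgn_add_cases q.s₁ q.s₁' with e1 | e1 | e1 <;>
    rcases sgn_add_cases q.s₂ q.s₂' with e2 | e2 | e2 <;>
    rw [e1, e2] at hq ⊢ <;> push_cast <;>
    first
    | (exfalso; exact hq ⟨rfl, rfl⟩)
    | (rw [le_abs]; first | (left; linarith) | (right; linarith))
    | (rcases abs_cases (omega m q.i - omega m q.j) with ⟨h6, -⟩ | ⟨h6, -⟩ <;> rw [h6] at h5 <;>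
        rw [le_abs] <;> first | (left; linarith) | (right; linarith))

/-! ### The quartic Hamiltonian as a power series -/

theorem Gcoef_eq (m : ℝ) (i j : ℕ+) : Gcoef m i j = 1 / (32 * Real.pi) * (acoef m i * acoef m j) := by
  rw [Gcoef, acoef, acoef, div_mul_div_comm ((i : ℝ) ^ 2)]

theorem Gcoef_nonneg (m : ℝ) (i j : ℕ+) : 0 ≤ Gcoef m i j := by
  rw [Gcoef_eq]
  exact mul_nonneg (by positivity) (mul_nonneg (acoef_nonneg m i) (acoef_nonneg m j))

/-- `G` as a power series. -/
def quarticHam (m : ℝ) : Ham := push (fun q : QIdx => (Gcoef m q.i q.j : ℂ)) QIdx.midx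

open Classical in
/-- The part of a Hamiltonian that depends only on the actions `|z_j|²`. -/
def diagPart (f : Ham) : Ham := fun p => if p.1 = p.2 then f p else 0

theorem QIdx.fst_add_snd (q : QIdx) : q.midx.1 + q.midx.2 =
    (Finsupp.single q.i 1 + Finsupp.single q.j 1) +
      (Finsupp.single q.i 1 + Finsupp.single q.j 1) := by
  have h1 := single_fst_add_snd q.i q.s₁
  have h2 := single_fst_add_snd q.i q.s₁'
  have h3 := single_fst_add_snd q.j q.s₂
  have h4 := single_fst_add_snd q.j q.s₂'
  calc q.midx.1 + q.midx.2 = ((single q.i q.s₁).1 + (single q.i q.s₁).2) +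
        ((single q.i q.s₁').1 + (single q.i q.s₁').2) +
        ((single q.j q.s₂).1 + (single q.j q.s₂).2) +
        ((single q.j q.s₂').1 + (single q.j q.s₂').2) := by
        simp only [QIdx.midx, Prod.fst_add, Prod.snd_add]
        abel
    _ = _ := by
        rw [h1, h2, h3, h4]
        abel

theorem QIdx.deg_midx (q : QIdx) : deg q.midx = 4 := by
  rw [deg_eq, ← map_add, q.fst_add_snd]
  simp

/-- Reversing all signs. -/
def QIdx.flip : QIdx ≃ QIdx where
  toFun q := ⟨q.i, q.j, !q.s₁, !q.s₂, !q.s₁', !q.s₂'⟩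
  invFun q := ⟨q.i, q.j, !q.s₁, !q.s₂, !q.s₁', !q.s₂'⟩
  left_inv q := by simp
  right_inv q := by simp

theorem QIdx.midx_flip (q : QIdx) : (QIdx.flip q).midx = q.midx.swap := by
  have h : ∀ i s, single i (!s) = (single i s).swap := by
    intro i s
    cases s <;> rfl
  simp only [QIdx.midx, QIdx.flip, Equiv.coe_fn_mk, h]
  rfl

theorem deg_of_quarticHam_ne_zero {m : ℝ} {p : MIdx} (h : quarticHam m p ≠ 0) : deg p = 4 := by
  obtain ⟨q, rfl, -⟩ := exists_of_push_ne_zero h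
  exact q.deg_midx

theorem good_quarticHam (m : ℝ) : Good (quarticHam m) where
  real α β := by
    classical
    rw [quarticHam, push, push, Complex.conj_tsum, ← QIdx.flip.tsum_eq]
    refine tsum_congr fun q => ?_
    have : (QIdx.flip q).midx = (α, β) ↔ q.midx = (β, α) := by
      rw [QIdx.midx_flip, ← Prod.swap_inj, Prod.swap_swap, Prod.swap_prod_mk]
    simp only [this]
    split_ifs <;> simp [QIdx.flip]
  even p hp k := by
    obtain ⟨q, rfl, -⟩ := exists_of_push_ne_zero hp
    have := DFunLike.congr_fun q.fst_add_snd k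
    simp only [Finsupp.add_apply] at this
    exact ⟨_, this⟩
  zero := by
    by_contra h
    have := deg_of_quarticHam_ne_zero h
    simp [deg_eq] at this

theorem Good.diagPart {f : Ham} (hf : Good f) : Good (diagPart f) where
  real α β := by
    simp only [Beam.diagPart]
    by_cases h : α = β
    · simp [h, ← hf.real]
    · simp [h, Ne.symm h]
  even p hp := hf.even p fun h => hp (by simp [Beam.diagPart, h])
  zero := by simp [Beam.diagPart, hf.zero]

/-- The indices of the monomials of `G` as a product type. -/
def QIdx.equivProd : (ℕ+ × ℕ+) × (Bool × Bool × Bool × Bool) ≃ QIdx where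
  toFun t := ⟨t.1.1, t.1.2, t.2.1, t.2.2.1, t.2.2.2.1, t.2.2.2.2⟩
  invFun q := ((q.i, q.j), (q.s₁, q.s₂, q.s₁', q.s₂'))
  left_inv _ := rfl
  right_inv _ := rfl

/-- For each `(i, j)`, the derivative of the sum over the sixteen sign patterns contributes `16
G_{ij}` from either index, and the total `32` cancels the prefactor `1/(32π)` to `1/π`. -/
theorem fld_quarticHam_le (m : ℝ) (x : ℕ+ → ℝ≥0∞) (k : ℕ+) : fld (quarticHam m) x k ≤
    ENNReal.ofReal (1 / Real.pi * acoef m k) *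
      (∑' j, ENNReal.ofReal (acoef m j) * x j ^ 2) * x k := by
  refine (fld_push_le _ _ x k).trans ?_
  rw [← QIdx.equivProd.tsum_eq, ENNReal.tsum_prod']
  have hb : ∀ ij : ℕ+ × ℕ+, ∑' b : Bool × Bool × Bool × Bool,
      ‖(Gcoef m (QIdx.equivProd (ij, b)).i (QIdx.equivProd (ij, b)).j : ℂ)‖ₑ *
        (emon (QIdx.equivProd (ij, b)).midx.1 x * ed (QIdx.equivProd (ij, b)).midx.2 k x)
      = ENNReal.ofReal (Gcoef m ij.1 ij.2) * (16 * ((if ij.1 = k then x ij.1 * x ij.2 ^ 2 else 0) +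
        if ij.2 = k then x ij.1 ^ 2 * x ij.2 else 0)) := by
    rintro ⟨i, j⟩
    rw [tsum_fintype]
    simp only [QIdx.equivProd, Equiv.coe_fn_mk, enorm_ofReal' (Gcoef_nonneg m i j)]
    rw [← Finset.mul_sum]
    congr 1
    simp only [Fintype.sum_prod_type, Fintype.sum_bool, QIdx.midx, Prod.fst_add, Prod.snd_add,
      emon_add, ed_add, single, if_true, Bool.false_eq_true, if_false, emon_single, emon_zero,
      ed_single, ed_zero]
    by_cases h1 : i = k <;> by_cases h2 : j = k <;> simp [h1, h2] <;> ring
  simp only [hb]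
  have hsplit : ∀ i j : ℕ+, ENNReal.ofReal (Gcoef m i j) * (16 * ((if i = k then x i * x j ^ 2 else 0)
      + if j = k then x i ^ 2 * x j else 0)) =
      (if i = k then ENNReal.ofReal (16 * Gcoef m k j) * x k * x j ^ 2 else 0) +
      (if j = k then ENNReal.ofReal (16 * Gcoef m i k) * x k * x i ^ 2 else 0) := by
    intro i j
    have h16 : ∀ i j, ENNReal.ofReal (16 * Gcoef m i j) = 16 * ENNReal.ofReal (Gcoef m i j) := by
      intro i j
      rw [ENNReal.ofReal_mul (by norm_num)]
      simp
    simp only [h16]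
    by_cases h1 : i = k <;> by_cases h2 : j = k <;> simp [h1, h2] <;> ring
  rw [ENNReal.tsum_prod']
  simp only [hsplit, ENNReal.tsum_add]
  have e1 : ∑' i : ℕ+, ∑' j : ℕ+, (if i = k then ENNReal.ofReal (16 * Gcoef m k j) * x k * x j ^ 2
      else 0) = ∑' j, ENNReal.ofReal (16 * Gcoef m k j) * x k * x j ^ 2 := by
    rw [tsum_eq_single k (fun i hi => by simp [hi])]
    simp
  have e2 : ∑' i : ℕ+, ∑' j : ℕ+, (if j = k then ENNReal.ofReal (16 * Gcoef m i k) * x k * x i ^ 2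
      else 0) = ∑' j, ENNReal.ofReal (16 * Gcoef m j k) * x k * x j ^ 2 :=
    tsum_congr fun i => by rw [tsum_eq_single k (fun j hj => by simp [hj])]; simp
  rw [e1, e2, ← ENNReal.tsum_add]
  refine le_of_eq ?_
  rw [← ENNReal.tsum_mul_left, ← ENNReal.tsum_mul_right]
  refine tsum_congr fun j => ?_
  have h3 : Gcoef m j k = Gcoef m k j := by rw [Gcoef_eq, Gcoef_eq]; ring
  have h4 : ENNReal.ofReal (1 / Real.pi * acoef m k) * ENNReal.ofReal (acoef m j)
      = ENNReal.ofReal (16 * Gcoef m k j) + ENNReal.ofReal (16 * Gcoef m k j) := by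
    have := Gcoef_nonneg m k j
    rw [← ENNReal.ofReal_mul (mul_nonneg (by positivity) (acoef_nonneg m k)),
      ← ENNReal.ofReal_add (by positivity) (by positivity), Gcoef_eq]
    congr 1
    field_simp
    ring
  rw [h3]
  calc _ = (ENNReal.ofReal (16 * Gcoef m k j) + ENNReal.ofReal (16 * Gcoef m k j)) *
        (x k * x j ^ 2) := by ring
    _ = _ := by
        rw [← h4]
        ring

/-! ### The quartic Hamiltonian as a function -/

theorem exists_acoef_le {m : ℝ} (hm : -1 / 2 ≤ m) (w : Weight) :
    ∃ C : ℝ, 0 ≤ C ∧ ∀ j, acoef m j ≤ C * w.val j ^ 2 := by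
  obtain ⟨c, hc, hw⟩ := w.bddBelow'
  refine ⟨cfrak m / c ^ 2, div_nonneg (cfrak_pos hm).le (by positivity), fun j => ?_⟩
  rw [div_mul_eq_mul_div, le_div_iff₀ (by positivity)]
  exact mul_le_mul (acoef_le_cfrak hm j) (pow_le_pow_left₀ hc.le (hw j) 2) (by positivity)
    (cfrak_pos hm).le

theorem exists_tsum_acoef_mul_le {m : ℝ} (hm : -1 / 2 ≤ m) (w : Weight) :
    ∃ C : ℝ, 0 ≤ C ∧ ∀ z : HSpace w, (Summable fun j => acoef m j * ‖z j‖ ^ 2) ∧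
      ∑' j, acoef m j * ‖z j‖ ^ 2 ≤ C * ‖z‖ ^ 2 := by
  obtain ⟨C, hC, h⟩ := exists_acoef_le hm w
  refine ⟨C, hC, fun z => ?_⟩
  have hs := ((mem_hSub_iff w z.1).1 z.2).mul_left C
  have hle : ∀ j, acoef m j * ‖z j‖ ^ 2 ≤ C * (w.val j ^ 2 * ‖z j‖ ^ 2) := fun j => by
    rw [← mul_assoc]
    exact mul_le_mul_of_nonneg_right (h j) (by positivity)
  have hs' : Summable fun j => acoef m j * ‖z j‖ ^ 2 := Summable.of_nonneg_of_le
    (fun j => mul_nonneg (acoef_nonneg m j) (by positivity)) hle hs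
  refine ⟨hs', ?_⟩
  rw [norm_sq_eq, ← tsum_mul_left]
  exact hs'.tsum_le_tsum hle hs

theorem summable_acoef_mul {m : ℝ} (hm : -1 / 2 ≤ m) {w : Weight} (z : HSpace w) :
    Summable fun j => acoef m j * ‖z j‖ ^ 2 := by
  obtain ⟨C, -, h⟩ := exists_tsum_acoef_mul_le hm w
  exact (h z).1

theorem mon_add (p q : MIdx) (z : ℕ+ → ℂ) : mon (p + q) z = mon p z * mon q z := by
  simp only [mon_eq, Prod.fst_add, Prod.snd_add, cmon_add]
  ring

theorem mon_single (i : ℕ+) (s : Bool) (z : ℕ+ → ℂ) :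
    mon (single i s) z = if s then z i else conj (z i) := by
  cases s <;> simp [mon_eq, single, cmon, conjSeq]

theorem QIdx.norm_mon_midx (q : QIdx) (z : ℕ+ → ℂ) :
    ‖mon q.midx z‖ = ‖z q.i‖ ^ 2 * ‖z q.j‖ ^ 2 := by
  have h : ∀ i s, ‖mon (single i s) z‖ = ‖z i‖ := fun i s => by
    rw [mon_single]
    split_ifs <;> simp
  simp only [QIdx.midx, mon_add, norm_mul, h]
  ring

theorem summable_acoef_mul_acoef {m : ℝ} (hm : -1 / 2 ≤ m) {w : Weight} (z : HSpace w) :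
    Summable fun t : ℕ+ × ℕ+ => acoef m t.1 * ‖z t.1‖ ^ 2 * (acoef m t.2 * ‖z t.2‖ ^ 2) :=
  (summable_acoef_mul hm z).mul_of_nonneg (summable_acoef_mul hm z)
    (fun j => mul_nonneg (acoef_nonneg m j) (by positivity))
    (fun j => mul_nonneg (acoef_nonneg m j) (by positivity))

theorem eval_push_midx {m : ℝ} (hm : -1 / 2 ≤ m) {w : Weight} (z : HSpace w) {c : QIdx → ℂ}
    (hc : ∀ q, ‖c q‖ ≤ Gcoef m q.i q.j) : (push c QIdx.midx).eval z =
      ∑' t : ℕ+ × ℕ+, ∑ b, c (QIdx.equivProd (t, b)) * mon (QIdx.equivProd (t, b)).midx z := by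
  have h1 : Summable fun t : (ℕ+ × ℕ+) × (Bool × Bool × Bool × Bool) =>
      1 / (32 * Real.pi) *
        (acoef m t.1.1 * ‖z t.1.1‖ ^ 2 * (acoef m t.1.2 * ‖z t.1.2‖ ^ 2) * 1) := by
    refine Summable.mul_left _ ?_
    exact (summable_acoef_mul_acoef hm z).mul_of_nonneg
      (summable_of_hasFiniteSupport (Set.toFinite _) :
        Summable fun _ : Bool × Bool × Bool × Bool => (1 : ℝ))
      (fun t => mul_nonneg (mul_nonneg (acoef_nonneg m _) (by positivity))
        (mul_nonneg (acoef_nonneg m _) (by positivity))) (fun _ => zero_le_one)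
  have h2 : Summable fun t => c (QIdx.equivProd t) * mon (QIdx.equivProd t).midx z := by
    refine Summable.of_norm_bounded h1 fun t => ?_
    rw [norm_mul, QIdx.norm_mon_midx]
    refine (mul_le_mul_of_nonneg_right (hc _) (by positivity)).trans (le_of_eq ?_)
    rw [Gcoef_eq]
    simp only [QIdx.equivProd, Equiv.coe_fn_mk]
    ring
  have h3 : Summable fun q => c q * mon q.midx z := QIdx.equivProd.summable_iff.1 h2
  rw [Ham.eval, (hasSum_push (fun p => mon p z) h3).tsum_eq,
    ← QIdx.equivProd.tsum_eq, h2.tsum_prod]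
  exact tsum_congr fun t => tsum_fintype _

theorem eval_quarticHam {m : ℝ} (hm : -1 / 2 ≤ m) {w : Weight} (z : HSpace w) :
    (quarticHam m).eval z = (Gfun m z : ℂ) := by
  rw [quarticHam, eval_push_midx hm z fun q => by
    rw [Complex.norm_real, Real.norm_of_nonneg (Gcoef_nonneg m _ _)]]
  have hs : Summable fun j => acoef m j * (2 * (z j).re) ^ 2 := by
    refine Summable.of_nonneg_of_le (fun j => mul_nonneg (acoef_nonneg m j) (by positivity))
      (fun j => ?_) ((summable_acoef_mul hm z).mul_left 4)
    have h1 : (z j).re ^ 2 ≤ ‖z j‖ ^ 2 := by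
      rw [← Complex.normSq_eq_norm_sq, Complex.normSq_apply]
      nlinarith [sq_nonneg (z j).im]
    nlinarith [mul_le_mul_of_nonneg_left h1 (acoef_nonneg m j)]
  have e : ∀ t : ℕ+ × ℕ+, ∑ b, (Gcoef m (QIdx.equivProd (t, b)).i (QIdx.equivProd (t, b)).j : ℂ) *
      mon (QIdx.equivProd (t, b)).midx z = ((1 / (32 * Real.pi) *
        (acoef m t.1 * (2 * (z t.1).re) ^ 2 * (acoef m t.2 * (2 * (z t.2).re) ^ 2)) : ℝ) : ℂ) := by
    rintro ⟨i, j⟩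
    have hre : ∀ k, ((2 * (z k).re : ℝ) : ℂ) = z k + conj (z k) := fun k => by
      rw [Complex.add_conj]
    simp only [QIdx.equivProd, Equiv.coe_fn_mk, Gcoef_eq]
    have hR : ∀ g a b x y : ℝ, ((g * (a * x ^ 2 * (b * y ^ 2)) : ℝ) : ℂ) =
        g * (a * (x : ℂ) ^ 2 * (b * (y : ℂ) ^ 2)) := by
      intros
      push_cast
      ring
    rw [hR, hre, hre]
    simp only [Fintype.sum_prod_type, Fintype.sum_bool, QIdx.midx, mon_add, mon_single, if_true,
      Bool.false_eq_true, if_false]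
    push_cast
    ring
  rw [tsum_congr e, ← Complex.ofReal_tsum, tsum_mul_left, Gfun, sq (∑' j : ℕ+, _),
    ← tsum_mul_tsum_of_summable_norm hs.norm hs.norm]
  rfl

open Classical in
theorem diagPart_quarticHam (m : ℝ) : diagPart (quarticHam m) =
    push (fun q : QIdx => if q.Integrable then (Gcoef m q.i q.j : ℂ) else 0) QIdx.midx := by
  funext p
  rw [diagPart, quarticHam, push, push]
  split_ifs with h
  · refine tsum_congr fun q => ?_
    by_cases hq : q.midx = p
    · rw [if_pos hq, if_pos hq, if_pos (q.integrable_iff.2 (hq ▸ h))]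
    · rw [if_neg hq, if_neg hq]
  · refine (tsum_congr fun q => ?_).trans tsum_zero |>.symm
    by_cases hq : q.midx = p
    · rw [if_pos hq, if_neg fun hi => h (hq ▸ q.integrable_iff.1 hi)]
    · rw [if_neg hq]

theorem eval_diagPart_quarticHam {m : ℝ} (hm : -1 / 2 ≤ m) {w : Weight} (z : HSpace w) :
    (diagPart (quarticHam m)).eval z = (Gbar m z : ℂ) := by
  classical
  rw [diagPart_quarticHam, eval_push_midx hm z fun q => by
    split_ifs
    · rw [Complex.norm_real, Real.norm_of_nonneg (Gcoef_nonneg m _ _)]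
    · rw [norm_zero]
      exact Gcoef_nonneg m _ _]
  rw [Gbar, Complex.ofReal_tsum]
  refine tsum_congr fun t => ?_
  obtain ⟨i, j⟩ := t
  have hns : ∀ k, ((‖z k‖ ^ 2 : ℝ) : ℂ) = z k * conj (z k) := fun k => by
    rw [Complex.mul_conj, Complex.normSq_eq_norm_sq]
  rw [Complex.ofReal_mul, Complex.ofReal_mul, hns, hns]
  by_cases hij : i = j
  · subst hij
    -- Six of the sixteen sign patterns on a single mode have sum zero.
    have hA : Acoef m i i = 6 * Gcoef m i i := by
      rw [Acoef, if_pos rfl, Gcoef]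
      ring
    rw [hA]
    simp only [Fintype.sum_prod_type, Fintype.sum_bool, QIdx.midx, mon_add, mon_single, if_true,
      Bool.false_eq_true, if_false, QIdx.equivProd, Equiv.coe_fn_mk, QIdx.Integrable, sgn]
    norm_num
    ring
  · have hA : Acoef m i j = 4 * Gcoef m i j := by
      rw [Acoef, if_neg hij, Gcoef]
      ring
    rw [hA]
    simp only [Fintype.sum_prod_type, Fintype.sum_bool, QIdx.midx, mon_add, mon_single, if_true,
      Bool.false_eq_true, if_false, QIdx.equivProd, Equiv.coe_fn_mk, QIdx.Integrable, sgn, hij]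
    norm_num [hij]
    ring

/-! ### The generating function of the quartic step -/

theorem QIdx.finite_fiber (p : MIdx) : {q : QIdx | q.midx = p}.Finite := by
  classical
  refine (Set.toFinite (QIdx.equivProd '' ((((p.1 + p.2).support ×ˢ (p.1 + p.2).support) ×ˢ
    (Finset.univ : Finset (Bool × Bool × Bool × Bool)) : Finset _) : Set _))).subset ?_
  rintro q rfl
  refine ⟨QIdx.equivProd.symm q, ?_, Equiv.apply_symm_apply _ _⟩
  have h1 : q.i ∈ (q.midx.1 + q.midx.2).support := by
    rw [q.fst_add_snd]
    simp
  have h2 : q.j ∈ (q.midx.1 + q.midx.2).support := by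
    rw [q.fst_add_snd]
    simp
  simp only [Finset.coe_product, Set.mem_prod, Finset.mem_coe, Finset.mem_univ, and_true]
  exact ⟨h1, h2⟩

-- The divisor is a function of the monomial, so it factors out of the finite sum over the
-- representations of the monomial; what remains is the coefficient of `G`.
open Classical in
theorem S4_apply (m : ℝ) (p : MIdx) :
    S4 m p = if p.1 = p.2 then 0 else Complex.I * quarticHam m p / (divisor m p : ℂ) := by
  rw [S4]
  simp_rw [finsum_eq_if]
  split_ifs with h
  · have : ∀ q : QIdx, ¬ (q.midx = p ∧ ¬ q.Integrable) := by
      rintro q ⟨rfl, hq⟩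
      exact hq (q.integrable_iff.2 h)
    simp [this]
  · have e : ∀ q : QIdx, (if q.midx = p ∧ ¬ q.Integrable then
        Complex.I * (Gcoef m q.i q.j : ℂ) / (q.Delta m : ℂ) else 0) =
        (Complex.I / (divisor m p : ℂ)) * if q.midx = p then (Gcoef m q.i q.j : ℂ) else 0 := by
      intro q
      by_cases hq : q.midx = p
      · have hi : ¬ q.Integrable := fun hi => h (hq ▸ q.integrable_iff.1 hi)
        rw [if_pos ⟨hq, hi⟩, if_pos hq, ← hq, QIdx.divisor_midx]
        ring
      · rw [if_neg fun hq' => hq hq'.1, if_neg hq, mul_zero]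
    simp_rw [e]
    rw [← tsum_eq_finsum (L := SummationFilter.unconditional QIdx), tsum_mul_left, quarticHam, push]
    · ring
    · refine (QIdx.finite_fiber p).subset fun q hq => ?_
      by_contra hq'
      exact hq (mul_eq_zero_of_right _ (if_neg hq'))

theorem mu_le_abs_divisor {m : ℝ} {p : MIdx} (hp : quarticHam m p ≠ 0) (h : p.1 ≠ p.2) :
    mu m ≤ |divisor m p| := by
  obtain ⟨q, rfl, -⟩ := exists_of_push_ne_zero hp
  rw [QIdx.divisor_midx]
  exact q.mu_le_abs_Delta fun hi => h (q.integrable_iff.1 hi)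

theorem quarticHam_ne_zero_of_S4 {m : ℝ} {p : MIdx} (hp : S4 m p ≠ 0) : quarticHam m p ≠ 0 := by
  intro h
  rw [S4_apply, h] at hp
  simp at hp

theorem good_S4 (m : ℝ) : Good (S4 m) where
  real α β := by
    rw [S4_apply, S4_apply]
    by_cases h : α = β
    · simp [h]
    · simp only [h, Ne.symm h, if_false, map_div₀, map_mul, Complex.conj_I, Complex.conj_ofReal,
        divisor_swap m α β, ← (good_quarticHam m).real α β]
      push_cast
      rw [div_neg, neg_mul, neg_div, neg_neg]
  even p hp := (good_quarticHam m).even p (quarticHam_ne_zero_of_S4 hp)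
  zero := by
    rw [S4_apply]
    simp

theorem enorm_S4_le {m : ℝ} (hm : -1 / 2 ≤ m) (p : MIdx) :
    ‖S4 m p‖ₑ ≤ ENNReal.ofReal (mu m)⁻¹ * ‖quarticHam m p‖ₑ := by
  have hmu := mu_pos hm
  rw [← ofReal_norm, ← ofReal_norm, ← ENNReal.ofReal_mul (by positivity)]
  refine ENNReal.ofReal_le_ofReal ?_
  by_cases hp : quarticHam m p = 0
  · simp [S4_apply, hp]
  rw [S4_apply]
  split_ifs with h
  · simp only [norm_zero]
    positivity
  · have h1 := mu_le_abs_divisor hp h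
    rw [norm_div, norm_mul, Complex.norm_I, one_mul, Complex.norm_real, Real.norm_eq_abs,
      div_eq_inv_mul]
    gcongr

theorem bracket_S4_lamHam {m : ℝ} (hm : -1 / 2 ≤ m) :
    bracket (S4 m) (lamHam m) = fun p => diagPart (quarticHam m) p - quarticHam m p := by
  funext p
  rw [bracket_lamHam, S4_apply, diagPart]
  by_cases hp : quarticHam m p = 0
  · simp [hp]
  split_ifs with h
  · simp
  · have h1 : (divisor m p : ℂ) ≠ 0 := by
      have := (mu_pos hm).trans_le (mu_le_abs_divisor hp h)
      exact_mod_cast abs_pos.1 this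
    rw [zero_sub, mul_div_assoc', div_eq_iff h1]
    linear_combination (divisor m p : ℂ) * quarticHam m p * Complex.I_mul_I

/-! ### The constant `γ_r` -/

theorem gam_nonneg (m : ℝ) (w : Weight) (R : ℝ) : 0 ≤ gam m w R :=
  Real.iSup_nonneg fun _ => Real.sqrt_nonneg _

theorem sqrt_le_gam {m : ℝ} (hm : -1 / 2 ≤ m) {w : Weight} {R : ℝ} {z : HSpace w}
    (hz : z ∈ ball w R) : √(∑' j, acoef m j * ‖z j‖ ^ 2) ≤ gam m w R := by
  obtain ⟨C, hC, h⟩ := exists_tsum_acoef_mul_le hm w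
  refine le_ciSup (f := fun z : ball w R => √(∑' j, acoef m j * ‖(z : HSpace w) j‖ ^ 2))
    ⟨√(C * R ^ 2), ?_⟩ ⟨z, hz⟩
  rintro _ ⟨y, rfl⟩
  refine Real.sqrt_le_sqrt ((h y).2.trans ?_)
  have h1 : ‖(y : HSpace w)‖ ≤ R := mem_closedBall_zero_iff.1 y.2
  gcongr

/-- Scaling by `s⁻¹` maps one ball into the other. It is used to control `γ` at radius `11r/10` by
`11/10` times its value at `r`. -/
theorem gam_mul_le {m : ℝ} (hm : -1 / 2 ≤ m) (w : Weight) {s R : ℝ} (hs : 0 < s) (hR : 0 ≤ R) :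
    gam m w (s * R) ≤ s * gam m w R := by
  have : Nonempty (ball w (s * R)) :=
    ⟨⟨0, Metric.mem_closedBall_self (mul_nonneg hs.le hR)⟩⟩
  refine ciSup_le fun z => ?_
  obtain ⟨z, hz⟩ := z
  have hz' : ((s⁻¹ : ℝ) : ℂ) • z ∈ ball w R := by
    rw [mem_closedBall_zero_iff] at hz ⊢
    rw [norm_smul, Complex.norm_real, Real.norm_of_nonneg (by positivity),
      inv_mul_le_iff₀ hs]
    exact hz
  have h1 := mul_le_mul_of_nonneg_left (sqrt_le_gam hm hz') hs.le
  refine le_trans (le_of_eq ?_) h1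
  have e : ∀ j, acoef m j * ‖(((s⁻¹ : ℝ) : ℂ) • z) j‖ ^ 2 =
      (s⁻¹) ^ 2 * (acoef m j * ‖z j‖ ^ 2) := by
    intro j
    have : (((s⁻¹ : ℝ) : ℂ) • z) j = ((s⁻¹ : ℝ) : ℂ) * z j := rfl
    rw [this, norm_mul, Complex.norm_real, Real.norm_of_nonneg (by positivity)]
    ring
  rw [tsum_congr e, tsum_mul_left, Real.sqrt_mul (by positivity), Real.sqrt_sq (by positivity),
    ← mul_assoc, mul_inv_cancel₀ hs.ne', one_mul]
  rfl

theorem tsum_ofReal_acoef_le {m : ℝ} (hm : -1 / 2 ≤ m) {w : Weight} {R : ℝ} (hR : 0 ≤ R)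
    {x : ℕ+ → ℝ≥0∞} (hx : wn w x ≤ ENNReal.ofReal R) :
    ∑' j, ENNReal.ofReal (acoef m j) * x j ^ 2 ≤ ENNReal.ofReal (gam m w R ^ 2) := by
  have hlt : wn w x < ⊤ := hx.trans_lt ENNReal.ofReal_lt_top
  have hxt := lt_top_of_wn_lt_top w hlt
  obtain ⟨y, hy⟩ : ∃ y : ℕ+ → ℂ, absSeq y = x := by
    refine ⟨fun j => (((x j).toReal : ℝ) : ℂ), funext fun j => ?_⟩
    rw [absSeq, enorm_ofReal' ENNReal.toReal_nonneg, ENNReal.ofReal_toReal (hxt j).ne]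
  obtain ⟨z, hzx⟩ : ∃ z : HSpace w, absSeq z = x :=
    ⟨⟨y, mem_hSub_of_wn_lt_top w (by rwa [hy])⟩, hy⟩
  have hzb : z ∈ ball w R := by
    rw [mem_ball_iff_enorm hR, ← wn_absSeq, hzx]
    exact hx
  have h1 := sqrt_le_gam hm hzb
  have h0 : 0 ≤ ∑' j, acoef m j * ‖z j‖ ^ 2 :=
    tsum_nonneg fun j => mul_nonneg (acoef_nonneg m j) (by positivity)
  rw [Real.sqrt_le_left (gam_nonneg m w R)] at h1
  refine le_trans (le_of_eq ?_) (ENNReal.ofReal_le_ofReal h1)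
  rw [ENNReal.ofReal_tsum_of_nonneg (fun j => mul_nonneg (acoef_nonneg m j) (by positivity))
    (summable_acoef_mul hm z)]
  refine tsum_congr fun j => ?_
  rw [ENNReal.ofReal_mul (acoef_nonneg m j), ENNReal.ofReal_pow (norm_nonneg _), ofReal_norm,
    ← hzx]
  rfl

theorem fldSup_quarticHam_le {m : ℝ} (hm : -1 / 2 ≤ m) (w : Weight) {R : ℝ} (hR : 0 ≤ R) :
    fldSup w (ENNReal.ofReal R) (quarticHam m) ≤
      ENNReal.ofReal (cfrak m / Real.pi * gam m w R ^ 2 * R) := by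
  refine iSup₂_le fun x hx => ?_
  have hc := (cfrak_pos hm).le
  have h1 : ∀ k, fld (quarticHam m) x k ≤
      ENNReal.ofReal (cfrak m / Real.pi * gam m w R ^ 2) * x k := fun k => by
    refine (fld_quarticHam_le m x k).trans (mul_le_mul_left ?_ _)
    rw [ENNReal.ofReal_mul (p := cfrak m / Real.pi) (by positivity)]
    refine mul_le_mul' (ENNReal.ofReal_le_ofReal ?_) (tsum_ofReal_acoef_le hm hR hx)
    rw [one_div, ← div_eq_inv_mul]
    gcongr
    exact acoef_le_cfrak hm k
  rw [ENNReal.ofReal_mul (by positivity)]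
  exact (wn_mono w h1).trans ((wn_smul w _ x).le.trans (mul_le_mul_right hx _))

/-! ### Small divisors of order six -/

theorem omega_le {m : ℝ} (hm : -1 / 2 ≤ m) (j : ℕ+) : omega m j ≤ (j : ℝ) ^ 2 + m / 2 := by
  have h := one_le_pnat j
  rw [omega]
  refine Real.sqrt_le_iff.2 ⟨by nlinarith, ?_⟩
  nlinarith [sq_nonneg m]

/-- In the expansion `ω_j = j² + m/2 - m²/(8j²) + …` the constant `1/8` is relaxed to `1/5`, which
absorbs the higher terms for `-1/2 ≤ m ≤ 1`. The parameter `u` allows a uniform error for all `j² ≥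
u`. -/
theorem le_omega {m : ℝ} (hm : -1 / 2 ≤ m) (hm1 : m ≤ 1) (j : ℕ+) {u : ℝ} (hu : 1 ≤ u)
    (huj : u ≤ (j : ℝ) ^ 2) : (j : ℝ) ^ 2 + m / 2 - m ^ 2 / 5 / u ≤ omega m j := by
  have hv : 1 ≤ (j : ℝ) ^ 2 := hu.trans huj
  have hd : m ^ 2 / 5 / (j : ℝ) ^ 2 ≤ m ^ 2 / 5 / u := by gcongr
  suffices h : (j : ℝ) ^ 2 + m / 2 - m ^ 2 / 5 / (j : ℝ) ^ 2 ≤ omega m j by linarith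
  refine Real.le_sqrt_of_sq_le ?_
  have hdv : m ^ 2 / 5 / (j : ℝ) ^ 2 * (j : ℝ) ^ 2 = m ^ 2 / 5 := by field_simp
  have hd0 : 0 ≤ m ^ 2 / 5 / (j : ℝ) ^ 2 := by positivity
  rw [show (j : ℝ) ^ 4 = ((j : ℝ) ^ 2) ^ 2 by ring]
  generalize (j : ℝ) ^ 2 = v at *
  generalize m ^ 2 / 5 / v = d at *
  have hd1 : d ≤ m ^ 2 / 5 := by nlinarith
  have hm2 : m ^ 2 ≤ 1 := by nlinarith
  nlinarith [mul_nonneg hd0 (by linarith : 0 ≤ 1 / 5 - d), mul_nonneg hd0 (by linarith : 0 ≤ m + 1 / 2)]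

/-- The numerical margins in `abs_le_abs_three_wave`, for `i² + j²` greater than, less than and
equal to `k²`, respectively. -/
theorem abs_mul_le_quarter {m : ℝ} (hm : -1 / 2 ≤ m) (hm1 : m ≤ 1) :
    7 * |m| / 16 ≤ 1 + m / 2 - 2 * m ^ 2 / 5 ∧ 7 * |m| / 16 ≤ 1 - m / 2 - m ^ 2 / 20 ∧
      m ^ 2 ≤ |m| := by
  rcases abs_cases m with ⟨h, h0⟩ | ⟨h, h0⟩ <;> rw [h]
  · exact ⟨by nlinarith, by nlinarith, by nlinarith⟩
  · exact ⟨by nlinarith, by nlinarith, by nlinarith⟩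

theorem abs_le_omega {m : ℝ} (hm : -1 / 2 ≤ m) (hm1 : m ≤ 1) (j : ℕ+) :
    7 * |m| / 16 ≤ omega m j := by
  have hj := one_le_pnat j
  have h1 := le_omega hm hm1 j le_rfl (by nlinarith)
  rw [div_one] at h1
  nlinarith [(abs_mul_le_quarter hm hm1).1, sq_nonneg m]

theorem abs_le_abs_omega_sub {m : ℝ} (hm : -1 / 2 ≤ m) (hm1 : m ≤ 1) {i j : ℕ+} (h : i ≠ j) :
    7 * |m| / 16 ≤ |omega m i - omega m j| := by
  have h1 : 7 * |m| / 16 ≤ √(4 + m) := by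
    refine Real.le_sqrt_of_sq_le ?_
    have : |m| ≤ 1 := abs_le.2 ⟨by linarith, hm1⟩
    nlinarith [abs_nonneg m]
  rcases lt_or_gt_of_ne h with h | h
  · rw [abs_sub_comm]
    exact (h1.trans (sqrt_four_add_le_omega_sub h)).trans (le_abs_self _)
  · exact (h1.trans (sqrt_four_add_le_omega_sub h)).trans (le_abs_self _)

/-- No Pythagorean triple has a leg `1` or `2`, as neither `1` nor `4` is a difference of two
positive squares. Legs of at least `3` make the error terms in the frequencies small. -/
theorem three_le_of_sq_add_sq_eq {i j k : ℕ} (hi : 0 < i) (hj : 0 < j)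
    (h : i ^ 2 + j ^ 2 = k ^ 2) : 3 ≤ i := by
  by_contra! hlt
  have hjk : j + 1 ≤ k := by nlinarith
  interval_cases i
  · nlinarith
  · rcases (by omega : k = j + 1 ∨ j + 2 ≤ k) with rfl | h2
    · have : 3 = 2 * j := by nlinarith
      omega
    · nlinarith

/-- The combination is `i² + j² - k² + m/2` up to errors of order `m²`. A nonzero integer dominates
the rest. For a Pythagorean triple `m/2` remains, and the errors are at most `2m²/45` because all
indices are at least `3`. -/
theorem abs_le_abs_three_wave {m : ℝ} (hm : -1 / 2 ≤ m) (hm1 : m ≤ 1) (i j k : ℕ+) :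
    7 * |m| / 16 ≤ |omega m i + omega m j - omega m k| := by
  have hi := one_le_pnat i
  have hj := one_le_pnat j
  have hk := one_le_pnat k
  obtain ⟨q1, q2, q3⟩ := abs_mul_le_quarter hm hm1
  have ui := omega_le hm i
  have uj := omega_le hm j
  have uk := omega_le hm k
  rcases lt_trichotomy ((i : ℕ) ^ 2 + (j : ℕ) ^ 2) ((k : ℕ) ^ 2) with h | h | h
  · have h1 : (i : ℝ) ^ 2 + (j : ℝ) ^ 2 + 1 ≤ (k : ℝ) ^ 2 := by exact_mod_cast h
    have hk2 : (2 : ℝ) ≤ k := by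
      have : 2 ≤ (k : ℕ) := by
        have := i.pos
        have := j.pos
        nlinarith
      exact_mod_cast this
    have lk := le_omega hm hm1 k (u := 4) (by norm_num) (by nlinarith)
    rw [le_abs]
    right
    linarith
  · have hi3 := three_le_of_sq_add_sq_eq i.pos j.pos h
    have hj3 := three_le_of_sq_add_sq_eq j.pos i.pos ((add_comm _ _).trans h)
    have hi3' : (3 : ℝ) ≤ i := by exact_mod_cast hi3
    have hj3' : (3 : ℝ) ≤ j := by exact_mod_cast hj3
    have h1 : (i : ℝ) ^ 2 + (j : ℝ) ^ 2 = (k : ℝ) ^ 2 := by exact_mod_cast h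
    have li := le_omega hm hm1 i (u := 9) (by norm_num) (by nlinarith)
    have lj := le_omega hm hm1 j (u := 9) (by norm_num) (by nlinarith)
    have lk := le_omega hm hm1 k (u := 9) (by norm_num) (by nlinarith)
    rw [le_abs]
    rcases abs_cases m with ⟨h2, h0⟩ | ⟨h2, h0⟩ <;> rw [h2] at q3 ⊢
    · left
      linarith
    · right
      linarith
  · have h1 : (k : ℝ) ^ 2 + 1 ≤ (i : ℝ) ^ 2 + (j : ℝ) ^ 2 := by exact_mod_cast h
    have li := le_omega hm hm1 i le_rfl (by nlinarith)
    have lj := le_omega hm hm1 j le_rfl (by nlinarith)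
    rw [div_one] at li lj
    rw [le_abs]
    left
    linarith

/-- An integer combination of at most three frequencies with coefficients `0, ±2` is bounded away
from zero unless it is trivial. -/
theorem abs_le_abs_of_signs {m : ℝ} (hm : -1 / 2 ≤ m) (hm1 : m ≤ 1) (i j k : ℕ+) {a b c : ℤ}
    (ha : a = 0 ∨ a = 2 ∨ a = -2) (hb : b = 0 ∨ b = 2 ∨ b = -2) (hc : c = 0 ∨ c = 2 ∨ c = -2) :
    (∀ l, (if i = l then a else 0) + (if j = l then b else 0) + (if k = l then c else 0) = 0) ∨
      7 * |m| / 8 ≤ |(a : ℝ) * omega m i + b * omega m j + c * omega m k| := by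
  have w1 := abs_le_abs_three_wave hm hm1 i j k
  have w2 := abs_le_abs_three_wave hm hm1 i k j
  have w3 := abs_le_abs_three_wave hm hm1 j k i
  have oi := abs_le_omega hm hm1 i
  have oj := abs_le_omega hm hm1 j
  have ok := abs_le_omega hm hm1 k
  have h0 := abs_nonneg m
  have pair : ∀ i j : ℕ+, i = j ∨ 7 * |m| / 16 ≤ omega m i - omega m j ∨
      7 * |m| / 16 ≤ omega m j - omega m i := by
    intro i j
    by_cases h : i = j
    · exact Or.inl h
    · have := abs_le_abs_omega_sub hm hm1 h
      rw [le_abs, neg_sub] at this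
      exact Or.inr this
  rw [le_abs] at w1 w2 w3
  rw [le_abs]
  -- Up to sign, the 27 patterns are: all zero, all of one sign, two against one (three-wave
  -- bounds), and a difference of two frequencies, which vanishes identically when the indices
  -- coincide.
  rcases ha with rfl | rfl | rfl <;> rcases hb with rfl | rfl | rfl <;>
    rcases hc with rfl | rfl | rfl <;> push_cast <;>
    first
    | (left; intro l; simp; done)
    | (right; left; linarith)
    | (right; right; linarith)
    | (right; rcases w1 with w1 | w1 <;> first | (left; linarith) | (right; linarith))
    | (right; rcases w2 with w1 | w1 <;> first | (left; linarith) | (right; linarith))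
    | (right; rcases w3 with w1 | w1 <;> first | (left; linarith) | (right; linarith))
    | (rcases pair i j with rfl | w1 | w1 <;> first
        | (left; intro l; split_ifs <;> rfl) | (right; left; linarith) | (right; right; linarith))
    | (rcases pair i k with rfl | w1 | w1 <;> first
        | (left; intro l; split_ifs <;> rfl) | (right; left; linarith) | (right; right; linarith))
    | (rcases pair j k with rfl | w1 | w1 <;> first
        | (left; intro l; split_ifs <;> rfl) | (right; left; linarith) | (right; right; linarith))

theorem exists_eq_single_add {p : MIdx} {j : ℕ+} (h : p.1 j + p.2 j ≠ 0) :
    ∃ s p', p = single j s + p' := by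
  have key : ∀ n : ℕ+ →₀ ℕ, n j ≠ 0 → Finsupp.single j 1 + (n - Finsupp.single j 1) = n :=
    fun n hn => add_tsub_cancel_of_le (Finsupp.single_le_iff.2 (Nat.one_le_iff_ne_zero.2 hn))
  by_cases h1 : p.1 j = 0
  · refine ⟨false, (p.1, p.2 - Finsupp.single j 1), Prod.ext ?_ ?_⟩
    · simp [single]
    · simp [single, key p.2 (by omega)]
  · refine ⟨true, (p.1 - Finsupp.single j 1, p.2), Prod.ext ?_ ?_⟩
    · simp [single, key p.1 h1]
    · simp [single]

theorem deg_single (i : ℕ+) (s : Bool) : deg (single i s) = 1 := by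
  rw [deg_eq, ← map_add, single_fst_add_snd, Finsupp.degree_single]

/-- Two factors with the same index can be split off, and parity is inherited by the rest. Used
three times, this writes a sextic monomial as three pairs, each contributing `0` or `±2` times one
frequency. -/
theorem exists_eq_single_add_single_add {p : MIdx} (he : ∀ j, Even (p.1 j + p.2 j)) {n : ℕ}
    (hd : deg p = n + 2) : ∃ l s s' p', p = single l s + (single l s' + p') ∧
      (∀ j, Even (p'.1 j + p'.2 j)) ∧ deg p' = n := by
  obtain ⟨l, hl⟩ : ∃ l, p.1 l + p.2 l ≠ 0 := by
    by_contra! h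
    have h0 : p.1 + p.2 = 0 := Finsupp.ext h
    rw [deg_eq, ← map_add, h0, map_zero] at hd
    omega
  have hs : ∀ s k, (single l s).1 k + (single l s).2 k = if l = k then 1 else 0 := fun s k => by
    rw [← Finsupp.add_apply, single_fst_add_snd, Finsupp.single_apply]
  obtain ⟨s, p1, rfl⟩ := exists_eq_single_add hl
  have h1 := he l
  have h2 := hs s l
  simp only [Prod.fst_add, Prod.snd_add, Finsupp.add_apply, if_true] at h1 h2
  obtain ⟨s', p2, rfl⟩ := exists_eq_single_add (p := p1) (j := l) (by
    rcases h1 with ⟨c, hc⟩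
    omega)
  refine ⟨l, s, s', p2, rfl, fun k => ?_, ?_⟩
  · obtain ⟨c, hc⟩ := he k
    have h3 := hs s k
    have h4 := hs s' k
    simp only [Prod.fst_add, Prod.snd_add, Finsupp.add_apply] at hc
    split_ifs at h3 h4
    · exact ⟨c - 1, by omega⟩
    · exact ⟨c, by omega⟩
  · rw [deg_add, deg_add, deg_single, deg_single] at hd
    omega

theorem abs_le_abs_divisor {m : ℝ} (hm : -1 / 2 ≤ m) (hm1 : m ≤ 1) {p : MIdx}
    (he : ∀ j, Even (p.1 j + p.2 j)) (hd : deg p = 6) (hp : p.1 ≠ p.2) :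
    7 * |m| / 8 ≤ |divisor m p| := by
  obtain ⟨i, s₁, t₁, p₁, rfl, he₁, hd₁⟩ := exists_eq_single_add_single_add he hd
  obtain ⟨j, s₂, t₂, p₂, rfl, he₂, hd₂⟩ := exists_eq_single_add_single_add he₁ hd₁
  obtain ⟨k, s₃, t₃, p₃, rfl, he₃, hd₃⟩ := exists_eq_single_add_single_add he₂ hd₂
  have h0 : p₃ = 0 := by
    rw [deg_eq] at hd₃
    have h1 : p₃.1.degree = 0 := by omega
    have h2 : p₃.2.degree = 0 := by omega
    exact Prod.ext ((Finsupp.degree_eq_zero_iff _).1 h1) ((Finsupp.degree_eq_zero_iff _).1 h2)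
  subst h0
  rcases abs_le_abs_of_signs hm hm1 i j k (sgn_add_cases s₁ t₁) (sgn_add_cases s₂ t₂)
    (sgn_add_cases s₃ t₃) with h | h
  · refine absurd (Finsupp.ext fun l => ?_) hp
    have e := h l
    have a1 := single_fst_sub_snd i s₁ l
    have a2 := single_fst_sub_snd i t₁ l
    have a3 := single_fst_sub_snd j s₂ l
    have a4 := single_fst_sub_snd j t₂ l
    have a5 := single_fst_sub_snd k s₃ l
    have a6 := single_fst_sub_snd k t₃ l
    simp only [Prod.fst_add, Prod.snd_add, Finsupp.add_apply, add_zero]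
    split_ifs at * <;> omega
  · convert h using 2
    simp only [divisor_add, divisor_single, add_zero]
    push_cast
    ring

/-! ### Linear operations on Hamiltonians -/

theorem Good.add {f g : Ham} (hf : Good f) (hg : Good g) : Good fun p => f p + g p where
  real α β := by rw [map_add, ← hf.real, ← hg.real]
  even p hp := by
    by_cases h : f p = 0
    · exact hg.even p fun h' => hp (by simp only [h, h', add_zero])
    · exact hf.even p h
  zero := by rw [hf.zero, hg.zero, add_zero]

theorem Good.neg {f : Ham} (hf : Good f) : Good fun p => -f p where
  real α β := by rw [map_neg, ← hf.real]
  even p hp := hf.even p fun h => hp (by simp only [h, neg_zero])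
  zero := by rw [hf.zero, neg_zero]

theorem Good.ite {f : Ham} (hf : Good f) (s : MIdx → Prop) [DecidablePred s]
    (hs : ∀ α β, s (α, β) → s (β, α)) : Good fun p => if s p then f p else 0 where
  real α β := by
    by_cases h : s (α, β)
    · rw [if_pos h, if_pos (hs _ _ h), ← hf.real]
    · rw [if_neg h, if_neg fun h' => h (hs _ _ h'), map_zero]
  even p hp := hf.even p fun h => hp (by simp only [h, ite_self])
  zero := by rw [hf.zero, ite_self]

theorem Good.even_deg {f : Ham} (hf : Good f) {p : MIdx} (hp : f p ≠ 0) : Even (deg p) := by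
  rw [deg_eq, ← map_add]
  exact Finset.even_sum _ fun j _ => hf.even p hp j

theorem deg_swap (α β : ℕ+ →₀ ℕ) : deg (β, α) = deg (α, β) := add_comm _ _

theorem eval_add {f g : Ham} {z : ℕ+ → ℂ} (hf : Summable fun p => f p * mon p z)
    (hg : Summable fun p => g p * mon p z) :
    Ham.eval (fun p => f p + g p) z = f.eval z + g.eval z := by
  rw [Ham.eval, Ham.eval, Ham.eval, ← hf.tsum_add hg]
  exact tsum_congr fun p => add_mul _ _ _

theorem fldSup_le_of_enorm_le (w : Weight) {R : ℝ≥0∞} {f g : Ham} (h : ∀ p, ‖f p‖ₑ ≤ ‖g p‖ₑ) :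
    fldSup w R f ≤ fldSup w R g := by
  have := fldSup_le_mul w (R := R) (f := f) (g := g) 1 fun p => by rw [one_mul]; exact h p
  rwa [one_mul] at this

/-! ### Degrees and norms of remainders -/

theorem le_deg_of_adPow_ne_zero {F K : Ham} {a b : ℕ} (hF : ∀ p, F p ≠ 0 → a + 2 ≤ deg p)
    (hK : ∀ p, K p ≠ 0 → b ≤ deg p) (k : ℕ) {P : MIdx} (hP : adPow F K k P ≠ 0) :
    b + k * a ≤ deg P := by
  induction k generalizing P with
  | zero => simpa using hK P hP
  | succ k ih =>
    rw [adPow_succ] at hP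
    obtain ⟨p, q, hp, hq, h⟩ := exists_deg_of_bracket_ne_zero hP
    have h1 := ih hq
    have h2 := hF p hp
    rw [add_mul]
    omega

theorem le_deg_of_lieTerm_ne_zero {F K N : Ham} {a b : ℕ} (hF : ∀ p, F p ≠ 0 → a + 2 ≤ deg p)
    (hK : ∀ p, K p ≠ 0 → b ≤ deg p) (hN : ∀ p, N p ≠ 0 → b ≤ deg p) {k : ℕ} {P : MIdx}
    (hP : lieTerm F K N k P ≠ 0) : b + (k + 1) * a ≤ deg P := by
  by_cases h : adPow F K (k + 1) P = 0
  · refine le_deg_of_adPow_ne_zero hF hN (k + 1) fun h' => hP ?_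
    rw [lieTerm, h, h', zero_div, zero_div, add_zero]
  · exact le_deg_of_adPow_ne_zero hF hK (k + 1) h

theorem le_deg_of_lieRem_ne_zero {F K N : Ham} {a b : ℕ} (hF : ∀ p, F p ≠ 0 → a + 2 ≤ deg p)
    (hK : ∀ p, K p ≠ 0 → b ≤ deg p) (hN : ∀ p, N p ≠ 0 → b ≤ deg p) {P : MIdx}
    (hP : lieRem F K N P ≠ 0) : b + a ≤ deg P := by
  obtain ⟨k, hk⟩ : ∃ k, lieTerm F K N k P ≠ 0 := by
    by_contra! h
    exact hP ((tsum_congr h).trans tsum_zero)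
  have := le_deg_of_lieTerm_ne_zero hF hK hN hk
  nlinarith [Nat.zero_le (k * a)]

theorem deg_of_lieTerm_zero_ne_zero {F K N : Ham} {a b : ℕ} (hF : ∀ p, F p ≠ 0 → deg p = a)
    (hK : ∀ p, K p ≠ 0 → deg p = b) (hN : ∀ p, N p ≠ 0 → deg p = b) {P : MIdx}
    (hP : lieTerm F K N 0 P ≠ 0) : deg P + 2 = a + b := by
  by_cases h : adPow F K 1 P = 0
  · have h' : bracket F N P ≠ 0 := fun h' => hP <| by
      have h'' : adPow F N 1 P = 0 := h'
      rw [lieTerm, zero_add, h, h'', zero_div, zero_div, add_zero]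
    obtain ⟨p, q, hp, hq, e⟩ := exists_deg_of_bracket_ne_zero h'
    rw [e, hF p hp, hN q hq]
  · obtain ⟨p, q, hp, hq, e⟩ := exists_deg_of_bracket_ne_zero (F := F) (K := K) h
    rw [e, hF p hp, hK q hq]

/-- Geometric tail of the Lie series from index `n` on: `n = 0` bounds the whole remainder, `n = 1`
bounds it without its leading term. -/
theorem fldSup_le_of_le_tsum_lieTerm (w : Weight) {R ρ : ℝ≥0∞} {F K N f : Ham} (hF : Good F)
    (hK : Good K) (hN : Good N) (hρ : ρ ≠ 0) (hρ' : ρ ≠ ⊤) {q B b c : ℝ} (hq : 0 ≤ q) (hq1 : q < 1)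
    (hb : 0 ≤ b) (hc : 0 ≤ c) (hB : b + c / 2 = B)
    (hFfin : fldSup w (R + ρ) F ≠ ⊤)
    (hratio : lieRatio w R ρ F ≤ ENNReal.ofReal (q / Real.exp 1))
    (hKb : fldSup w (R + ρ) K ≤ ENNReal.ofReal b) (hNc : fldSup w (R + ρ) N ≤ ENNReal.ofReal c)
    (n : ℕ) (hf : ∀ p, ‖f p‖ₑ ≤ ∑' k, ‖lieTerm F K N (k + n) p‖ₑ) :
    fldSup w R f ≤ ENNReal.ofReal (q / Real.exp 1 * (q ^ n / (1 - q)) * B) := by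
  have he := Real.exp_pos 1
  have hB0 : 0 ≤ B := by linarith
  have hterm : ∀ k, fldSup w R (lieTerm F K N k) ≤
      ENNReal.ofReal (q / Real.exp 1 * q ^ k * B) := fun k => by
    refine (fldSup_lieTerm_le w hF hK hN hρ hρ' hFfin (ne_top_of_le_ne_top ENNReal.ofReal_ne_top hKb)
      (ne_top_of_le_ne_top ENNReal.ofReal_ne_top hNc) k).trans ?_
    rw [ENNReal.ofReal_mul (by positivity), ENNReal.ofReal_mul (by positivity),
      ENNReal.ofReal_pow hq]
    refine mul_le_mul' (mul_le_mul' hratio (pow_le_pow_left' ?_ k)) ?_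
    · refine (mul_le_mul_right hratio _).trans (le_of_eq ?_)
      rw [← ENNReal.ofReal_mul he.le, mul_div_cancel₀ _ he.ne']
    · rw [← hB, ENNReal.ofReal_add hb (by positivity), div_eq_inv_mul,
        ENNReal.ofReal_mul (by norm_num), ENNReal.ofReal_inv_of_pos two_pos,
        ENNReal.ofReal_ofNat]
      gcongr
  have h1 := fldSup_tsum_le w (R := R) (f := f) (g := fun k => lieTerm F K N (k + n))
    (fun _ => 1) fun p => by simpa using hf p
  refine h1.trans ?_
  simp only [one_mul]
  refine (ENNReal.tsum_le_tsum fun k => hterm (k + n)).trans (le_of_eq ?_)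
  have hs : HasSum (fun k : ℕ => q / Real.exp 1 * q ^ (k + n) * B)
      (q / Real.exp 1 * (q ^ n / (1 - q)) * B) := by
    have := ((hasSum_geometric_of_lt_one hq hq1).mul_left (q / Real.exp 1 * q ^ n * B))
    have e1 : (fun k : ℕ => q / Real.exp 1 * q ^ (k + n) * B) =
        fun k => q / Real.exp 1 * q ^ n * B * q ^ k := by
      funext k
      rw [pow_add]
      ring
    have e2 : q / Real.exp 1 * (q ^ n / (1 - q)) * B =
        q / Real.exp 1 * q ^ n * B * (1 - q)⁻¹ := by
      rw [div_eq_mul_inv (q ^ n)]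
      ring
    rw [e1, e2]
    exact this
  rw [← ENNReal.ofReal_tsum_of_nonneg (fun k => by positivity) hs.summable, hs.tsum_eq]

/-! ### Hamiltonian flows -/

theorem isHamFlow_of_hasDerivWithinAt {w : Weight} {F : Ham} {r ρ d : ℝ} (hr : 0 ≤ r) (hd : 0 ≤ d)
    (hdρ : d ≤ ρ) (hF : fldSup w (ENNReal.ofReal (r + ρ)) F < ⊤) {Φ : ℝ → HSpace w → HSpace w}
    (h : ∀ z ∈ ball w r, Φ 0 z = z ∧ (∀ t ∈ Set.Icc (-1 : ℝ) 1, HasDerivWithinAt (fun s => Φ s z)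
      (vf w F (Φ t z)) (Set.Icc (-1) 1) t) ∧ ∀ t, ‖Φ t z - z‖ ≤ d) : IsHamFlow w F r ρ Φ := by
  intro z hz
  obtain ⟨h0, hder, hdist⟩ := h z hz
  refine ⟨h0, fun t ht => ?_⟩
  have hmem : Φ t z ∈ ball w (r + ρ) := by
    rw [mem_closedBall_zero_iff] at hz ⊢
    have := norm_le_norm_add_norm_sub' (Φ t z) z
    have := hdist t
    linarith
  refine ⟨hmem, vf w F (Φ t z), fun j => vf_apply ?_ j, hder t ht⟩
  have h1 := (mem_ball_iff_enorm (by linarith)).1 hmem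
  rw [← wn_absSeq] at h1
  exact (wn_fld_le w F h1).trans_lt hF

theorem lieRatio_le {w : Weight} {F : Ham} {r ρ d : ℝ} (hr : 0 ≤ r) (hρ : 0 < ρ)
    (hF : fldSup w (ENNReal.ofReal (r + ρ)) F ≤ ENNReal.ofReal d) :
    lieRatio w (ENNReal.ofReal r) (ENNReal.ofReal ρ) F ≤ ENNReal.ofReal (2 / ρ * d) := by
  rw [lieRatio, ← ENNReal.ofReal_add hr hρ.le, ENNReal.ofReal_mul (by positivity),
    ENNReal.ofReal_div_of_pos hρ, ENNReal.ofReal_ofNat]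
  exact mul_le_mul_right hF _

/-! ### The fourth order normal form -/

theorem eta_nonneg {m : ℝ} (hm : -1 / 2 ≤ m) (w : Weight) (r : ℝ) : 0 ≤ eta m w r := by
  have h1 := cfrak_pos hm
  have h2 := mu_pos hm
  rw [eta]
  positivity

/-- The bound is `(44/22) · (11/10 · 5/11)² = 1/2`. -/
theorem eta_le_half {m : ℝ} (hm : -1 / 2 ≤ m) {w : Weight} {r : ℝ} (hgam : gam m w r ≤
    5 / 11 * √(Real.pi * mu m / (22 * Real.exp 1 * cfrak m))) : eta m w r ≤ 1 / 2 := by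
  have h1 := cfrak_pos hm
  have h2 := mu_pos hm
  have h3 := Real.exp_pos 1
  have h4 := Real.pi_pos
  have h5 : gam m w r ^ 2 ≤ (5 / 11) ^ 2 * (Real.pi * mu m / (22 * Real.exp 1 * cfrak m)) := by
    refine (pow_le_pow_left₀ (gam_nonneg m w r) hgam 2).trans (le_of_eq ?_)
    rw [mul_pow, Real.sq_sqrt (by positivity)]
  calc eta m w r = 44 * Real.exp 1 * cfrak m / (Real.pi * mu m) * (121 / 100) *
        gam m w r ^ 2 := by
        rw [eta]
        ring
    _ ≤ 44 * Real.exp 1 * cfrak m / (Real.pi * mu m) * (121 / 100) *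
        ((5 / 11) ^ 2 * (Real.pi * mu m / (22 * Real.exp 1 * cfrak m))) := by gcongr
    _ = 1 / 2 := by
        field_simp
        norm_num

theorem Cr_nonneg {m : ℝ} (hm : -1 / 2 ≤ m) {w : Weight} {r : ℝ} (h : eta m w r ≤ 1 / 2) :
    0 ≤ Cr m w r := by
  have h1 := cfrak_pos hm
  have h2 := eta_nonneg hm w r
  rw [Cr]
  have h3 : 0 ≤ eta m w r / (1 - eta m w r) := div_nonneg h2 (by linarith)
  positivity

/-- Besides the normal form, the terms of `R` of degree other than six are bounded with a factor
`η²`. The bound `C_r`, whose factor is only linear in `η`, would be too weak for the remainder of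
the sixth order step. -/
theorem exists_fourthOrderNF {m : ℝ} (hm : -1 / 2 ≤ m) (w : Weight) {r : ℝ} (hr : 0 < r)
    (hη : eta m w r ≤ 1 / 2) : ∃ (Ψ : ℝ → HSpace w → HSpace w) (R : Ham),
      IsFourthOrderNF m w r Ψ R ∧ Good R ∧
      fldSup w (ENNReal.ofReal r) (fun p => if deg p = 6 then 0 else R p) ≤
        ENNReal.ofReal (33 / 80 * (cfrak m / (Real.pi * Real.exp 1)) * (11 * gam m w r / 10) ^ 2 *
          (eta m w r ^ 2 / (1 - eta m w r / 2)) * r) := by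
  have hc := cfrak_pos hm
  have hmu := mu_pos hm
  have he := Real.exp_pos 1
  have he1 : 1 ≤ Real.exp 1 := Real.one_le_exp zero_le_one
  have hπ := Real.pi_pos
  have hη0 := eta_nonneg hm w r
  set g := gam m w r with hg
  have hg0 : 0 ≤ g := gam_nonneg m w r
  set b := cfrak m / Real.pi * (11 * g / 10) ^ 2 * (11 * r / 10) with hb
  have hb0 : 0 ≤ b := by positivity
  -- This is `b / μ`: the bound `b` for the field of `G` at radius `11r/10`, divided by the lower
  -- bound of the divisors.
  set d := eta m w r * r / (40 * Real.exp 1) with hd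
  have hd0 : 0 ≤ d := by positivity
  have hbd : (mu m)⁻¹ * b = d := by
    rw [hb, hd, eta]
    field_simp
    ring
  have h8d : 8 * d ≤ r / 10 := by
    rw [hd, mul_div_assoc', div_le_div_iff₀ (by positivity) (by norm_num)]
    nlinarith [mul_le_mul hη he1 zero_le_one (by norm_num), mul_pos hr he]
  have hrr : 0 ≤ r + r / 10 := by positivity
  have hG := good_quarticHam m
  have hS := good_S4 m
  have hGb : fldSup w (ENNReal.ofReal (r + r / 10)) (quarticHam m) ≤ ENNReal.ofReal b := by
    refine (fldSup_quarticHam_le hm w hrr).trans (ENNReal.ofReal_le_ofReal ?_)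
    have h1 := gam_mul_le hm w (s := 11 / 10) (by norm_num) hr.le
    rw [show 11 / 10 * r = r + r / 10 by ring] at h1
    have h2 : gam m w (r + r / 10) ^ 2 ≤ (11 * g / 10) ^ 2 :=
      pow_le_pow_left₀ (gam_nonneg _ _ _) (by linarith) 2
    rw [hb, show 11 * r / 10 = r + r / 10 by ring]
    gcongr
  have hSd : fldSup w (ENNReal.ofReal (r + r / 10)) (S4 m) ≤ ENNReal.ofReal d := by
    refine (fldSup_le_mul w _ (enorm_S4_le hm)).trans ?_
    rw [← hbd, ENNReal.ofReal_mul (by positivity)]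
    exact mul_le_mul_right hGb _
  set N : Ham := fun p => diagPart (quarticHam m) p - quarticHam m p with hN
  have hNG : N = fun p => -if p.1 ≠ p.2 then quarticHam m p else 0 := by
    funext p
    simp only [hN, diagPart]
    by_cases h : p.1 = p.2 <;> simp [h]
  have hNgood : Good N := by
    rw [hNG]
    exact (hG.ite (fun p => p.1 ≠ p.2) fun α β h => Ne.symm h).neg
  have hNle : ∀ p, ‖N p‖ₑ ≤ ‖quarticHam m p‖ₑ := fun p => by
    rw [hNG]
    by_cases h : p.1 = p.2 <;> simp [h]
  have hNb : fldSup w (ENNReal.ofReal (r + r / 10)) N ≤ ENNReal.ofReal b :=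
    (fldSup_le_of_enorm_le w hNle).trans hGb
  have hρ0 : ENNReal.ofReal (r / 10) ≠ 0 := by simpa using hr
  have hadd : ENNReal.ofReal r + ENNReal.ofReal (r / 10) = ENNReal.ofReal (r + r / 10) :=
    (ENNReal.ofReal_add hr.le (by positivity)).symm
  have htop : ∀ {x : ℝ≥0∞} {y : ℝ}, x ≤ ENNReal.ofReal y → x ≠ ⊤ :=
    fun h => ne_top_of_le_ne_top ENNReal.ofReal_ne_top h
  have hratio : lieRatio w (ENNReal.ofReal r) (ENNReal.ofReal (r / 10)) (S4 m) ≤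
      ENNReal.ofReal (eta m w r / 2 / Real.exp 1) := by
    refine (lieRatio_le hr.le (by positivity) hSd).trans (le_of_eq ?_)
    rw [hd]
    congr 1
    field_simp
    ring
  have hbound : ∀ (f : Ham) (n : ℕ),
      (∀ p, ‖f p‖ₑ ≤ ∑' k, ‖lieTerm (S4 m) (quarticHam m) N (k + n) p‖ₑ) →
      fldSup w (ENNReal.ofReal r) f ≤ ENNReal.ofReal (eta m w r / 2 / Real.exp 1 *
        ((eta m w r / 2) ^ n / (1 - eta m w r / 2)) * (b + b / 2)) := fun f n hf =>
    fldSup_le_of_le_tsum_lieTerm w hS hG hNgood hρ0 ENNReal.ofReal_ne_top (by positivity)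
      (by linarith) hb0 hb0 rfl (by rw [hadd]; exact htop hSd) hratio (by rwa [hadd])
      (by rwa [hadd]) n hf
  obtain ⟨Ψ, hΨ, -⟩ := exists_hamFlow hr.le hd0 (by linarith) hSd
  set R := lieRem (S4 m) (quarticHam m) N with hR
  have hRgood : Good R := hS.lieRem hG hNgood
  have hS4deg : ∀ p, S4 m p ≠ 0 → deg p = 4 := fun p hp =>
    deg_of_quarticHam_ne_zero (quarticHam_ne_zero_of_S4 hp)
  have hNdeg : ∀ p, N p ≠ 0 → deg p = 4 := fun p hp =>
    deg_of_quarticHam_ne_zero (m := m) fun h => hp <| by simp [hNG, h]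
  have hGdeg : ∀ p, quarticHam m p ≠ 0 → deg p = 4 := fun p => deg_of_quarticHam_ne_zero
  have hRfld : fldSup w (ENNReal.ofReal r) R ≤ ENNReal.ofReal (Cr m w r * r) := by
    refine (hbound R 0 fun p => enorm_tsum_le_tsum_enorm).trans (ENNReal.ofReal_le_ofReal ?_)
    -- The Lie series yields the constant `33/40` and the ratio `η/2`; the claimed `C_r` is weaker
    -- than this.
    have h1 : 33 / 40 / (1 - eta m w r / 2) ≤ 3 / 2 / (1 - eta m w r) := by
      rw [div_le_div_iff₀ (by linarith) (by linarith)]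
      linarith
    have h2 := mul_le_mul_of_nonneg_left h1 (by positivity :
      0 ≤ cfrak m / (Real.pi * Real.exp 1) * eta m w r * (11 * g / 10) ^ 2 * r)
    have h3 : 1 - eta m w r / 2 ≠ 0 := by linarith
    have h4 : 1 - eta m w r ≠ 0 := by linarith
    refine le_trans (le_of_eq ?_) (h2.trans (le_of_eq ?_))
    · rw [hb, pow_zero]
      field_simp
      ring
    · rw [Cr, ← hg]
      field_simp
  have hmem := hRgood.memHam hr (hRfld.trans_lt ENNReal.ofReal_lt_top)
  refine ⟨Ψ, R, ⟨hS.memHam (by positivity) (hSd.trans_lt ENNReal.ofReal_lt_top),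
    isHamFlow_of_hasDerivWithinAt hr.le hd0 (by linarith) (hSd.trans_lt ENNReal.ofReal_lt_top) hΨ,
    hmem, ?_, ?_, hRgood.even, ?_⟩, hRgood, ?_⟩
  · rw [hamNorm_eq w hr.le, ← ENNReal.div_eq_inv_mul]
    refine ENNReal.div_le_of_le_mul ?_
    rwa [← ENNReal.ofReal_mul (Cr_nonneg hm hη)]
  · intro p hp
    exact le_deg_of_lieRem_ne_zero (a := 2) (b := 4) (fun p hp => (hS4deg p hp).ge)
      (fun p hp => (hGdeg p hp).ge) (fun p hp => (hNdeg p hp).ge) hp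
  · intro z hz hen
    obtain ⟨h0, hder, hdist⟩ := hΨ z hz
    obtain ⟨h1, h2⟩ := lie_step hr.le hd0 (by positivity) h8d hS hG hNgood hSd (htop hGb)
      (htop hNb) (bracket_S4_lamHam hm) hz h0 hder hdist hen
    refine ⟨h1, ?_⟩
    have hz' := (mem_ball_iff_enorm hr.le).1 hz
    have hGr := htop ((fldSup_mono w (ENNReal.ofReal_le_ofReal
      (by linarith : r ≤ r + r / 10)) _).trans hGb)
    have hNr := htop ((fldSup_mono w (ENNReal.ofReal_le_ofReal
      (by linarith : r ≤ r + r / 10)) _).trans hNb)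
    have h3 : (quarticHam m).eval z + N.eval z = (Gbar m z : ℂ) := by
      rw [← eval_diagPart_quarticHam hm, ← eval_add (hG.summable_mon ENNReal.ofReal_ne_top hGr hz')
        (hNgood.summable_mon ENNReal.ofReal_ne_top hNr hz')]
      congr 1
      funext p
      rw [hN]
      ring
    rw [eval_quarticHam hm] at h2
    rw [Hbeam, Complex.ofReal_add, h2, ← h3]
    ring
  -- The leading Lie term is homogeneous of degree `4 + 4 - 2 = 6`, so coefficients of any other
  -- degree come from the terms with `k ≥ 1`.
  · refine (hbound _ 1 fun p => ?_).trans (le_of_eq ?_)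
    · split_ifs with h
      · simp
      · have h0 : lieTerm (S4 m) (quarticHam m) N 0 p = 0 := by
          by_contra h0
          have := deg_of_lieTerm_zero_ne_zero hS4deg hGdeg hNdeg h0
          omega
        refine (enorm_tsum_le_tsum_enorm).trans ?_
        rw [tsum_eq_zero_add' ENNReal.summable, h0, enorm_zero, zero_add]
    · rw [hb]
      congr 1
      have h3 : 1 - eta m w r / 2 ≠ 0 := by linarith
      field_simp
      ring

/-! ### The resonant part of degree six -/

theorem exists_eq_single_add_of_degree {α : ℕ+ →₀ ℕ} {n : ℕ} (h : α.degree = n + 1) :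
    ∃ i β, α = Finsupp.single i 1 + β ∧ β.degree = n := by
  obtain ⟨i, hi⟩ : ∃ i, α i ≠ 0 := by
    by_contra! h0
    rw [Finsupp.ext (g := 0) h0, map_zero] at h
    omega
  have e : Finsupp.single i 1 + (α - Finsupp.single i 1) = α :=
    add_tsub_cancel_of_le (Finsupp.single_le_iff.2 (Nat.one_le_iff_ne_zero.2 hi))
  refine ⟨i, _, e.symm, ?_⟩
  rw [← e, map_add, Finsupp.degree_single] at h
  omega

/-- The multi-index `e_i + e_j + e_k`. -/
def tripleIdx (q : ℕ+ × ℕ+ × ℕ+) : ℕ+ →₀ ℕ :=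
  Finsupp.single q.1 1 + Finsupp.single q.2.1 1 + Finsupp.single q.2.2 1

theorem exists_tripleIdx_eq (α : ℕ+ →₀ ℕ) (h : α.degree = 3) : ∃ q, tripleIdx q = α := by
  obtain ⟨i, α₁, rfl, h₁⟩ := exists_eq_single_add_of_degree h
  obtain ⟨j, α₂, rfl, h₂⟩ := exists_eq_single_add_of_degree h₁
  obtain ⟨k, α₃, rfl, h₃⟩ := exists_eq_single_add_of_degree h₂
  rw [Finsupp.degree_eq_zero_iff] at h₃
  exact ⟨(i, j, k), by simp [tripleIdx, h₃, add_assoc]⟩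

theorem mon_tripleIdx (q : ℕ+ × ℕ+ × ℕ+) (z : ℕ+ → ℂ) : mon (tripleIdx q, tripleIdx q) z =
    ((‖z q.1‖ ^ 2 * ‖z q.2.1‖ ^ 2 * ‖z q.2.2‖ ^ 2 : ℝ) : ℂ) := by
  have e : (tripleIdx q, tripleIdx q) = diagIdx q.1 + diagIdx q.2.1 + diagIdx q.2.2 := rfl
  rw [e, mon_add, mon_add, mon_diagIdx, mon_diagIdx, mon_diagIdx]
  push_cast
  rfl

/-- A Hamiltonian that depends only on the actions and is homogeneous of degree six is a sum of
monomials `|z_i|² |z_j|² |z_k|²`. -/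
theorem exists_hasSum_actions {f : Ham} (hf : Good f) (hdeg : ∀ p, f p ≠ 0 → deg p = 6)
    (hdiag : ∀ p, f p ≠ 0 → p.1 = p.2) : ∃ A : ℕ+ → ℕ+ → ℕ+ → ℝ, ∀ z : ℕ+ → ℂ,
      (Summable fun p => f p * mon p z) → HasSum (fun q : ℕ+ × ℕ+ × ℕ+ =>
        ((A q.1 q.2.1 q.2.2 * ‖z q.1‖ ^ 2 * ‖z q.2.1‖ ^ 2 * ‖z q.2.2‖ ^ 2 : ℝ) : ℂ))
        (f.eval z) := by
  classical
  -- One ordered triple is chosen for each multi-index of degree three and receives the whole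
  -- coefficient; the other orderings get `0`. The coefficients `A` are thus not symmetric.
  choose t ht using fun α : {α : ℕ+ →₀ ℕ // α.degree = 3} => exists_tripleIdx_eq α.1 α.2
  have htinj : Function.Injective t := fun a b h => Subtype.ext (by rw [← ht a, ← ht b, h])
  let A : ℕ+ × ℕ+ × ℕ+ → ℝ := fun q =>
    if q ∈ Set.range t then (f (tripleIdx q, tripleIdx q)).re else 0
  refine ⟨fun i j k => A (i, j, k), fun z hz => ?_⟩
  have hreal : ∀ α, ((f (α, α)).re : ℂ) = f (α, α) := fun α =>
    Complex.conj_eq_iff_re.1 (hf.real α α).symm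
  rw [← htinj.hasSum_iff]
  · have hdinj : Function.Injective fun α : {α : ℕ+ →₀ ℕ // α.degree = 3} => (α.1, α.1) :=
      fun a b h => Subtype.ext (congrArg Prod.fst h)
    have h1 : HasSum (fun p => f p * mon p z) (f.eval z) := hz.hasSum
    rw [← hdinj.hasSum_iff] at h1
    · convert h1 using 1
      funext α
      have e : A (t α) = (f (α.1, α.1)).re := by
        simp only [A, if_pos (Set.mem_range_self α), ht]
      simp only [Function.comp_apply, Prod.mk.eta]
      have e' := mon_tripleIdx (t α) z
      rw [ht] at e'
      rw [e, e']
      conv_rhs => rw [← hreal α.1]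
      push_cast
      ring
    · intro p hp
      by_contra h0
      have h2 := left_ne_zero_of_mul h0
      have h3 := hdiag p h2
      have h4 := hdeg p h2
      rw [deg_eq, ← h3] at h4
      exact hp ⟨⟨p.1, by omega⟩, Prod.ext rfl h3⟩
  · intro q hq
    simp only [A, Prod.mk.eta, if_neg hq, zero_mul, Complex.ofReal_zero]

theorem Good.Rbar {f : Ham} (m : ℝ) (hf : Good f) : Good (Rbar m f) := by
  classical
  refine hf.ite (fun p => deg p = 6 ∧ divisor m p = 0) fun α β h => ?_
  rw [deg_swap, divisor_swap, h.2, neg_zero]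
  exact ⟨h.1, rfl⟩

theorem Rbar_ne_zero {m : ℝ} {f : Ham} {p : MIdx} (hp : Rbar m f p ≠ 0) :
    deg p = 6 ∧ divisor m p = 0 ∧ f p ≠ 0 := by
  rw [Rbar] at hp
  split_ifs at hp with h
  · exact ⟨h.1, h.2, hp⟩
  · exact absurd rfl hp

theorem enorm_Rbar_le (m : ℝ) (f : Ham) (p : MIdx) : ‖Rbar m f p‖ₑ ≤ ‖f p‖ₑ := by
  rw [Rbar]
  split_ifs
  · exact le_rfl
  · simp

theorem fst_eq_snd_of_divisor_eq_zero {m : ℝ} (hm : -1 / 2 ≤ m) (hm1 : m ≤ 1) (hm0 : m ≠ 0)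
    {p : MIdx} (he : ∀ j, Even (p.1 j + p.2 j)) (hd : deg p = 6) (h : divisor m p = 0) :
    p.1 = p.2 := by
  by_contra hp
  have := abs_le_abs_divisor hm hm1 he hd hp
  rw [h, abs_zero] at this
  have := abs_pos.2 hm0
  linarith

/-! ### The generating function of the sixth order step -/

theorem Good.S6 {f : Ham} (m : ℝ) (hf : Good f) : Good (S6 m f) where
  real α β := by
    rw [Beam.S6, Beam.S6, deg_swap α β, divisor_swap m α β]
    by_cases h : deg (α, β) = 6 ∧ divisor m (α, β) ≠ 0
    · rw [if_pos h, if_pos ⟨h.1, neg_ne_zero.2 h.2⟩, map_div₀, map_mul, Complex.conj_I,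
        Complex.conj_ofReal, ← hf.real α β]
      push_cast
      rw [div_neg, neg_mul, neg_div, neg_neg]
    · rw [if_neg h, if_neg fun h' => h ⟨h'.1, neg_ne_zero.1 h'.2⟩, map_zero]
  even p hp := hf.even p fun h => hp (by simp [Beam.S6, h])
  zero := by simp [Beam.S6, hf.zero]

theorem deg_of_S6_ne_zero {m : ℝ} {f : Ham} {p : MIdx} (hp : S6 m f p ≠ 0) : deg p = 6 := by
  rw [S6] at hp
  split_ifs at hp with h
  · exact h.1
  · exact absurd rfl hp

theorem enorm_S6_le {m : ℝ} (hm : -1 / 2 ≤ m) (hm1 : m ≤ 1) (hm0 : m ≠ 0) {f : Ham} (hf : Good f)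
    (p : MIdx) : ‖S6 m f p‖ₑ ≤ ENNReal.ofReal (8 / (7 * |m|)) * ‖f p‖ₑ := by
  have h0 := abs_pos.2 hm0
  rw [← ofReal_norm, ← ofReal_norm, ← ENNReal.ofReal_mul (by positivity)]
  refine ENNReal.ofReal_le_ofReal ?_
  rw [S6]
  split_ifs with h
  · by_cases hp : f p = 0
    · simp [hp]
    have h1 := abs_le_abs_divisor hm hm1 (hf.even p hp) h.1 fun h' =>
      h.2 (divisor_eq_zero_of_eq m h')
    rw [norm_div, norm_mul, Complex.norm_I, one_mul, Complex.norm_real, Real.norm_eq_abs,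
      div_eq_inv_mul, ← inv_div]
    gcongr
  · rw [norm_zero]
    positivity

open Classical in
theorem bracket_S6_lamHam (m : ℝ) (f : Ham) : bracket (S6 m f) (lamHam m) =
    fun p => -if deg p = 6 ∧ divisor m p ≠ 0 then f p else 0 := by
  funext p
  rw [bracket_lamHam, S6]
  split_ifs with h
  · have h1 : (divisor m p : ℂ) ≠ 0 := by exact_mod_cast h.2
    rw [mul_div_assoc', div_eq_iff h1]
    linear_combination (divisor m p : ℂ) * f p * Complex.I_mul_I
  · simp

/-! ### The sixth order normal form -/

theorem abs_le_mu {m : ℝ} (hm : -1 / 2 ≤ m) (hm1 : m ≤ 1) : 7 / 5 * |m| ≤ mu m := by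
  have h0 := abs_nonneg m
  have h1 : |m| ≤ 1 := abs_le.2 ⟨by linarith, hm1⟩
  have h2 : |m| ^ 2 = m ^ 2 := sq_abs m
  refine le_min ?_ ?_
  · have : 7 / 10 * |m| ≤ √(1 + m) := Real.le_sqrt_of_sq_le (by nlinarith)
    linarith
  · have : 14 / 15 * |m| ≤ √(4 + m) := Real.le_sqrt_of_sq_le (by nlinarith)
    linarith

/-- Expressing `(11γ/10)²` through `η` shows that `η̃ = (12/(7e)) η² (μ/|m|) / (1 - η)`, and `μ/|m|
≥ 7/5`. Terms of order `η²` can thus be charged to `η̃`. -/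
theorem etaTilde_ge {m : ℝ} (hm : -1 / 2 ≤ m) (hm1 : m ≤ 1) (hm0 : m ≠ 0) {w : Weight} {r rr : ℝ}
    (hrr : 11 * rr / 10 = r) (hη : eta m w r ≤ 1 / 2) :
    12 / 5 / Real.exp 1 * eta m w r ^ 2 ≤ etaTilde m w rr := by
  have hc := cfrak_pos hm
  have hmu := mu_pos hm
  have he := Real.exp_pos 1
  have hπ := Real.pi_pos
  have hη0 := eta_nonneg hm w r
  have h0 := abs_pos.2 hm0
  have h1 : etaTilde m w rr = 12 / 7 / Real.exp 1 * eta m w r ^ 2 * (mu m / |m|) *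
      (1 - eta m w r)⁻¹ := by
    have hX : (11 * gam m w r / 10) ^ 2 = eta m w r * (Real.pi * mu m / (44 * Real.exp 1 * cfrak m)) := by
      rw [eta]
      field_simp
    have h4 : 1 - eta m w r ≠ 0 := by linarith
    rw [etaTilde, hrr, Cr, hX]
    generalize eta m w r = η at *
    field_simp
    ring
  have h2 : 7 / 5 ≤ mu m / |m| := by
    rw [le_div_iff₀ h0]
    exact abs_le_mu hm hm1
  have h3 : 1 ≤ (1 - eta m w r)⁻¹ := by
    rw [one_le_inv₀ (by linarith)]
    linarith
  rw [h1]
  calc 12 / 5 / Real.exp 1 * eta m w r ^ 2 = 12 / 7 / Real.exp 1 * eta m w r ^ 2 * (7 / 5) * 1 := by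
        ring
    _ ≤ _ := by gcongr

/-- The middle summand of `C̃` alone suffices, the others being nonnegative. With `e < 3`, the
coefficient of `η̃ a / e` is about `0.92 + 11/15 < 2`, and that of `η̃ C_r / e` is `11/10 < 2`. -/
theorem remainder_le_CrTilde {m : ℝ} (hm : -1 / 2 ≤ m) (hm1 : m ≤ 1) (hm0 : m ≠ 0) (w : Weight)
    {r rr : ℝ} (hrr0 : 0 < rr) (hrr : 11 * rr / 10 = r) (hη : eta m w r ≤ 1 / 2)
    (heta : etaTilde m w rr ≤ 1 / 2) :
    33 / 80 * (cfrak m / (Real.pi * Real.exp 1)) * (11 * gam m w r / 10) ^ 2 *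
        (eta m w r ^ 2 / (1 - eta m w r / 2)) * r +
      etaTilde m w rr / 2 / Real.exp 1 *
        ((etaTilde m w rr / 2) ^ 0 / (1 - etaTilde m w rr / 2)) *
        ((cfrak m / Real.pi * gam m w r ^ 2 + 3 / 2 * Cr m w r) * r) ≤ CrTilde m w rr * rr := by
  have hc := cfrak_pos hm
  have hmu := mu_pos hm
  have he := Real.exp_pos 1
  have he3 := Real.exp_one_lt_three
  have hπ := Real.pi_pos
  have hη0 := eta_nonneg hm w r
  have hC := Cr_nonneg hm hη
  have hg := gam_nonneg m w r
  have h0 := abs_pos.2 hm0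
  have hge := etaTilde_ge hm hm1 hm0 (w := w) hrr hη
  have hθ0 : 0 ≤ etaTilde m w rr := by
    rw [etaTilde, hrr]
    positivity
  set θ := etaTilde m w rr with hθ
  set a := cfrak m / Real.pi * gam m w r ^ 2 with ha
  have ha0 : 0 ≤ a := by positivity
  have h1 : eta m w r ^ 2 / (1 - eta m w r / 2) ≤ 4 / 3 * eta m w r ^ 2 := by
    rw [div_le_iff₀ (by linarith)]
    nlinarith [sq_nonneg (eta m w r)]
  have h2 : (θ / 2) ^ 0 / (1 - θ / 2) ≤ 4 / 3 := by
    rw [pow_zero, div_le_iff₀ (by linarith)]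
    linarith
  have h3 : eta m w r ^ 2 / Real.exp 1 ≤ 5 / 12 * θ := by
    have : 12 / 5 / Real.exp 1 * eta m w r ^ 2 = 12 / 5 * (eta m w r ^ 2 / Real.exp 1) := by ring
    linarith
  have h4 : θ / 3 ≤ θ / Real.exp 1 := div_le_div_of_nonneg_left hθ0 he he3.le
  have h5 : 2 / Real.exp 1 * θ * (a + Cr m w r) ≤ CrTilde m w rr := by
    rw [CrTilde, hrr, ← hθ, ← ha]
    have p1 : 0 ≤ 1 / (44 * Real.exp 1 ^ 2) * θ ^ 2 := by positivity
    have p2 : 0 ≤ 16 * cfrak m / (3 * Real.exp 1 ^ 2 * Real.pi ^ 3) *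
      (gam m w r ^ 6 / mu m ^ 2) * (1 + 2 * θ / Real.exp 1) := by positivity
    linarith
  have h6 := mul_le_mul_of_nonneg_right h5 hrr0.le
  have h7 : eta m w r ^ 2 / (1 - eta m w r / 2) / Real.exp 1 ≤ 5 / 9 * θ := by
    have := div_le_div_of_nonneg_right h1 he.le
    have e1 : 4 / 3 * eta m w r ^ 2 / Real.exp 1 = 4 / 3 * (eta m w r ^ 2 / Real.exp 1) := by ring
    linarith
  have h8 := mul_le_mul_of_nonneg_left h7 (by positivity : 0 ≤ 43923 / 80000 * a * rr)
  have h9 := mul_le_mul_of_nonneg_left h2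
    (by positivity : 0 ≤ θ / 2 / Real.exp 1 * ((a + 3 / 2 * Cr m w r) * (11 * rr / 10)))
  have h10 := mul_le_mul_of_nonneg_left h4 (by positivity : 0 ≤ a * rr)
  have h11 : 0 ≤ θ / Real.exp 1 * Cr m w r * rr := by positivity
  have h12 : 0 ≤ θ / Real.exp 1 * a * rr := by positivity
  have e1 : 33 / 80 * (cfrak m / (Real.pi * Real.exp 1)) * (11 * gam m w r / 10) ^ 2 *
      (eta m w r ^ 2 / (1 - eta m w r / 2)) * r =
      -- `43923/80000 = (33/80) (11/10)² (11/10)`, the last factor coming from `r = 11 𝚛/10`.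
      43923 / 80000 * a * rr * (eta m w r ^ 2 / (1 - eta m w r / 2) / Real.exp 1) := by
    rw [ha, ← hrr]
    generalize eta m w (11 * rr / 10) ^ 2 / (1 - eta m w (11 * rr / 10) / 2) = x
    field_simp
    ring
  have e2 : θ / 2 / Real.exp 1 * ((θ / 2) ^ 0 / (1 - θ / 2)) * ((a + 3 / 2 * Cr m w r) * r) =
      θ / 2 / Real.exp 1 * ((a + 3 / 2 * Cr m w r) * (11 * rr / 10)) *
        ((θ / 2) ^ 0 / (1 - θ / 2)) := by
    rw [hrr]
    ring
  have e3 : θ / 2 / Real.exp 1 * ((a + 3 / 2 * Cr m w r) * (11 * rr / 10)) * (4 / 3) =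
      11 / 15 * (θ / Real.exp 1 * a * rr) + 11 / 10 * (θ / Real.exp 1 * Cr m w r * rr) := by
    ring
  have e4 : 2 / Real.exp 1 * θ * (a + Cr m w r) * rr =
      2 * (θ / Real.exp 1 * a * rr) + 2 * (θ / Real.exp 1 * Cr m w r * rr) := by
    ring
  rw [e1, e2]
  nlinarith [h6, h8, h9, h10, h11, h12, e3, e4]

theorem exists_sixthOrderNF {m : ℝ} (hm : -1 / 2 ≤ m) (hm1 : m ≤ 1) (hm0 : m ≠ 0) (w : Weight)
    {r rr : ℝ} (hr : 0 < r) (hrr : 11 * rr / 10 = r) (hη : eta m w r ≤ 1 / 2)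
    (heta : etaTilde m w rr ≤ 1 / 2) {Ψ : ℝ → HSpace w → HSpace w} {R : Ham}
    (hNF : IsFourthOrderNF m w r Ψ R) (hR : Good R)
    (hR8 : fldSup w (ENNReal.ofReal r) (fun p => if deg p = 6 then 0 else R p) ≤
      ENNReal.ofReal (33 / 80 * (cfrak m / (Real.pi * Real.exp 1)) * (11 * gam m w r / 10) ^ 2 *
        (eta m w r ^ 2 / (1 - eta m w r / 2)) * r)) :
    MemHam w r (S6 m R) ∧
    ∃ (Φ : ℝ → HSpace w → HSpace w) (RR : Ham),
      IsHamFlow w (S6 m R) rr (rr / 10) Φ ∧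
      (∀ z ∈ ball w rr, ‖Φ 1 z - z‖ ≤ 1 / (80 * Real.exp 1) * rr ∧
        ‖Φ (-1) z - z‖ ≤ 1 / (80 * Real.exp 1) * rr) ∧
      (∀ z ∈ ball w ((1 - 1 / (80 * Real.exp 1)) * rr),
        Φ 1 (Φ (-1) z) = z ∧ Φ (-1) (Φ 1 z) = z) ∧
      (∀ z ∈ ball w rr, FiniteEnergy m z → FiniteEnergy m (Φ 1 z) ∧
        FiniteEnergy m (Ψ 1 (Φ 1 z)) ∧
        (Hbeam m (Ψ 1 (Φ 1 z)) : ℂ) = Lam m z + Gbar m z + (Rbar m R).eval z + RR.eval z) ∧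
      MemHam w rr RR ∧
      hamNorm w rr RR ≤ ENNReal.ofReal (CrTilde m w rr) ∧
      (∀ p, RR p ≠ 0 → 8 ≤ deg p) ∧
      EvenIndex RR := by
  classical
  have hc := cfrak_pos hm
  have hmu := mu_pos hm
  have he := Real.exp_pos 1
  have he1 : 1 ≤ Real.exp 1 := Real.one_le_exp zero_le_one
  have hπ := Real.pi_pos
  have hη0 := eta_nonneg hm w r
  have hC := Cr_nonneg hm hη
  have h0 := abs_pos.2 hm0
  have hrr0 : 0 < rr := by linarith
  have hsum : rr + rr / 10 = r := by linarith
  have htop : ∀ {x : ℝ≥0∞} {y : ℝ}, x ≤ ENNReal.ofReal y → x ≠ ⊤ :=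
    fun h => ne_top_of_le_ne_top ENNReal.ofReal_ne_top h
  set θ := etaTilde m w rr with hθ
  have hθ0 : 0 ≤ θ := by
    rw [hθ, etaTilde, hrr]
    positivity
  -- The field of `𝓢` is bounded by `η̃ 𝚛 / (40e)`, and `η̃ ≤ 1/2`.
  set d := 1 / (80 * Real.exp 1) * rr with hd
  have hd0 : 0 ≤ d := by positivity
  have h8d : 8 * d ≤ rr / 10 := by
    have : 1 / (80 * Real.exp 1) ≤ 1 / 80 := by
      apply one_div_le_one_div_of_le <;> linarith
    have := mul_le_mul_of_nonneg_right this hrr0.le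
    linarith
  have hRr : fldSup w (ENNReal.ofReal r) R ≤ ENNReal.ofReal (Cr m w r * r) := by
    rw [fldSup_eq w hr, ENNReal.ofReal_mul hC, mul_comm]
    exact mul_le_mul_left hNF.bound _
  have hS := hR.S6 m
  have hSd' : fldSup w (ENNReal.ofReal r) (S6 m R) ≤
      ENNReal.ofReal (θ / (40 * Real.exp 1) * rr) := by
    refine (fldSup_le_mul w _ (enorm_S6_le hm hm1 hm0 hR)).trans ?_
    refine (mul_le_mul_right hRr _).trans (le_of_eq ?_)
    rw [← ENNReal.ofReal_mul (by positivity), hθ, etaTilde, hrr, ← hrr]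
    congr 1
    field_simp
    ring
  have hSd : fldSup w (ENNReal.ofReal (rr + rr / 10)) (S6 m R) ≤ ENNReal.ofReal d := by
    rw [hsum]
    refine hSd'.trans (ENNReal.ofReal_le_ofReal ?_)
    rw [hd]
    refine mul_le_mul_of_nonneg_right ?_ hrr0.le
    rw [div_le_div_iff₀ (by positivity) (by positivity)]
    nlinarith
  set K : Ham := fun p => diagPart (quarticHam m) p + R p with hK
  set N : Ham := fun p => -if deg p = 6 ∧ divisor m p ≠ 0 then R p else 0 with hN
  set R8 : Ham := fun p => if deg p = 6 then 0 else R p with hR8'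
  have hD := (good_quarticHam m).diagPart
  have hKg : Good K := hD.add hR
  have hNg : Good N := (hR.ite (fun p => deg p = 6 ∧ divisor m p ≠ 0) fun α β h => by
    rw [deg_swap, divisor_swap]
    exact ⟨h.1, neg_ne_zero.2 h.2⟩).neg
  have hR8e : R8 = fun p => if deg p ≠ 6 then R p else 0 := by
    funext p
    by_cases h : deg p = 6 <;> simp [hR8', h]
  have hR8g : Good R8 := by
    rw [hR8e]
    exact hR.ite (fun p => deg p ≠ 6) fun α β h => by rwa [deg_swap]
  set a := cfrak m / Real.pi * gam m w r ^ 2 with ha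
  have ha0 : 0 ≤ a := by positivity
  have hDb : fldSup w (ENNReal.ofReal r) (diagPart (quarticHam m)) ≤ ENNReal.ofReal (a * r) := by
    refine (fldSup_le_of_enorm_le w fun p => ?_).trans (fldSup_quarticHam_le hm w hr.le)
    rw [diagPart]
    split_ifs <;> simp
  have hKb : fldSup w (ENNReal.ofReal r) K ≤ ENNReal.ofReal ((a + Cr m w r) * r) := by
    refine (fldSup_add_le w (f := K) (g := diagPart (quarticHam m)) (h := R) 1 1 fun p => ?_).trans ?_
    · rw [one_mul, one_mul]
      exact enorm_add_le _ _
    · rw [one_mul, one_mul, add_mul, ENNReal.ofReal_add (by positivity) (by positivity)]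
      exact add_le_add hDb hRr
  have hNb : fldSup w (ENNReal.ofReal r) N ≤ ENNReal.ofReal (Cr m w r * r) := by
    refine (fldSup_le_of_enorm_le w fun p => ?_).trans hRr
    rw [hN]
    by_cases h : deg p = 6 ∧ divisor m p ≠ 0 <;> simp [h]
  have hRbarb : fldSup w (ENNReal.ofReal r) (Rbar m R) ≤ ENNReal.ofReal (Cr m w r * r) :=
    (fldSup_le_of_enorm_le w (enorm_Rbar_le m R)).trans hRr
  have hρ0 : ENNReal.ofReal (rr / 10) ≠ 0 := by simpa using hrr0
  have hadd : ENNReal.ofReal rr + ENNReal.ofReal (rr / 10) = ENNReal.ofReal r := by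
    rw [← ENNReal.ofReal_add hrr0.le (by positivity), hsum]
  have hratio : lieRatio w (ENNReal.ofReal rr) (ENNReal.ofReal (rr / 10)) (S6 m R) ≤
      ENNReal.ofReal (θ / 2 / Real.exp 1) := by
    refine (lieRatio_le hrr0.le (by positivity) (by rwa [hsum])).trans (le_of_eq ?_)
    congr 1
    field_simp
    ring
  set L := lieRem (S6 m R) K N with hL
  have hLg : Good L := hS.lieRem hKg hNg
  have hLb : fldSup w (ENNReal.ofReal rr) L ≤ ENNReal.ofReal (θ / 2 / Real.exp 1 *
      ((θ / 2) ^ 0 / (1 - θ / 2)) * ((a + 3 / 2 * Cr m w r) * r)) :=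
    fldSup_le_of_le_tsum_lieTerm w hS hKg hNg (b := (a + Cr m w r) * r)
      (c := Cr m w r * r) hρ0 ENNReal.ofReal_ne_top (by positivity)
      (by linarith) (by positivity) (by positivity) (by ring) (by rw [hadd]; exact htop hSd')
      hratio (by rwa [hadd]) (by rwa [hadd]) 0 fun p => enorm_tsum_le_tsum_enorm
  have hle : ENNReal.ofReal rr ≤ ENNReal.ofReal r := ENNReal.ofReal_le_ofReal (by linarith)
  have hRRg : Good fun p => R8 p + L p := hR8g.add hLg
  have hRRb : fldSup w (ENNReal.ofReal rr) (fun p => R8 p + L p) ≤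
      ENNReal.ofReal (CrTilde m w rr * rr) := by
    refine (fldSup_add_le w (g := R8) (h := L) 1 1 fun p => ?_).trans ?_
    · rw [one_mul, one_mul]
      exact enorm_add_le _ _
    · rw [one_mul, one_mul]
      refine (add_le_add ((fldSup_mono w hle R8).trans hR8) hLb).trans ?_
      have h1 : 0 < 1 - eta m w r / 2 := by linarith
      have h2 : 0 < 1 - θ / 2 := by linarith
      rw [← ENNReal.ofReal_add (by positivity) (by positivity)]
      exact ENNReal.ofReal_le_ofReal (remainder_le_CrTilde hm hm1 hm0 w hrr0 hrr hη heta)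
  obtain ⟨Φ, hΦ, hinv⟩ := exists_hamFlow hrr0.le hd0 (by linarith) hSd
  refine ⟨hS.memHam hr (hSd'.trans_lt ENNReal.ofReal_lt_top), Φ, fun p => R8 p + L p,
    isHamFlow_of_hasDerivWithinAt hrr0.le hd0 (by linarith) (hSd.trans_lt ENNReal.ofReal_lt_top) hΦ,
    fun z hz => ⟨(hΦ z hz).2.2 1, (hΦ z hz).2.2 (-1)⟩, fun z hz => hinv z ?_, ?_,
    hRRg.memHam hrr0 (hRRb.trans_lt ENNReal.ofReal_lt_top), ?_, ?_, hRRg.even⟩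
  · rwa [sub_mul, one_mul] at hz
  · intro z hz hen
    obtain ⟨hz0, hder, hdist⟩ := hΦ z hz
    obtain ⟨h1, h2⟩ := lie_step hrr0.le hd0 (by positivity) h8d hS hKg hNg hSd
      (by rw [hsum]; exact htop hKb) (by rw [hsum]; exact htop hNb) (bracket_S6_lamHam m R) hz hz0
      hder hdist hen
    have hΦr : Φ 1 z ∈ ball w r := by
      rw [mem_closedBall_zero_iff] at hz ⊢
      have := norm_le_norm_add_norm_sub' (Φ 1 z) z
      have := hdist 1
      linarith
    obtain ⟨h3, h4⟩ := hNF.conj_eq _ hΦr h1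
    refine ⟨h1, h3, ?_⟩
    have hev : ∀ y ∈ ball w r, ∀ {f : Ham} {c : ℝ}, Good f →
        fldSup w (ENNReal.ofReal r) f ≤ ENNReal.ofReal c → Summable fun p => f p * mon p y :=
      fun y hy f c hf hfc => hf.summable_mon ENNReal.ofReal_ne_top (htop hfc)
        ((mem_ball_iff_enorm hr.le).1 hy)
    have hKev : ∀ y ∈ ball w r, K.eval y = (Gbar m y : ℂ) + R.eval y := fun y hy => by
      rw [← eval_diagPart_quarticHam hm, ← eval_add (hev y hy hD hDb) (hev y hy hR hRr)]
    have hzr : z ∈ ball w r := by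
      rw [mem_closedBall_zero_iff] at hz ⊢
      linarith
    have hzrr := (mem_ball_iff_enorm hrr0.le).1 hz
    -- `R` splits into its resonant sextic part, its nonresonant sextic part, which `N` cancels, and
    -- the rest `R8`.
    have e1 : R.eval z + N.eval z = (Rbar m R).eval z + R8.eval z := by
      rw [← eval_add (hev z hzr hR hRr) (hev z hzr hNg hNb),
        ← eval_add (hev z hzr (hR.Rbar m) hRbarb) (hev z hzr hR8g hR8)]
      congr 1
      funext p
      simp only [hN, hR8', Rbar]
      by_cases hp : deg p = 6 <;> by_cases hp' : divisor m p = 0 <;> simp [hp, hp']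
    have e2 : Ham.eval (fun p => R8 p + L p) z = R8.eval z + L.eval z :=
      eval_add (hev z hzr hR8g hR8)
        (hLg.summable_mon ENNReal.ofReal_ne_top (htop hLb) hzrr)
    rw [h4, e2, add_assoc, ← hKev _ hΦr, h2, hKev z hzr]
    linear_combination e1
  · rw [hamNorm_eq w hrr0.le, ← ENNReal.div_eq_inv_mul]
    refine ENNReal.div_le_of_le_mul ?_
    rwa [← ENNReal.ofReal_mul' hrr0.le]
  · intro p hp
    by_cases h8 : R8 p = 0
    -- Bracketing with the sextic `𝓢` raises degrees by `4`, and `K` and `N` have degrees at least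
    -- `4`.
    · refine le_deg_of_lieRem_ne_zero (F := S6 m R) (K := K) (N := N) (a := 4) (b := 4)
        (fun p hp => (deg_of_S6_ne_zero hp).ge) (fun p hp => ?_) (fun p hp => ?_)
        (P := p) fun h => hp (by simp only [h8, hL, h, add_zero])
      · by_cases hRp : R p = 0
        · have h1 : quarticHam m p ≠ 0 := fun h1 => hp (by simp [hK, diagPart, h1, hRp])
          exact (deg_of_quarticHam_ne_zero h1).ge
        · have := hNF.six_le_deg p hRp
          omega
      · have := hNF.six_le_deg p fun h1 => hp (by simp [hN, h1])
        omega
    -- Degrees of `R` are even and at least six, so a degree other than six is at least eight.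
    · have h6 : deg p ≠ 6 := fun h6 => h8 (by simp [hR8', h6])
      have hRp : R p ≠ 0 := fun h => h8 (by simp [hR8', h])
      have := hNF.six_le_deg p hRp
      obtain ⟨k, hk⟩ := hR.even_deg hRp
      omega

end Beam

end

/-! ### Assembly of the two steps and integrability of the resonant part. -/

theorem mainTheorem4 (m : ℝ) (hm_lower : -1 / 2 ≤ m) (hm_upper : m ≤ 1) (hm_ne : m ≠ 0)
    (w : Beam.Weight) (r rr : ℝ) (hr : 0 < r) (hrr : rr = 10 * r / 11)
    (hgam : Beam.gam m w r ≤
      5 / 11 * √(Real.pi * Beam.mu m / (22 * Real.exp 1 * Beam.cfrak m)))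
    (heta : Beam.etaTilde m w rr ≤ 1 / 2) :
    ∃ (Ψ : ℝ → Beam.HSpace w → Beam.HSpace w) (R : Beam.Ham),
      Beam.IsFourthOrderNF m w r Ψ R ∧
      Beam.MemHam w r (Beam.S6 m R) ∧
      ∃ (Φ : ℝ → Beam.HSpace w → Beam.HSpace w) (RR : Beam.Ham),
        Beam.IsHamFlow w (Beam.S6 m R) rr (rr / 10) Φ ∧
        (∀ z ∈ Beam.ball w rr,
          ‖Φ 1 z - z‖ ≤ 1 / (80 * Real.exp 1) * rr ∧
          ‖Φ (-1) z - z‖ ≤ 1 / (80 * Real.exp 1) * rr) ∧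
        (∀ z ∈ Beam.ball w ((1 - 1 / (80 * Real.exp 1)) * rr),
          Φ 1 (Φ (-1) z) = z ∧ Φ (-1) (Φ 1 z) = z) ∧
        (∀ z ∈ Beam.ball w rr, Beam.FiniteEnergy m z →
          Beam.FiniteEnergy m (Φ 1 z) ∧ Beam.FiniteEnergy m (Ψ 1 (Φ 1 z)) ∧
          (Beam.Hbeam m (Ψ 1 (Φ 1 z)) : ℂ) =
            Beam.Lam m z + Beam.Gbar m z + (Beam.Rbar m R).eval z + RR.eval z) ∧
        Beam.MemHam w r (Beam.Rbar m R) ∧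
        (∃ A : ℕ+ → ℕ+ → ℕ+ → ℝ, ∀ z ∈ Beam.ball w r,
          HasSum (fun q : ℕ+ × ℕ+ × ℕ+ =>
            ((A q.1 q.2.1 q.2.2 * ‖z q.1‖ ^ 2 * ‖z q.2.1‖ ^ 2 * ‖z q.2.2‖ ^ 2 : ℝ) : ℂ))
            ((Beam.Rbar m R).eval z)) ∧
        Beam.MemHam w rr RR ∧
        Beam.hamNorm w rr RR ≤ ENNReal.ofReal (Beam.CrTilde m w rr) ∧
        (∀ p, RR p ≠ 0 → 8 ≤ Beam.deg p) ∧
        Beam.EvenIndex RR := by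
  have hη := Beam.eta_le_half hm_lower hgam
  have hrr' : 11 * rr / 10 = r := by
    rw [hrr]
    ring
  obtain ⟨Ψ, R, hNF, hR, hR8⟩ := Beam.exists_fourthOrderNF hm_lower w hr hη
  obtain ⟨hS, Φ, RR, h1, h2, h3, h4, h5, h6, h7, h8⟩ := Beam.exists_sixthOrderNF hm_lower hm_upper
    hm_ne w hr hrr' hη heta hNF hR hR8
  have hBfin : Beam.fldSup w (ENNReal.ofReal r) (Beam.Rbar m R) < ⊤ := by
    refine (Beam.fldSup_le_of_enorm_le w (Beam.enorm_Rbar_le m R)).trans_lt ?_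
    rw [Beam.fldSup_eq w hr]
    exact ENNReal.mul_lt_top ENNReal.ofReal_lt_top hNF.mem.norm_lt
  have hB := hR.Rbar m
  obtain ⟨A, hA⟩ := Beam.exists_hasSum_actions hB (fun p hp => (Beam.Rbar_ne_zero hp).1)
    fun p hp => Beam.fst_eq_snd_of_divisor_eq_zero hm_lower hm_upper hm_ne (hB.even p hp)
      (Beam.Rbar_ne_zero hp).1 (Beam.Rbar_ne_zero hp).2.1
  have hBmem := hB.memHam hr hBfin
  exact ⟨Ψ, R, hNF, hS, Φ, RR, h1, h2, h3, h4, hBmem,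
    ⟨A, fun z hz => hA z (hBmem.summable z hz).of_norm⟩, h5, h6, h7, h8⟩
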